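/- Let $(X_t)_{t\in\mathbb Z}$ be a strictly stationary real-valued time series with extremal index $\theta>0$, i.e. for every $\tau>0$ and all thresholds $w_n$ with $nP\{X_0>w_n\}\to\tau$ one has $P\{\max_{1\le i\le n}X_i\le w_n\}\to e^{-\theta\tau}$. Write $M_{i,j}:=\max(X_i,\dots,X_j)$, let $u_n\in\mathbb R$ be thresholds, $s_n\in\mathbb N$ block lengths, $v_n:=P\{X_1>u_n\}$, and $$\beta_{n,k}:=\sup_{1\le l\le n-k-1}E\Big[\sup_{B\in\sigma(X_{l+k+1},\dots,X_n)}\big|P(B\mid X_1,\dots,X_l)-P(B)\big|\Big],$$ where the conditional probabilities are taken from a regular version. Suppose that there are natural numbers $r_n$ and a real number $c$ such that the following conditions hold as $n\to\infty$. * ($\theta$1) $v_n\to0$, $nv_n\to\infty$, $s_n\to\infty$, $s_n=o(r_n)$, $r_nv_n\to0$, $r_n=o(\sqrt{nv_n})$ and $(n/r_n)\,\beta_{n,s_n-1}\to0$. * ($\theta$2) $\displaystyle c=\lim_{n\to\infty}\frac1{r_nv_n}E\Big[\Big(\sum_{j=1}^{r_n}\mathbf 1_{\{X_j>u_n\}}\Big)^2\Big]$.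 * ($\theta$P) There are real numbers $e_n(k)\ge P(X_k>u_n\mid X_0>u_n)$, $n,k\ge 1$, such that $\lim_{n}e_n(k)$ exists for every $k$ and $\lim_{n\to\infty}\sum_{k=1}^{r_n}e_n(k)=\sum_{k=1}^\infty\lim_{n\to\infty}e_n(k)<\infty$. Consider the disjoint blocks, the sliding blocks and the runs estimator $$\hat\theta_n^d:=\frac{\sum_{i=1}^{\lfloor n/s_n\rfloor}\mathbf 1_{\{M_{(i-1)s_n+1,\,is_n}>u_n\}}}{\sum_{i=1}^{n-s_n+1}\mathbf 1_{\{X_i>u_n\}}},\qquad \hat\theta_n^s:=\frac{\frac1{s_n}\sum_{i=1}^{n-s_n+1}\mathbf 1_{\{M_{i,\,i+s_n-1}>u_n\}}}{\sum_{i=1}^{n-s_n+1}\mathbf 1_{\{X_i>u_n\}}},\qquad \hat\theta_n^r:=\frac{\sum_{i=1}^{n-s_n+1}\mathbf 1_{\{X_i>u_n,\;M_{i+1,\,i+s_n-1}\le u_n\}}}{\sum_{i=1}^{n-s_n+1}\mathbf 1_{\{X_i>u_n\}}}.$$ 1. If (B$_b$) $\ \displaystyle\frac{P\{M_{1,s_n}>u_n\}}{s_nv_n}-\theta=o\big((nv_n)^{-1/2}\big)$,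 then $\theta(\theta c-1)\ge0$ and, for $\sharp=d$ and for $\sharp=s$, $$\sqrt{nv_n}\,(\hat\theta_n^\sharp-\theta)\xrightarrow{w}\mathcal N\big(0,\theta(\theta c-1)\big).$$ 2. If (B$_r$) $\ P(M_{2,s_n}\le u_n\mid X_1>u_n)-\theta=o\big((nv_n)^{-1/2}\big)$, then $\theta(\theta c-1)\ge0$ and $$\sqrt{nv_n}\,(\hat\theta_n^r-\theta)\xrightarrow{w}\mathcal N\big(0,\theta(\theta c-1)\big).$$ So the three estimators have the same limit distribution. If $\theta(\theta c-1)=0$, the limit is the point mass at $0$. -/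

import Mathlib

open MeasureTheory ProbabilityTheory Filter Asymptotics
open scoped Topology ENNReal NNReal

namespace ExtremalIndex

variable {Ω : Type*} [MeasurableSpace Ω]

/-- Strict stationarity of a real-valued time series `(X_t)`, `t ∈ ℤ`: each `X_t` is a random
variable and the law of the whole series is invariant under every time shift. -/
def IsStationarySeries (μ : Measure Ω) (X : ℤ → Ω → ℝ) : Prop :=
  (∀ t, Measurable (X t)) ∧
    ∀ h : ℤ, μ.map (fun ω (t : ℤ) => X (t + h) ω) = μ.map (fun ω (t : ℤ) => X t ω)

/-- `M_{i,j} = max (X_i, …, X_j)`, with the convention that the maximum over an empty range of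
times (`j < i`) is `-∞`. -/
noncomputable def blockMax (X : ℤ → Ω → ℝ) (i j : ℤ) (ω : Ω) : EReal :=
  (Finset.Icc i j).sup fun t => (X t ω : EReal)

/-- The exceedance probability `v_n = P{X_1 > u_n}`. -/
noncomputable def exceedProb (μ : Measure Ω) (X : ℤ → Ω → ℝ) (u : ℕ → ℝ) (n : ℕ) : ℝ :=
  μ.real {ω | u n < X 1 ω}

/-- `θ` is the extremal index of the time series: for every `τ > 0` and all thresholds `w_n` such
that `n P{X_0 > w_n} → τ`, one has `P{max (X_1, …, X_n) ≤ w_n} → exp (-θ τ)`. -/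
def IsExtremalIndex (μ : Measure Ω) (X : ℤ → Ω → ℝ) (θ : ℝ) : Prop :=
  ∀ τ : ℝ, 0 < τ → ∀ w : ℕ → ℝ,
    Tendsto (fun n : ℕ => (n : ℝ) * μ.real {ω | w n < X 0 ω}) atTop (𝓝 τ) →
    Tendsto (fun n : ℕ => μ.real {ω | blockMax X 1 n ω ≤ (w n : EReal)}) atTop
      (𝓝 (Real.exp (-θ * τ)))

/-- The random vector `(X_i, …, X_j)`. The events `{window X i j ∈ B}`, `B` a Borel set, are
exactly the elements of the σ-field generated by `X_i, …, X_j`. -/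
def window (X : ℤ → Ω → ℝ) (i j : ℤ) (ω : Ω) : Finset.Icc i j → ℝ :=
  fun t => X t ω

/-- The β-mixing (absolute regularity) coefficient
`β_{n,k} = sup_{1 ≤ l ≤ n-k-1} E [ sup_B | P(B | X_1, …, X_l) - P(B) | ]`,
where `B` ranges over the σ-field generated by `X_{l+k+1}, …, X_n`. The conditional probabilities
are taken from a regular version (`condDistrib`), so that the supremum over all `B` is pointwise. -/
noncomputable def betaCoeff (μ : Measure Ω) [IsProbabilityMeasure μ] (X : ℤ → Ω → ℝ)
    (n k : ℕ) : ℝ≥0∞ :=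
  ⨆ (l : ℕ) (_ : 1 ≤ l ∧ l + k + 1 ≤ n),
    ∫⁻ ω, ⨆ (B : Set (Finset.Icc ((l : ℤ) + k + 1) (n : ℤ) → ℝ)) (_ : MeasurableSet B),
      ENNReal.ofReal
        |(condDistrib (window X ((l : ℤ) + k + 1) n) (window X 1 l) μ (window X 1 l ω)).real B
          - μ.real (window X ((l : ℤ) + k + 1) n ⁻¹' B)| ∂μ

/-- Condition (θ1) on the thresholds `u_n` and the block lengths `s_n`, with the big block
lengths `r_n`. -/
structure Theta1 (μ : Measure Ω) [IsProbabilityMeasure μ] (X : ℤ → Ω → ℝ) (u : ℕ → ℝ)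
    (s r : ℕ → ℕ) : Prop where
  exceed_zero : Tendsto (exceedProb μ X u) atTop (𝓝 0)
  exceed_count : Tendsto (fun n : ℕ => (n : ℝ) * exceedProb μ X u n) atTop atTop
  block_length : Tendsto s atTop atTop
  small_big : (fun n => (s n : ℝ)) =o[atTop] fun n => (r n : ℝ)
  big_exceed : Tendsto (fun n => (r n : ℝ) * exceedProb μ X u n) atTop (𝓝 0)
  big_sqrt : (fun n => (r n : ℝ)) =o[atTop] fun n : ℕ => Real.sqrt (n * exceedProb μ X u n)
  mixing : Tendsto (fun n : ℕ => (n : ℝ) / (r n : ℝ) * (betaCoeff μ X n (s n - 1)).toReal)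
    atTop (𝓝 0)

/-- Condition (θ2): `c` is the limit of
`(r_n v_n)⁻¹ E [(∑_{j=1}^{r_n} 1{X_j > u_n})²]`. -/
def Theta2 (μ : Measure Ω) (X : ℤ → Ω → ℝ) (u : ℕ → ℝ) (r : ℕ → ℕ) (c : ℝ) : Prop :=
  Tendsto (fun n => 1 / ((r n : ℝ) * exceedProb μ X u n) *
      ∫ ω, (∑ j ∈ Finset.Icc (1 : ℤ) (r n),
        Set.indicator {ω' | u n < X j ω'} (fun _ => (1 : ℝ)) ω) ^ 2 ∂μ)
    atTop (𝓝 c)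

/-- Condition (θP): there are bounds `e_n(k) ≥ P(X_k > u_n | X_0 > u_n)` with
`lim_n ∑_{k=1}^{r_n} e_n(k) = ∑_{k=1}^∞ lim_n e_n(k) < ∞`. -/
def ThetaP (μ : Measure Ω) (X : ℤ → Ω → ℝ) (u : ℕ → ℝ) (r : ℕ → ℕ) : Prop :=
  ∃ (e : ℕ → ℕ → ℝ) (eLim : ℕ → ℝ),
    (∀ n k : ℕ, 1 ≤ k → (μ[|{ω | u n < X 0 ω}]).real {ω | u n < X k ω} ≤ e n k) ∧
    (∀ k : ℕ, 1 ≤ k → Tendsto (fun n => e n k) atTop (𝓝 (eLim k))) ∧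
    Summable (fun k : ℕ => eLim (k + 1)) ∧
    Tendsto (fun n => ∑ k ∈ Finset.Icc 1 (r n), e n k) atTop (𝓝 (∑' k : ℕ, eLim (k + 1)))

/-- Bias condition (B_b): `P{M_{1,s_n} > u_n} / (s_n v_n) - θ = o((n v_n)^{-1/2})`. -/
def BiasBlocks (μ : Measure Ω) (X : ℤ → Ω → ℝ) (u : ℕ → ℝ) (s : ℕ → ℕ) (θ : ℝ) : Prop :=
  (fun n => μ.real {ω | (u n : EReal) < blockMax X 1 (s n) ω} / (s n * exceedProb μ X u n) - θ)
    =o[atTop] fun n : ℕ => ((n : ℝ) * exceedProb μ X u n) ^ (-(1 / 2) : ℝ)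

/-- Bias condition (B_r): `P(M_{2,s_n} ≤ u_n | X_1 > u_n) - θ = o((n v_n)^{-1/2})`. -/
def BiasRuns (μ : Measure Ω) (X : ℤ → Ω → ℝ) (u : ℕ → ℝ) (s : ℕ → ℕ) (θ : ℝ) : Prop :=
  (fun n => (μ[|{ω | u n < X 1 ω}]).real {ω | blockMax X 2 (s n) ω ≤ (u n : EReal)} - θ)
    =o[atTop] fun n : ℕ => ((n : ℝ) * exceedProb μ X u n) ^ (-(1 / 2) : ℝ)

/-- The common denominator `∑_{i=1}^{n-s_n+1} 1{X_i > u_n}` of the estimators. -/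
noncomputable def exceedCount (X : ℤ → Ω → ℝ) (u : ℕ → ℝ) (s : ℕ → ℕ) (n : ℕ) (ω : Ω) : ℝ :=
  ∑ i ∈ Finset.Icc (1 : ℤ) ((n : ℤ) - s n + 1),
    Set.indicator {ω' | u n < X i ω'} (fun _ => (1 : ℝ)) ω

/-- The disjoint blocks estimator. -/
noncomputable def disjointEstimator (X : ℤ → Ω → ℝ) (u : ℕ → ℝ) (s : ℕ → ℕ) (n : ℕ)
    (ω : Ω) : ℝ :=
  (∑ i ∈ Finset.Icc (1 : ℤ) ((n / s n : ℕ) : ℤ),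
    Set.indicator {ω' | (u n : EReal) < blockMax X ((i - 1) * s n + 1) (i * s n) ω'}
      (fun _ => (1 : ℝ)) ω) / exceedCount X u s n ω

/-- The sliding blocks estimator. -/
noncomputable def slidingEstimator (X : ℤ → Ω → ℝ) (u : ℕ → ℝ) (s : ℕ → ℕ) (n : ℕ)
    (ω : Ω) : ℝ :=
  (1 / (s n : ℝ) * ∑ i ∈ Finset.Icc (1 : ℤ) ((n : ℤ) - s n + 1),
    Set.indicator {ω' | (u n : EReal) < blockMax X i (i + s n - 1) ω'}
      (fun _ => (1 : ℝ)) ω) / exceedCount X u s n ω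

/-- The runs estimator. -/
noncomputable def runsEstimator (X : ℤ → Ω → ℝ) (u : ℕ → ℝ) (s : ℕ → ℕ) (n : ℕ)
    (ω : Ω) : ℝ :=
  (∑ i ∈ Finset.Icc (1 : ℤ) ((n : ℤ) - s n + 1),
    Set.indicator {ω' | u n < X i ω' ∧ blockMax X (i + 1) (i + s n - 1) ω' ≤ (u n : EReal)}
      (fun _ => (1 : ℝ)) ω) / exceedCount X u s n ω

/-- `Z_n` converges weakly to the normal law `N(0, σ2)`; this includes that `σ2` is a
nonnegative number. For `σ2 = 0` the limit is the point mass at `0`. -/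
def ConvergesToCenteredNormal (μ : Measure Ω) [IsProbabilityMeasure μ] (Z : ℕ → Ω → ℝ)
    (σ2 : ℝ) : Prop :=
  0 ≤ σ2 ∧
    TendstoInDistribution Z atTop (id : ℝ → ℝ) (fun _ => μ) (gaussianReal 0 σ2.toNNReal)

end ExtremalIndex

open ExtremalIndex

/-! Each estimator is a ratio `T / N`, where `N` counts exceedances and `T` sums local statistics
`t_i` that depend on `X_i, …, X_{i+s-1}`. Hence `T / N - θ` is the sum of `t_i - θ 1{X_i > u}`
divided by `N`. Since `N / (n v) → 1` in probability, it suffices to prove a central limit theorem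
for that sum, normalised by `√(n v)`, and to control its mean. The bias conditions say that the mean
is negligible.

The central limit theorem uses big and small blocks. Time is cut into periods of length about `r`,
and the last few multiples of `s` in each period are set aside. The remaining big blocks are
separated by at least `s`, so absolute regularity factorises the characteristic function at a total
cost of order `(n / r) β → 0`. One block sum is at most a constant times `r = o(√(n v))`, so a
Taylor expansion gives the Gaussian limit. The set-aside parts obey the same limit theorem with
variance zero, and hence vanish in probability (`RareEventArray.tendstoInDistribution_sum`).

The common limit variance comes from one fact: all three numerators count clusters. If a big block
contains an exceedance, then its numerator `T` is close to `1`, in the sense that `E[N |T - 1|] =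
o(r v)`. Because `T` is dominated by a count of exceedances, `T²` may be replaced by `T` and `N T`
by `N`, so that `E[(T - θ N)²] / (r v)` tends to `θ - 2θ + θ² c = θ (θ c - 1)`
(`RareEventArray.tendsto_second_moment_sub`).

To prove that fact, fix an exceedance at a time `j` away from the block boundary. Then `|T - 1|` is
at most a weighted number of exceedances at other times `k`. The weights of times near `j` are
negligible as `s → ∞`, and pairs of distant exceedances are rare by (θP)
(`RareEventArray.tendsto_key`). Disjoint and sliding blocks are handled together as weighted
families of block indicators; runs need a separate combinatorial argument. -/

namespace ExtremalIndex

/-! ### Finite sums over integer intervals -/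

section Sums

variable {M : Type*} [AddCommMonoid M]

lemma sum_Ioc_add_sum_Ioc (f : ℤ → M) {a b c : ℤ} (hab : a ≤ b) (hbc : b ≤ c) :
    ∑ i ∈ Finset.Ioc a b, f i + ∑ i ∈ Finset.Ioc b c, f i = ∑ i ∈ Finset.Ioc a c, f i := by
  rw [← Finset.Ioc_union_Ioc_eq_Ioc hab hbc, Finset.sum_union]
  rw [Finset.disjoint_left]
  intro x hx hx'
  rw [Finset.mem_Ioc] at hx hx'
  omega

lemma sum_Ioc_add_right (f : ℤ → M) (a b h : ℤ) :
    ∑ i ∈ Finset.Ioc (a + h) (b + h), f i = ∑ i ∈ Finset.Ioc a b, f (i + h) := by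
  rw [← Finset.image_add_right_Ioc, Finset.sum_image fun _ _ _ _ hxy => add_right_cancel hxy]

lemma sum_Ioc_mul (f : ℤ → M) (r m : ℕ) :
    ∑ i ∈ Finset.Ioc (0 : ℤ) (m * r), f i
      = ∑ j ∈ Finset.range m, ∑ i ∈ Finset.Ioc (0 : ℤ) r, f (i + j * r) := by
  induction m with
  | zero => simp
  | succ m ih =>
    rw [Finset.sum_range_succ, ← ih, ← sum_Ioc_add_right, zero_add,
      sum_Ioc_add_sum_Ioc _ (by positivity) (by linarith [Int.natCast_nonneg r])]
    push_cast
    ring_nf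

/-- Every positive distance from `i` is attained at most once on each side of `i`. -/
lemma sum_natAbs_sub_le {F : ℕ → ℝ} (hF : ∀ k, 0 ≤ F k) (K : ℕ) {i : ℤ}
    (hi : i ∈ Finset.Ioc (0 : ℤ) K) :
    ∑ j ∈ Finset.Ioc (0 : ℤ) K, F (i - j).natAbs ≤ F 0 + 2 * ∑ k ∈ Finset.Ioc 0 K, F k := by
  rw [Finset.mem_Ioc] at hi
  have side (s : Finset ℤ) (hs : ∀ j ∈ s, (i - j).natAbs ∈ Finset.Ioc 0 K)
      (inj : Set.InjOn (fun j : ℤ => (i - j).natAbs) s) :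
      ∑ j ∈ s, F (i - j).natAbs ≤ ∑ k ∈ Finset.Ioc 0 K, F k := by
    rw [← Finset.sum_image (g := fun j : ℤ => (i - j).natAbs) (f := F) inj]
    refine Finset.sum_le_sum_of_subset_of_nonneg ?_ fun _ _ _ => hF _
    intro k hk
    obtain ⟨j, hj, rfl⟩ := Finset.mem_image.1 hk
    exact hs j hj
  have h1 := side (Finset.Ioc 0 (i - 1))
    (fun j hj => by rw [Finset.mem_Ioc] at hj ⊢; omega)
    (fun j hj k hk h => by simp at hj hk h; omega)
  have h2 := side (Finset.Ioc i K)
    (fun j hj => by rw [Finset.mem_Ioc] at hj ⊢; omega)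
    (fun j hj k hk h => by simp at hj hk h; omega)
  have h3 : ∑ j ∈ Finset.Ioc (i - 1) i, F (i - j).natAbs = F 0 := by
    have : Finset.Ioc (i - 1) i = {i} := by ext; simp; omega
    simp [this]
  rw [← sum_Ioc_add_sum_Ioc _ (show 0 ≤ i by omega) hi.2,
    ← sum_Ioc_add_sum_Ioc _ (show 0 ≤ i - 1 by omega) (show i - 1 ≤ i by omega)]
  linarith

end Sums

/-! ### Exceedance counts on the path space -/

/-- The time shift on the path space. -/
def shift (h : ℤ) (x : ℤ → ℝ) : ℤ → ℝ := fun t => x (t + h)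

/-- The exceedance indicator `1{x_i > u}`. -/
noncomputable def exc (u : ℝ) (i : ℤ) (x : ℤ → ℝ) : ℝ :=
  Set.indicator {y : ℤ → ℝ | u < y i} (fun _ => (1 : ℝ)) x

/-- The number of exceedances at times in `(a, b]`. -/
noncomputable def cnt (u : ℝ) (a b : ℤ) (x : ℤ → ℝ) : ℝ := ∑ i ∈ Finset.Ioc a b, exc u i x

@[fun_prop]
lemma measurable_shift (h : ℤ) : Measurable (shift h) :=
  measurable_pi_lambda _ fun t => measurable_pi_apply (t + h)

lemma shift_apply (h : ℤ) (x : ℤ → ℝ) (t : ℤ) : shift h x t = x (t + h) := rfl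

lemma measurableSet_exc (u : ℝ) (i : ℤ) : MeasurableSet {y : ℤ → ℝ | u < y i} :=
  measurableSet_lt measurable_const (measurable_pi_apply i)

@[fun_prop]
lemma measurable_exc (u : ℝ) (i : ℤ) : Measurable (exc u i) :=
  measurable_const.indicator (measurableSet_exc u i)

lemma exc_of_lt {u : ℝ} {i : ℤ} {x : ℤ → ℝ} (h : u < x i) : exc u i x = 1 :=
  Set.indicator_of_mem (s := {y : ℤ → ℝ | u < y i}) h _

lemma exc_of_not_lt {u : ℝ} {i : ℤ} {x : ℤ → ℝ} (h : ¬ u < x i) : exc u i x = 0 :=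
  Set.indicator_of_notMem (s := {y : ℤ → ℝ | u < y i}) h _

lemma exc_eq_zero_or_one (u : ℝ) (i : ℤ) (x : ℤ → ℝ) : exc u i x = 0 ∨ exc u i x = 1 := by
  by_cases h : u < x i
  · exact .inr (exc_of_lt h)
  · exact .inl (exc_of_not_lt h)

lemma exc_nonneg (u : ℝ) (i : ℤ) (x : ℤ → ℝ) : 0 ≤ exc u i x := by
  rcases exc_eq_zero_or_one u i x with h | h <;> simp [h]

lemma exc_le_one (u : ℝ) (i : ℤ) (x : ℤ → ℝ) : exc u i x ≤ 1 := by
  rcases exc_eq_zero_or_one u i x with h | h <;> simp [h]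

lemma exc_congr {u : ℝ} {i j : ℤ} {x y : ℤ → ℝ} (h : x i = y j) : exc u i x = exc u j y := by
  by_cases hx : u < x i
  · rw [exc_of_lt hx, exc_of_lt (h ▸ hx)]
  · rw [exc_of_not_lt hx, exc_of_not_lt (h ▸ hx)]

lemma exc_shift (u : ℝ) (i h : ℤ) (x : ℤ → ℝ) : exc u i (shift h x) = exc u (i + h) x :=
  exc_congr rfl

@[fun_prop]
lemma measurable_cnt (u : ℝ) (a b : ℤ) : Measurable (cnt u a b) := by
  unfold cnt
  fun_prop

lemma cnt_nonneg (u : ℝ) (a b : ℤ) (x : ℤ → ℝ) : 0 ≤ cnt u a b x :=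
  Finset.sum_nonneg fun _ _ => exc_nonneg _ _ _

lemma cnt_le (u : ℝ) (a b : ℤ) (x : ℤ → ℝ) : cnt u a b x ≤ (b - a).toNat := by
  refine (Finset.sum_le_card_nsmul _ _ 1 fun i _ => exc_le_one u i x).trans ?_
  simp

lemma cnt_mono (u : ℝ) {a b a' b' : ℤ} (ha : a' ≤ a) (hb : b ≤ b') (x : ℤ → ℝ) :
    cnt u a b x ≤ cnt u a' b' x :=
  Finset.sum_le_sum_of_subset_of_nonneg (Finset.Ioc_subset_Ioc ha hb) fun _ _ _ => exc_nonneg _ _ _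

lemma cnt_add_cnt (u : ℝ) {a b c : ℤ} (hab : a ≤ b) (hbc : b ≤ c) (x : ℤ → ℝ) :
    cnt u a b x + cnt u b c x = cnt u a c x :=
  sum_Ioc_add_sum_Ioc _ hab hbc

lemma cnt_shift (u : ℝ) (a b h : ℤ) (x : ℤ → ℝ) :
    cnt u a b (shift h x) = cnt u (a + h) (b + h) x := by
  simp only [cnt, sum_Ioc_add_right, exc_shift]

lemma exc_le_cnt (u : ℝ) {a b i : ℤ} (hi : i ∈ Finset.Ioc a b) (x : ℤ → ℝ) :
    exc u i x ≤ cnt u a b x :=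
  Finset.single_le_sum (f := fun i => exc u i x) (fun _ _ => exc_nonneg _ _ _) hi

lemma integrable_of_measurable_of_bound {α : Type*} [MeasurableSpace α] {P : Measure α}
    [IsFiniteMeasure P] {f : α → ℝ} (hf : Measurable f) (C : ℝ) (hC : ∀ x, |f x| ≤ C) :
    Integrable f P :=
  Integrable.of_bound hf.aestronglyMeasurable C (ae_of_all _ hC)

/-! ### First and second moments of exceedance counts under a stationary law -/

section Moments

set_option linter.unusedSectionVars false

variable {P : Measure (ℤ → ℝ)} [IsProbabilityMeasure P]

lemma integral_comp_shift (hP : ∀ h, P.map (shift h) = P) {F : Type*} [NormedAddCommGroup F]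
    [NormedSpace ℝ F] {f : (ℤ → ℝ) → F} (hf : StronglyMeasurable f) (h : ℤ) :
    ∫ x, f (shift h x) ∂P = ∫ x, f x ∂P := by
  conv_rhs => rw [← hP h]
  rw [integral_map (measurable_shift h).aemeasurable hf.aestronglyMeasurable]

lemma integrable_exc (u : ℝ) (i : ℤ) : Integrable (exc u i) P :=
  integrable_of_measurable_of_bound (by fun_prop) 1 fun x => by
    rw [abs_of_nonneg (exc_nonneg _ _ _)]; exact exc_le_one _ _ _

lemma integrable_cnt (u : ℝ) (a b : ℤ) : Integrable (cnt u a b) P :=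
  integrable_of_measurable_of_bound (by fun_prop) (b - a).toNat fun x => by
    rw [abs_of_nonneg (cnt_nonneg _ _ _ _)]; exact cnt_le _ _ _ _

lemma integrable_cnt_mul_cnt (u : ℝ) (a b a' b' : ℤ) :
    Integrable (fun x => cnt u a b x * cnt u a' b' x) P :=
  integrable_of_measurable_of_bound (by fun_prop) ((b - a).toNat * (b' - a').toNat) fun x => by
    rw [abs_of_nonneg (mul_nonneg (cnt_nonneg _ _ _ _) (cnt_nonneg _ _ _ _))]
    exact mul_le_mul (cnt_le _ _ _ _) (cnt_le _ _ _ _) (cnt_nonneg _ _ _ _) (by positivity)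

lemma integrable_exc_mul_exc (u : ℝ) (i j : ℤ) :
    Integrable (fun x => exc u i x * exc u j x) P :=
  integrable_of_measurable_of_bound (by fun_prop) 1 fun x => by
    rcases exc_eq_zero_or_one u i x with h | h <;>
      rcases exc_eq_zero_or_one u j x with h' | h' <;> simp [h, h']

/-- The probability that there are exceedances at the times `0` and `k`. -/
noncomputable def pairProb (P : Measure (ℤ → ℝ)) (u : ℝ) (k : ℕ) : ℝ :=
  ∫ x, exc u 0 x * exc u k x ∂P

/-- The probability of an exceedance at time `0`. -/
noncomputable def excProb (P : Measure (ℤ → ℝ)) (u : ℝ) : ℝ := ∫ x, exc u 0 x ∂P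

lemma excProb_nonneg (u : ℝ) : 0 ≤ excProb P u := integral_nonneg fun _ => exc_nonneg _ _ _

lemma excProb_le_one (u : ℝ) : excProb P u ≤ 1 := by
  refine (integral_mono (integrable_exc u 0) (integrable_const 1) fun x => exc_le_one _ _ _).trans ?_
  simp

lemma pairProb_nonneg (u : ℝ) (k : ℕ) : 0 ≤ pairProb P u k :=
  integral_nonneg fun _ => mul_nonneg (exc_nonneg _ _ _) (exc_nonneg _ _ _)

lemma pairProb_le (u : ℝ) (k : ℕ) : pairProb P u k ≤ excProb P u := by
  refine integral_mono (integrable_exc_mul_exc _ _ _) (integrable_exc _ _) fun x => ?_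
  exact mul_le_of_le_one_right (exc_nonneg _ _ _) (exc_le_one _ _ _)

lemma pairProb_zero (u : ℝ) : pairProb P u 0 = excProb P u := by
  refine integral_congr_ae (ae_of_all _ fun x => ?_)
  rcases exc_eq_zero_or_one u 0 x with h | h <;> simp [h]

lemma integral_exc (hP : ∀ h, P.map (shift h) = P) (u : ℝ) (i : ℤ) :
    ∫ x, exc u i x ∂P = excProb P u := by
  rw [excProb, ← integral_comp_shift hP (measurable_exc u 0).stronglyMeasurable i]
  simp only [exc_shift, zero_add]

lemma integral_cnt (hP : ∀ h, P.map (shift h) = P) (u : ℝ) {a b : ℤ} (hab : a ≤ b) :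
    ∫ x, cnt u a b x ∂P = (b - a) * excProb P u := by
  simp only [cnt]
  rw [integral_finsetSum _ fun i _ => integrable_exc u i]
  simp only [integral_exc hP, Finset.sum_const, Int.card_Ioc, nsmul_eq_mul]
  congr 1
  exact_mod_cast Int.toNat_of_nonneg (by omega)

lemma integral_exc_mul_exc (hP : ∀ h, P.map (shift h) = P) (u : ℝ) (i j : ℤ) :
    ∫ x, exc u i x * exc u j x ∂P = pairProb P u (i - j).natAbs := by
  rcases le_total i j with h | h
  · rw [pairProb, ← integral_comp_shift hP
      (f := fun x => exc u 0 x * exc u (i - j).natAbs x)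
      (Measurable.stronglyMeasurable (by fun_prop)) i]
    simp only [exc_shift, zero_add]
    rw [show ((i - j).natAbs : ℤ) + i = j by omega]
  · rw [pairProb, ← integral_comp_shift hP
      (f := fun x => exc u 0 x * exc u (i - j).natAbs x)
      (Measurable.stronglyMeasurable (by fun_prop)) j]
    simp only [exc_shift, zero_add]
    rw [show ((i - j).natAbs : ℤ) + j = i by omega]
    simp only [mul_comm]

/-- By stationarity a pair of times contributes only through its distance, so each time in `(a, b]`
has the same bound. Linearity in `b - a` is what later makes short stretches of a big block
negligible. -/
lemma integral_cnt_mul_cnt_le (hP : ∀ h, P.map (shift h) = P) (u : ℝ) {a b : ℤ} {K : ℕ}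
    (ha : 0 ≤ a) (hab : a ≤ b) (hb : b ≤ K) :
    ∫ x, cnt u a b x * cnt u 0 K x ∂P
      ≤ (b - a) * (excProb P u + 2 * ∑ k ∈ Finset.Ioc 0 K, pairProb P u k) := by
  simp only [cnt, Finset.sum_mul_sum]
  rw [integral_finsetSum _ fun i _ => integrable_finsetSum _ fun j _ =>
    integrable_exc_mul_exc u i j]
  simp only [integral_finsetSum _ fun j _ => integrable_exc_mul_exc (P := P) u _ j,
    integral_exc_mul_exc hP]
  refine (Finset.sum_le_card_nsmul _ _ (excProb P u + 2 * ∑ k ∈ Finset.Ioc 0 K, pairProb P u k)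
    fun i hi => ?_).trans ?_
  · rw [← pairProb_zero]
    refine sum_natAbs_sub_le (fun k => pairProb_nonneg u k) K ?_
    rw [Finset.mem_Ioc] at hi ⊢
    omega
  · rw [nsmul_eq_mul, Int.card_Ioc]
    refine le_of_eq ?_
    congr 1
    exact_mod_cast Int.toNat_of_nonneg (by omega)

end Moments

end ExtremalIndex

namespace ExtremalIndex

/-! ### From uniform bounds on events to bounds on integrals -/

section TotalVariation

variable {α : Type*} [MeasurableSpace α] (κ ν : Measure α) [IsProbabilityMeasure κ]
  [IsProbabilityMeasure ν]

/-- The layer cake formula writes the integral of `g` as the integral over `t ∈ (0, 1]` of the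
probability of `{t ≤ g}`, and the bound holds for each of these events. -/
lemma abs_integral_sub_integral_le {D : ℝ}
    (hD : ∀ B, MeasurableSet B → |κ.real B - ν.real B| ≤ D) {g : α → ℝ} (hg : Measurable g)
    (h0 : ∀ x, 0 ≤ g x) (h1 : ∀ x, g x ≤ 1) : |∫ x, g x ∂κ - ∫ x, g x ∂ν| ≤ D := by
  have int (m : Measure α) [IsProbabilityMeasure m] : Integrable g m :=
    integrable_of_measurable_of_bound hg 1 fun x => by rw [abs_of_nonneg (h0 x)]; exact h1 x
  have anti (m : Measure α) [IsProbabilityMeasure m] :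
      IntegrableOn (fun t => m.real {a | t ≤ g a}) (Set.Ioc 0 1) := by
    refine AntitoneOn.integrableOn_of_measure_ne_top (μ := volume) ?_
      (a := 0) (b := 1) ?_ ?_ ?_ ?_ |>.mono_set Set.Ioc_subset_Icc_self
    · intro a _ b _ hab
      exact measureReal_mono fun x hx => hab.trans hx
    · exact ⟨by simp, by intro; simp; tauto⟩
    · exact ⟨by simp, by intro; simp⟩
    · simp
    · exact measurableSet_Icc
  rw [(int κ).integral_eq_integral_Ioc_meas_le (ae_of_all _ h0) (ae_of_all _ h1),
    (int ν).integral_eq_integral_Ioc_meas_le (ae_of_all _ h0) (ae_of_all _ h1),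
    ← integral_sub (anti κ) (anti ν), ← Real.norm_eq_abs]
  refine (norm_setIntegral_le_of_norm_le_const (C := D) (by simp) fun t _ => ?_).trans ?_
  · exact hD _ (measurableSet_le measurable_const hg)
  · simp

lemma norm_integral_sub_integral_le {D : ℝ}
    (hD : ∀ B, MeasurableSet B → |κ.real B - ν.real B| ≤ D) {g : α → ℂ} (hg : Measurable g)
    (h1 : ∀ x, ‖g x‖ ≤ 1) : ‖∫ x, g x ∂κ - ∫ x, g x ∂ν‖ ≤ 4 * D := by
  have int (m : Measure α) [IsProbabilityMeasure m] : Integrable g m :=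
    Integrable.of_bound hg.aestronglyMeasurable 1 (ae_of_all _ h1)
  have real_part {f : α → ℝ} (hf : Measurable f) (hf1 : ∀ x, |f x| ≤ 1) :
      |∫ x, f x ∂κ - ∫ x, f x ∂ν| ≤ 2 * D := by
    -- The affine map from `[-1, 1]` onto `[0, 1]` costs a factor `2`; adding real and imaginary
    -- parts gives the final factor `4`.
    have key := abs_integral_sub_integral_le κ ν hD (g := fun x => (f x + 1) / 2) (by fun_prop)
      (fun x => by linarith [(abs_le.1 (hf1 x)).1]) (fun x => by linarith [(abs_le.1 (hf1 x)).2])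
    have e (m : Measure α) [IsProbabilityMeasure m] :
        ∫ x, (f x + 1) / 2 ∂m = (∫ x, f x ∂m + 1) / 2 := by
      rw [integral_div, integral_add (integrable_of_measurable_of_bound hf 1 hf1)
        (integrable_const _)]
      simp
    rw [e κ, e ν, abs_le] at key
    rw [abs_le]
    constructor <;> linarith [key.1, key.2]
  refine (Complex.norm_le_abs_re_add_abs_im _).trans ?_
  have hre := real_part (Complex.measurable_re.comp hg)
    fun x => (Complex.abs_re_le_norm _).trans (h1 x)
  have him := real_part (Complex.measurable_im.comp hg)
    fun x => (Complex.abs_im_le_norm _).trans (h1 x)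
  simp only [Function.comp_apply] at hre him
  have cre (m : Measure α) [IsProbabilityMeasure m] :
      (∫ x, g x ∂m).re = ∫ x, (g x).re ∂m := (integral_re (int m)).symm
  have cim (m : Measure α) [IsProbabilityMeasure m] :
      (∫ x, g x ∂m).im = ∫ x, (g x).im ∂m := (integral_im (int m)).symm
  rw [Complex.sub_re, Complex.sub_im, cre, cre, cim, cim]
  linarith

end TotalVariation

/-! ### Covariance inequality for absolutely regular series -/

section Mixing

variable {Ω : Type*} [MeasurableSpace Ω] (μ : Measure Ω) [IsProbabilityMeasure μ]
  {X : ℤ → Ω → ℝ}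

/-- The path of the time series. -/
def path (X : ℤ → Ω → ℝ) (ω : Ω) : ℤ → ℝ := fun t => X t ω

lemma measurable_path (hX : ∀ t, Measurable (X t)) : Measurable (path X) :=
  measurable_pi_lambda _ hX

lemma measurable_window (hX : ∀ t, Measurable (X t)) (i j : ℤ) : Measurable (window X i j) :=
  measurable_pi_lambda _ fun t => hX t

/-- Extension of a vector indexed by a finite set of times to a path. -/
noncomputable def extendPath (S : Finset ℤ) (w : S → ℝ) : ℤ → ℝ :=
  fun t => if h : t ∈ S then w ⟨t, h⟩ else 0

lemma measurable_extendPath (S : Finset ℤ) : Measurable (extendPath S) := by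
  refine measurable_pi_lambda _ fun t => ?_
  by_cases h : t ∈ S
  · simpa only [extendPath, h, dif_pos] using measurable_pi_apply _
  · simp only [extendPath, h, dif_neg, not_false_eq_true, measurable_const]

lemma extendPath_window {β : Type*} {f : (ℤ → ℝ) → β} {a b : ℤ} (hf : DependsOn f (Set.Icc a b))
    (ω : Ω) : f (extendPath _ (window X a b ω)) = f (path X ω) := by
  refine hf fun t ht => ?_
  have : t ∈ Finset.Icc a b := Finset.mem_Icc.2 ht
  simp only [extendPath, this, dif_pos, window, path]

lemma betaCoeff_le_one (n k : ℕ) : betaCoeff μ X n k ≤ 1 := by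
  refine iSup₂_le fun l _ => (lintegral_mono (g := fun _ => 1) fun ω => ?_).trans (by simp)
  refine iSup₂_le fun B _ => ?_
  rw [ENNReal.ofReal_le_one, abs_le]
  have h1 := measureReal_le_one
    (μ := condDistrib (window X ((l : ℤ) + k + 1) n) (window X 1 l) μ (window X 1 l ω)) (s := B)
  have h2 := measureReal_le_one (μ := μ) (s := window X ((l : ℤ) + k + 1) n ⁻¹' B)
  constructor <;> linarith [measureReal_nonneg (μ := μ) (s := window X ((l : ℤ) + k + 1) n ⁻¹' B),
    measureReal_nonneg (s := B)
      (μ := condDistrib (window X ((l : ℤ) + k + 1) n) (window X 1 l) μ (window X 1 l ω))]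

/-- Disintegrating the joint law of past and future by `condDistrib` turns the covariance into the
mean of `f` times the difference between the conditional and the unconditional integral of `g`.
Pointwise that difference is at most four times the supremum over events in the definition of
`betaCoeff`. -/
lemma norm_integral_mul_sub_le_betaCoeff (hX : ∀ t, Measurable (X t)) {n k l : ℕ} (hl : 1 ≤ l)
    (hn : l + k + 1 ≤ n) {f g : (ℤ → ℝ) → ℂ} (hf : Measurable f) (hg : Measurable g)
    (hf1 : ∀ x, ‖f x‖ ≤ 1) (hg1 : ∀ x, ‖g x‖ ≤ 1) (hfd : DependsOn f (Set.Icc 1 (l : ℤ)))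
    (hgd : DependsOn g (Set.Icc ((l : ℤ) + k + 1) n)) :
    ‖∫ ω, f (path X ω) * g (path X ω) ∂μ
        - (∫ ω, f (path X ω) ∂μ) * ∫ ω, g (path X ω) ∂μ‖ ≤ 4 * (betaCoeff μ X n k).toReal := by
  set V := window X 1 l with hV
  set W := window X ((l : ℤ) + k + 1) n with hW
  have mV : Measurable V := measurable_window hX _ _
  have mW : Measurable W := measurable_window hX _ _
  set f' : (Finset.Icc (1 : ℤ) l → ℝ) → ℂ := fun w => f (extendPath _ w)
  set g' : (Finset.Icc ((l : ℤ) + k + 1) (n : ℤ) → ℝ) → ℂ := fun w => g (extendPath _ w)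
  have mf : Measurable f' := hf.comp (measurable_extendPath _)
  have mg : Measurable g' := hg.comp (measurable_extendPath _)
  have ef (ω : Ω) : f (path X ω) = f' (V ω) := (extendPath_window hfd ω).symm
  have eg (ω : Ω) : g (path X ω) = g' (W ω) := (extendPath_window hgd ω).symm
  simp only [ef, eg]
  set κ := condDistrib W V μ with hκ
  have : IsProbabilityMeasure (μ.map W) := Measure.isProbabilityMeasure_map mW.aemeasurable
  have joint : ∫ ω, f' (V ω) * g' (W ω) ∂μ = ∫ ω, f' (V ω) * ∫ w, g' w ∂(κ (V ω)) ∂μ := by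
    have m2 : Measurable fun p : (Finset.Icc (1 : ℤ) l → ℝ) ×
        (Finset.Icc ((l : ℤ) + k + 1) (n : ℤ) → ℝ) => f' p.1 * g' p.2 := by fun_prop
    have h1 : ∫ ω, f' (V ω) * g' (W ω) ∂μ
        = ∫ p, f' p.1 * g' p.2 ∂(μ.map fun ω => (V ω, W ω)) := by
      rw [integral_map (mV.prodMk mW).aemeasurable m2.aestronglyMeasurable]
    rw [h1, ← compProd_map_condDistrib mW.aemeasurable, Measure.integral_compProd,
      integral_map mV.aemeasurable]
    · simp only [integral_const_mul, hκ]
    · exact (StronglyMeasurable.integral_kernel_prod_right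
        (f := fun v w => f' v * g' w) m2.stronglyMeasurable).aestronglyMeasurable
    · have : IsProbabilityMeasure (μ.map V) := Measure.isProbabilityMeasure_map mV.aemeasurable
      refine Integrable.of_bound m2.aestronglyMeasurable 1 (ae_of_all _ fun p => ?_)
      rw [norm_mul]
      exact mul_le_one₀ (hf1 _) (norm_nonneg _) (hg1 _)
  have bound (ω : Ω) : ‖∫ w, g' w ∂(κ (V ω))‖ ≤ 1 := by
    refine (norm_integral_le_of_norm_le_const (ae_of_all _ fun w => hg1 _)).trans ?_
    simp
  have mint : Measurable fun ω => f' (V ω) * ∫ w, g' w ∂(κ (V ω)) := by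
    refine (mf.comp mV).mul ?_
    exact ((StronglyMeasurable.integral_kernel (κ := κ) mg.stronglyMeasurable).comp_measurable
      mV).measurable
  have diff : ∫ ω, f' (V ω) * g' (W ω) ∂μ - (∫ ω, f' (V ω) ∂μ) * ∫ ω, g' (W ω) ∂μ
      = ∫ ω, f' (V ω) * (∫ w, g' w ∂(κ (V ω)) - ∫ w, g' w ∂(μ.map W)) ∂μ := by
    rw [joint, ← integral_map mW.aemeasurable mg.aestronglyMeasurable, ← integral_mul_const,
      ← integral_sub]
    · simp only [mul_sub]
    · refine Integrable.of_bound mint.aestronglyMeasurable 1 (ae_of_all _ fun ω => ?_)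
      rw [norm_mul]
      exact mul_le_one₀ (hf1 _) (norm_nonneg _) (bound ω)
    · exact (Integrable.of_bound (mf.comp mV).aestronglyMeasurable 1
        (ae_of_all _ fun ω => hf1 _)).mul_const _
  have pointwise (ω : Ω) :
      ‖f' (V ω) * (∫ w, g' w ∂(κ (V ω)) - ∫ w, g' w ∂(μ.map W))‖ₑ
        ≤ 4 * ⨆ (B : Set (Finset.Icc ((l : ℤ) + k + 1) (n : ℤ) → ℝ)) (_ : MeasurableSet B),
          ENNReal.ofReal |(κ (V ω)).real B - μ.real (W ⁻¹' B)| := by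
    set D := ⨆ (B : Set (Finset.Icc ((l : ℤ) + k + 1) (n : ℤ) → ℝ)) (_ : MeasurableSet B),
          ENNReal.ofReal |(κ (V ω)).real B - μ.real (W ⁻¹' B)| with hD
    have hDtop : D ≠ ⊤ := by
      refine ne_top_of_le_ne_top ENNReal.one_ne_top (iSup₂_le fun B _ => ?_)
      rw [ENNReal.ofReal_le_one, abs_le]
      constructor <;> linarith [measureReal_le_one (μ := κ (V ω)) (s := B),
        measureReal_le_one (μ := μ) (s := W ⁻¹' B), measureReal_nonneg (μ := κ (V ω)) (s := B),
        measureReal_nonneg (μ := μ) (s := W ⁻¹' B)]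
    have hle := norm_integral_sub_integral_le (κ (V ω)) (μ.map W) (D := D.toReal) (fun B hB => by
      rw [map_measureReal_apply mW hB, ← ENNReal.ofReal_le_iff_le_toReal hDtop]
      exact le_iSup₂ (f := fun (B : Set (Finset.Icc ((l : ℤ) + k + 1) (n : ℤ) → ℝ))
        (_ : MeasurableSet B) => ENNReal.ofReal |(κ (V ω)).real B - μ.real (W ⁻¹' B)|) B hB)
      mg (fun w => hg1 _)
    rw [← ofReal_norm]
    refine (ENNReal.ofReal_le_ofReal ((norm_mul_le _ _).trans
      ((mul_le_of_le_one_left (norm_nonneg _) (hf1 _)).trans hle))).trans ?_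
    rw [ENNReal.ofReal_mul (by norm_num), ENNReal.ofReal_toReal hDtop]
    simp
  rw [diff, ← toReal_enorm]
  have fin : 4 * betaCoeff μ X n k ≠ ⊤ :=
    ENNReal.mul_ne_top (by simp) (ne_top_of_le_ne_top ENNReal.one_ne_top (betaCoeff_le_one μ n k))
  have : (4 : ℝ) * (betaCoeff μ X n k).toReal = (4 * betaCoeff μ X n k).toReal := by simp
  rw [this]
  refine ENNReal.toReal_mono fin ((enorm_integral_le_lintegral_enorm _).trans ?_)
  refine (lintegral_mono pointwise).trans ?_
  -- The supremum runs over uncountably many events and need not be measurable; pulling out a finite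
  -- constant does not require it.
  rw [lintegral_const_mul' _ _ (by simp)]
  gcongr
  exact le_iSup₂ (f := fun (l : ℕ) (_ : 1 ≤ l ∧ l + k + 1 ≤ n) =>
    ∫⁻ ω, ⨆ (B : Set (Finset.Icc ((l : ℤ) + k + 1) (n : ℤ) → ℝ)) (_ : MeasurableSet B),
      ENNReal.ofReal
        |(condDistrib (window X ((l : ℤ) + k + 1) n) (window X 1 l) μ (window X 1 l ω)).real B
          - μ.real (window X ((l : ℤ) + k + 1) n ⁻¹' B)| ∂μ) l ⟨hl, hn⟩

end Mixing

end ExtremalIndex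

namespace ExtremalIndex

/-! ### Characteristic functions of sums of separated blocks -/

section Blocks

/-- The covariances of bounded functions of `X_1, …, X_l` and `X_{l+s}, …, X_n` are at most `4 b`. -/
def MixingBound (P : Measure (ℤ → ℝ)) (n s : ℕ) (b : ℝ) : Prop :=
  ∀ (l : ℕ) (f g : (ℤ → ℝ) → ℂ), 1 ≤ l → l + s ≤ n → Measurable f → Measurable g →
    (∀ x, ‖f x‖ ≤ 1) → (∀ x, ‖g x‖ ≤ 1) → DependsOn f (Set.Icc 1 (l : ℤ)) →
    DependsOn g (Set.Icc ((l : ℤ) + s) n) →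
    ‖∫ x, f x * g x ∂P - (∫ x, f x ∂P) * ∫ x, g x ∂P‖ ≤ 4 * b

lemma dependsOn_comp_shift {β : Type*} {f : (ℤ → ℝ) → β} {a b : ℤ} (hf : DependsOn f (Set.Icc a b))
    (h : ℤ) : DependsOn (fun x => f (shift h x)) (Set.Icc (a + h) (b + h)) := by
  intro x y hxy
  refine hf fun t ht => hxy _ ?_
  exact ⟨by linarith [ht.1], by linarith [ht.2]⟩

lemma norm_pow_sub_pow_le_mul (m : ℕ) {z w : ℂ} (hz : ‖z‖ ≤ 1) (hw : ‖w‖ ≤ 1) :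
    ‖z ^ m - w ^ m‖ ≤ m * ‖z - w‖ := by
  induction m with
  | zero => simp
  | succ m ih =>
    have e : z ^ (m + 1) - w ^ (m + 1) = z ^ m * (z - w) + (z ^ m - w ^ m) * w := by ring
    rw [e]
    refine (norm_add_le _ _).trans ?_
    rw [norm_mul, norm_mul, norm_pow]
    have h1 : ‖z‖ ^ m * ‖z - w‖ ≤ ‖z - w‖ :=
      mul_le_of_le_one_left (norm_nonneg _) (pow_le_one₀ (norm_nonneg _) hz)
    have h2 : ‖z ^ m - w ^ m‖ * ‖w‖ ≤ m * ‖z - w‖ :=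
      (mul_le_of_le_one_right (norm_nonneg _) hw).trans ih
    push_cast
    linarith

variable {P : Measure (ℤ → ℝ)} [IsProbabilityMeasure P]

/-- The last block is split off repeatedly, each time at the cost of one covariance. The condition
`b + s ≤ a + r` leaves the required gap between consecutive windows `[a, b] + j r`, and `m r + b ≤ n
+ r` keeps the last window within `[1, n]`. -/
lemma norm_integral_prod_shift_sub_pow_le (hP : ∀ h, P.map (shift h) = P) {n s a b r : ℕ} {β : ℝ}
    (hmix : MixingBound P n s β) (hβ : 0 ≤ β) (ha : 1 ≤ a) (hab : a ≤ b) (hr : b + s ≤ a + r)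
    {φ : (ℤ → ℝ) → ℂ} (hφ : Measurable φ) (hφ1 : ∀ x, ‖φ x‖ ≤ 1)
    (hφd : DependsOn φ (Set.Icc (a : ℤ) b)) (m : ℕ) (hm : m * r + b ≤ n + r) :
    ‖∫ x, ∏ j ∈ Finset.range m, φ (shift (j * r) x) ∂P - (∫ x, φ x ∂P) ^ m‖ ≤ m * (4 * β) := by
  induction m with
  | zero => simp
  | succ m ih =>
    have hm' : m * r + r + b ≤ n + r := by simpa [add_mul] using hm
    have ih := ih (by omega)
    have e1 : ∫ x, φ (shift (m * r) x) ∂P = ∫ x, φ x ∂P :=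
      integral_comp_shift hP hφ.stronglyMeasurable _
    simp only [Finset.prod_range_succ]
    -- The first block has no past to be separated from; here stationarity gives equality.
    rcases Nat.eq_zero_or_pos m with rfl | hm0
    · simp [integral_comp_shift hP hφ.stronglyMeasurable]
      exact hβ
    have hφint : ‖∫ x, φ x ∂P‖ ≤ 1 := by
      refine (norm_integral_le_of_norm_le_const (ae_of_all _ hφ1)).trans ?_
      simp
    obtain ⟨k, rfl⟩ : ∃ k, m = k + 1 := ⟨m - 1, by omega⟩
    have hk : k * r + r + r + b ≤ n + r := by simpa [add_mul] using hm'
    have key := hmix (k * r + b) (fun x => ∏ j ∈ Finset.range (k + 1), φ (shift (j * r) x))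
      (fun x => φ (shift ((k + 1 : ℕ) * r) x)) (by omega) (by omega)
      (Finset.measurable_fun_prod _ fun j _ => hφ.comp (measurable_shift _))
      (hφ.comp (measurable_shift _))
      (fun x => by
        rw [norm_prod]
        exact Finset.prod_le_one (fun _ _ => norm_nonneg _) fun _ _ => hφ1 _)
      (fun x => hφ1 _)
      (fun x y hxy => Finset.prod_congr rfl fun j hj => by
        refine dependsOn_comp_shift hφd _ fun t ht => hxy t ?_
        have hjk : j * r ≤ k * r := Nat.mul_le_mul_right r (by simpa [Nat.lt_succ_iff] using hj)
        have hjk' : (j : ℤ) * r ≤ k * r := by exact_mod_cast hjk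
        have : (0 : ℤ) ≤ j * r := by positivity
        refine ⟨by linarith [ht.1, (by exact_mod_cast ha : (1 : ℤ) ≤ a)], ?_⟩
        push_cast
        linarith [ht.2])
      ((dependsOn_comp_shift hφd _).mono fun t ht => by
        have h1 := ht.1
        have h2 := ht.2
        have h3 : (b : ℤ) + s ≤ a + r := by exact_mod_cast hr
        have h4 : (k : ℤ) * r + r + r + b ≤ n + r := by exact_mod_cast hk
        push_cast at h1 h2 ⊢
        constructor <;> linarith)
    rw [e1] at key
    have e2 : (∫ x, φ x ∂P) ^ (k + 1 + 1) = (∫ x, φ x ∂P) ^ (k + 1) * ∫ x, φ x ∂P := pow_succ _ _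
    rw [e2]
    set A := ∫ x, (∏ j ∈ Finset.range (k + 1), φ (shift (j * r) x)) *
      φ (shift ((k + 1 : ℕ) * r) x) ∂P
    set B := ∫ x, ∏ j ∈ Finset.range (k + 1), φ (shift (j * r) x) ∂P
    set C := ∫ x, φ x ∂P
    have e3 : A - C ^ (k + 1) * C = (A - B * C) + (B - C ^ (k + 1)) * C := by ring
    rw [e3]
    refine (norm_add_le _ _).trans ?_
    rw [norm_mul]
    have := mul_le_of_le_one_right (norm_nonneg (B - C ^ (k + 1))) hφint
    push_cast at ih ⊢
    linarith

lemma norm_exp_mul_I_sub_le {y : ℝ} (hy : |y| ≤ 1) :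
    ‖Complex.exp (y * Complex.I) - (1 + y * Complex.I - y ^ 2 / 2)‖ ≤ |y| ^ 3 := by
  have h := Complex.exp_bound (x := y * Complex.I) (by simpa using hy) (n := 3) (by norm_num)
  have e : ∑ k ∈ Finset.range 3, (y * Complex.I) ^ k / (k.factorial : ℂ)
      = 1 + y * Complex.I - y ^ 2 / 2 := by
    simp [Finset.sum_range_succ, mul_pow]
    ring
  rw [e] at h
  refine h.trans ?_
  simp only [norm_mul, Complex.norm_real, Complex.norm_I, mul_one, Real.norm_eq_abs]
  refine mul_le_of_le_one_right (by positivity) ?_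
  norm_num [Nat.factorial]

/-- The linear Taylor term vanishes by centring, and the cubic remainder `|t Z|³` is at most `|t|³ ε
Z²`. The error is therefore a small multiple of the variance and remains small after summation over
all blocks. -/
lemma norm_charFun_centered_sub_le {Z : (ℤ → ℝ) → ℝ} (hZ : Measurable Z) {ε t : ℝ}
    (hε : ∀ x, |Z x| ≤ ε) (ht : |t| * ε ≤ 1) (h0 : ∫ x, Z x ∂P = 0) :
    ‖∫ x, Complex.exp (t * Z x * Complex.I) ∂P - (1 - t ^ 2 / 2 * ∫ x, Z x ^ 2 ∂P : ℝ)‖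
      ≤ |t| ^ 3 * ε * ∫ x, Z x ^ 2 ∂P := by
  have hε0 : 0 ≤ ε := (abs_nonneg _).trans (hε fun _ => 0)
  have tz (x : ℤ → ℝ) : |t * Z x| ≤ 1 := by
    rw [abs_mul]
    exact (mul_le_mul_of_nonneg_left (hε x) (abs_nonneg t)).trans ht
  have iZ : Integrable Z P := integrable_of_measurable_of_bound hZ ε hε
  have iZ2 : Integrable (fun x => Z x ^ 2) P :=
    integrable_of_measurable_of_bound (by fun_prop) (ε ^ 2) fun x => by
      rw [abs_pow]
      exact pow_le_pow_left₀ (abs_nonneg _) (hε x) 2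
  have jZ : Integrable (fun x => (Z x : ℂ)) P := iZ.ofReal
  have jZ2 : Integrable (fun x => ((Z x ^ 2 : ℝ) : ℂ)) P := iZ2.ofReal
  have i1 : Integrable (fun x => (1 : ℂ) + (t * Z x : ℝ) * Complex.I - ((t * Z x : ℝ) : ℂ) ^ 2 / 2)
      P := by
    have e (x : ℤ → ℝ) : (1 : ℂ) + (t * Z x : ℝ) * Complex.I - ((t * Z x : ℝ) : ℂ) ^ 2 / 2
        = 1 + ((Z x : ℝ) : ℂ) * (t * Complex.I) - ((Z x ^ 2 : ℝ) : ℂ) * (t ^ 2 / 2) := by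
      push_cast; ring
    simp only [e]
    exact ((integrable_const _).add (jZ.mul_const _)).sub (jZ2.mul_const _)
  have e1 : ∫ x, ((1 : ℂ) + (t * Z x : ℝ) * Complex.I - ((t * Z x : ℝ) : ℂ) ^ 2 / 2) ∂P
      = ((1 - t ^ 2 / 2 * ∫ x, Z x ^ 2 ∂P : ℝ) : ℂ) := by
    have e (x : ℤ → ℝ) : (1 : ℂ) + (t * Z x : ℝ) * Complex.I - ((t * Z x : ℝ) : ℂ) ^ 2 / 2
        = 1 + ((Z x : ℝ) : ℂ) * (t * Complex.I) - ((Z x ^ 2 : ℝ) : ℂ) * (t ^ 2 / 2) := by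
      push_cast; ring
    simp only [e]
    rw [integral_sub (f := fun x => (1 : ℂ) + ((Z x : ℝ) : ℂ) * (t * Complex.I))
      ((integrable_const _).add (jZ.mul_const _)) (jZ2.mul_const _),
      integral_add (integrable_const _) (jZ.mul_const _), integral_mul_const,
      integral_mul_const, integral_complex_ofReal, integral_complex_ofReal, h0]
    simp
    ring
  have i2 : Integrable (fun x => Complex.exp (t * Z x * Complex.I)) P := by
    refine Integrable.of_bound (Measurable.aestronglyMeasurable (by fun_prop)) 1
      (ae_of_all _ fun x => ?_)
    rw [← Complex.ofReal_mul, Complex.norm_exp_ofReal_mul_I]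
  rw [← e1, ← integral_sub i2 i1, ← integral_const_mul]
  refine norm_integral_le_of_norm_le (iZ2.const_mul _) (ae_of_all _ fun x => ?_)
  rw [← Complex.ofReal_mul]
  refine (norm_exp_mul_I_sub_le (tz x)).trans ?_
  rw [abs_mul, mul_pow, mul_assoc]
  refine mul_le_mul_of_nonneg_left ?_ (by positivity)
  rw [pow_succ, sq_abs, mul_comm]
  exact mul_le_mul_of_nonneg_right (hε x) (sq_nonneg _)

/-- The characteristic function is compared with the `m`-th power for one block (mixing), that
factor with `1 - y` (Taylor), and `1 - y` with `exp (-y)`, where `y` is `t² / 2` times the variance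
of one block. The last two errors are multiplied by `m`, but they are proportional to the block
variance, so only the total variance enters, times a quantity that vanishes with `B`. -/
lemma norm_charFun_blockSum_sub_le (hP : ∀ h, P.map (shift h) = P) {n s a b r m : ℕ} {β : ℝ}
    (hmix : MixingBound P n s β) (hβ : 0 ≤ β) (ha : 1 ≤ a) (hab : a ≤ b) (hr : b + s ≤ a + r)
    (hm : m * r + b ≤ n + r) {A : (ℤ → ℝ) → ℝ} (hA : Measurable A)
    (hAd : DependsOn A (Set.Icc (a : ℤ) b)) {B t : ℝ} (hB : ∀ x, |A x| ≤ B)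
    (ht : |t| * (2 * B) ≤ 1) :
    ‖∫ x, Complex.exp (t * (∑ j ∈ Finset.range m, (A (shift (j * r) x) - ∫ y, A y ∂P) : ℝ)
          * Complex.I) ∂P
        - Real.exp (-(t ^ 2 / 2 * (m * (∫ x, A x ^ 2 ∂P - (∫ x, A x ∂P) ^ 2))))‖
      ≤ m * (4 * β) + m * (∫ x, A x ^ 2 ∂P - (∫ x, A x ∂P) ^ 2)
        * (2 * |t| ^ 3 * B + t ^ 4 * B ^ 2) := by
  have hB0 : 0 ≤ B := (abs_nonneg _).trans (hB fun _ => 0)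
  have iA : Integrable A P := integrable_of_measurable_of_bound hA B hB
  have iA2 : Integrable (fun x => A x ^ 2) P :=
    integrable_of_measurable_of_bound (by fun_prop) (B ^ 2) fun x => by
      rw [abs_pow]
      exact pow_le_pow_left₀ (abs_nonneg _) (hB x) 2
  set e := ∫ y, A y ∂P with he
  have he1 : |e| ≤ B := by
    refine (norm_integral_le_of_norm_le_const (f := A) (ae_of_all P hB)).trans ?_
    simp
  set Z : (ℤ → ℝ) → ℝ := fun x => A x - e with hZdef
  have hZ : Measurable Z := by fun_prop
  have hZB (x : ℤ → ℝ) : |Z x| ≤ 2 * B := (abs_sub _ _).trans (by linarith [hB x])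
  have hZ0 : ∫ x, Z x ∂P = 0 := by
    rw [hZdef, integral_sub iA (integrable_const _)]
    simp [he]
  have hZ2 : ∫ x, Z x ^ 2 ∂P = ∫ x, A x ^ 2 ∂P - e ^ 2 := by
    have e1 (x : ℤ → ℝ) : Z x ^ 2 = A x ^ 2 - (2 * e) * A x + e ^ 2 := by simp only [hZdef]; ring
    simp only [e1]
    rw [integral_add (f := fun x => A x ^ 2 - (2 * e) * A x) (iA2.sub (iA.const_mul _))
      (integrable_const _), integral_sub iA2 (iA.const_mul _), integral_const_mul, ← he]
    simp
    ring
  rw [← hZ2]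
  set V := ∫ x, Z x ^ 2 ∂P with hV
  have hV0 : 0 ≤ V := integral_nonneg fun x => sq_nonneg _
  have hVB : V ≤ 4 * B ^ 2 := by
    have h1 : ∀ x, ‖Z x ^ 2‖ ≤ 4 * B ^ 2 := fun x => by
      rw [norm_pow, Real.norm_eq_abs]
      refine (pow_le_pow_left₀ (abs_nonneg _) (hZB x) 2).trans ?_
      linarith [mul_pow 2 B 2]
    have h2 := (le_abs_self V).trans (norm_integral_le_of_norm_le_const (ae_of_all P h1))
    simpa using h2
  set φ : (ℤ → ℝ) → ℂ := fun x => Complex.exp (t * Z x * Complex.I) with hφ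
  have hφ1 (x : ℤ → ℝ) : ‖φ x‖ ≤ 1 := by
    rw [hφ]
    dsimp only
    rw [← Complex.ofReal_mul, Complex.norm_exp_ofReal_mul_I]
  have hprod (x : ℤ → ℝ) : Complex.exp (t * (∑ j ∈ Finset.range m, (A (shift (j * r) x) - e) : ℝ)
      * Complex.I) = ∏ j ∈ Finset.range m, φ (shift (j * r) x) := by
    rw [hφ, ← Complex.exp_sum, Complex.ofReal_sum, Finset.mul_sum, Finset.sum_mul]
  simp only [hprod]
  have step1 := norm_integral_prod_shift_sub_pow_le hP hmix hβ ha hab hr (φ := φ) (by fun_prop) hφ1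
    (fun x y hxy => by simp only [hφ, hZdef, hAd hxy]) m hm
  have step2 := norm_charFun_centered_sub_le (P := P) hZ hZB ht hZ0
  set y := t ^ 2 / 2 * V with hy
  have hy0 : 0 ≤ y := by positivity
  have hyB : y ≤ 2 * t ^ 2 * B ^ 2 := by
    have := mul_le_mul_of_nonneg_left hVB (show 0 ≤ t ^ 2 / 2 by positivity)
    linarith
  have hy1 : y ≤ 1 := by
    have h1 : (|t| * (2 * B)) ^ 2 ≤ 1 := pow_le_one₀ (by positivity) ht
    rw [mul_pow, sq_abs] at h1
    nlinarith
  have step3 : ‖((1 - y : ℝ) : ℂ) - Real.exp (-y)‖ ≤ y ^ 2 := by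
    have h1 := Real.abs_exp_sub_one_sub_id_le (x := -y) (by rwa [abs_neg, abs_of_nonneg hy0])
    rw [← Complex.ofReal_sub, Complex.norm_real, Real.norm_eq_abs, abs_sub_comm]
    rwa [neg_sq, show Real.exp (-y) - 1 - -y = Real.exp (-y) - (1 - y) by ring] at h1
  have hφint : ‖∫ x, φ x ∂P‖ ≤ 1 := by
    refine (norm_integral_le_of_norm_le_const (ae_of_all _ hφ1)).trans ?_
    simp
  have hw : ‖((Real.exp (-y) : ℝ) : ℂ)‖ ≤ 1 := by
    rw [Complex.norm_real, Real.norm_eq_abs, abs_of_pos (Real.exp_pos _)]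
    exact Real.exp_le_one_iff.2 (by linarith)
  have step4 := norm_pow_sub_pow_le_mul m hφint hw
  have hpow : ((Real.exp (-y) : ℝ) : ℂ) ^ m = Real.exp (-(t ^ 2 / 2 * (m * V))) := by
    rw [← Complex.ofReal_pow, ← Real.exp_nat_mul]
    congr 2
    rw [hy]
    ring
  rw [hpow] at step4
  have step5 : ‖∫ x, φ x ∂P - Real.exp (-y)‖ ≤ |t| ^ 3 * (2 * B) * V + y ^ 2 :=
    (norm_sub_le_norm_sub_add_norm_sub _ _ _).trans (add_le_add step2 step3)
  have hy2 : y ^ 2 ≤ t ^ 4 * B ^ 2 * V := by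
    calc y ^ 2 = y * (t ^ 2 / 2 * V) := by rw [sq]
      _ ≤ (2 * t ^ 2 * B ^ 2) * (t ^ 2 / 2 * V) := mul_le_mul_of_nonneg_right hyB hy0
      _ = t ^ 4 * B ^ 2 * V := by ring
  refine (norm_sub_le_norm_sub_add_norm_sub _ ((∫ x, φ x ∂P) ^ m) _).trans
    (add_le_add step1 (step4.trans ?_))
  calc (m : ℝ) * ‖∫ x, φ x ∂P - Real.exp (-y)‖
      ≤ m * (|t| ^ 3 * (2 * B) * V + t ^ 4 * B ^ 2 * V) := by
        refine mul_le_mul_of_nonneg_left ?_ (by positivity)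
        linarith
    _ = m * V * (2 * |t| ^ 3 * B + t ^ 4 * B ^ 2) := by ring

end Blocks

/-! ### Weak convergence of block sums -/

section Limits

variable {P : Measure (ℤ → ℝ)} [IsProbabilityMeasure P]

lemma tendstoInDistribution_of_charFun {Y : ℕ → (ℤ → ℝ) → ℝ} (hY : ∀ n, Measurable (Y n))
    {σ2 : ℝ} (hσ : 0 ≤ σ2)
    (h : ∀ t : ℝ, Tendsto (fun n => ∫ x, Complex.exp (t * Y n x * Complex.I) ∂P) atTop
      (𝓝 (Real.exp (-(t ^ 2 / 2 * σ2)) : ℝ))) :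
    TendstoInDistribution Y atTop (id : ℝ → ℝ) (fun _ => P) (gaussianReal 0 σ2.toNNReal) where
  forall_aemeasurable n := (hY n).aemeasurable
  aemeasurable_limit := aemeasurable_id
  tendsto := by
    refine ProbabilityMeasure.tendsto_iff_tendsto_charFun.2 fun t => ?_
    have e (n : ℕ) : charFun (P.map (Y n)) t = ∫ x, Complex.exp (t * Y n x * Complex.I) ∂P := by
      rw [charFun_apply_real, integral_map (hY n).aemeasurable
        (Measurable.aestronglyMeasurable (by fun_prop))]
    simp only [ProbabilityMeasure.coe_mk, e, Measure.map_id, charFun_gaussianReal]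
    convert h t using 2
    rw [Complex.ofReal_exp]
    congr 1
    simp [hσ]
    ring

/-- The limit is the point mass at `0`, under which the closed set `{ε ≤ ‖y‖}` is null; the
portmanteau theorem applies. -/
lemma tendstoInMeasure_zero_of_tendstoInDistribution {Y : ℕ → (ℤ → ℝ) → ℝ}
    (h : TendstoInDistribution Y atTop (id : ℝ → ℝ) (fun _ => P)
      (gaussianReal 0 (0 : ℝ).toNNReal)) :
    TendstoInMeasure P Y atTop fun _ => 0 := by
  rw [tendstoInMeasure_iff_norm]
  intro ε hε
  have hc : IsClosed {y : ℝ | ε ≤ ‖y‖} := isClosed_le continuous_const continuous_norm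
  have lim := ProbabilityMeasure.limsup_measure_closed_le_of_tendsto h.tendsto hc
  have z : (gaussianReal 0 (0 : ℝ).toNNReal).map id {y : ℝ | ε ≤ ‖y‖} = 0 := by
    simp [hε]
  simp only [ProbabilityMeasure.coe_mk, z] at lim
  have e (n : ℕ) : P.map (Y n) {y : ℝ | ε ≤ ‖y‖} = P {x | ε ≤ ‖Y n x - 0‖} := by
    rw [Measure.map_apply_of_aemeasurable (h.forall_aemeasurable n) hc.measurableSet]
    simp
  simp only [e] at lim
  exact tendsto_of_le_liminf_of_limsup_le bot_le lim

/-- A triangular array of block sums: the uniform bound `B n → 0` takes the place of a Lindeberg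
condition, and `m n * β n → 0` that of independence. -/
lemma tendstoInDistribution_blockSum (hP : ∀ h, P.map (shift h) = P) {s a b r m : ℕ → ℕ}
    {β B : ℕ → ℝ} {A : ℕ → (ℤ → ℝ) → ℝ} (hA : ∀ n, Measurable (A n)) {σ2 : ℝ}
    (h : ∀ᶠ n in atTop, MixingBound P n (s n) (β n) ∧ 0 ≤ β n ∧ 1 ≤ a n ∧ a n ≤ b n ∧
      b n + s n ≤ a n + r n ∧ m n * r n + b n ≤ n + r n ∧
      DependsOn (A n) (Set.Icc (a n : ℤ) (b n)) ∧ ∀ x, |A n x| ≤ B n)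
    (hβ : Tendsto (fun n => m n * β n) atTop (𝓝 0)) (hB : Tendsto B atTop (𝓝 0))
    (hσ : Tendsto (fun n => m n * (∫ x, A n x ^ 2 ∂P - (∫ x, A n x ∂P) ^ 2)) atTop (𝓝 σ2))
    (hσ0 : 0 ≤ σ2) :
    TendstoInDistribution
      (fun n x => ∑ j ∈ Finset.range (m n), (A n (shift (j * r n) x) - ∫ y, A n y ∂P))
      atTop (id : ℝ → ℝ) (fun _ => P) (gaussianReal 0 σ2.toNNReal) := by
  refine tendstoInDistribution_of_charFun (fun n => ?_) hσ0 fun t => ?_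
  · exact Finset.measurable_fun_sum _ fun j _ => ((hA n).comp (measurable_shift _)).sub_const _
  set V := fun n => m n * (∫ x, A n x ^ 2 ∂P - (∫ x, A n x ∂P) ^ 2) with hV
  have main : Tendsto (fun n => ((Real.exp (-(t ^ 2 / 2 * V n)) : ℝ) : ℂ)) atTop
      (𝓝 (Real.exp (-(t ^ 2 / 2 * σ2)) : ℝ)) :=
    (Complex.continuous_ofReal.tendsto _).comp
      ((Real.continuous_exp.tendsto _).comp (hσ.const_mul _).neg)
  have err : Tendsto (fun n => m n * (4 * β n) + V n * (2 * |t| ^ 3 * B n + t ^ 4 * B n ^ 2))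
      atTop (𝓝 0) := by
    have h1 := (hβ.const_mul 4).add
      (hσ.mul ((hB.const_mul (2 * |t| ^ 3)).add ((hB.pow 2).const_mul (t ^ 4))))
    simp only [mul_zero, ne_eq, OfNat.ofNat_ne_zero, not_false_eq_true, zero_pow, add_zero] at h1
    refine h1.congr fun n => ?_
    simp only [hV]
    ring
  have small : ∀ᶠ n in atTop, |t| * (2 * B n) ≤ 1 := by
    have h1 := (hB.const_mul 2).const_mul |t|
    simp only [mul_zero] at h1
    exact h1.eventually_le_const one_pos
  rw [tendsto_iff_norm_sub_tendsto_zero]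
  have main' := (tendsto_iff_norm_sub_tendsto_zero.1 main)
  refine squeeze_zero' (Eventually.of_forall fun _ => norm_nonneg _) ?_
    (by simpa only [add_zero] using err.add main')
  filter_upwards [h, small] with n ⟨h1, h2, h3, h4, h5, h6, h7, h8⟩ hs
  refine (norm_sub_le_norm_sub_add_norm_sub _ ((Real.exp (-(t ^ 2 / 2 * V n)) : ℝ) : ℂ) _).trans
    (add_le_add ?_ le_rfl)
  exact norm_charFun_blockSum_sub_le hP h1 h2 h3 h4 h5 h6 (hA n) h7 h8 hs

end Limits

end ExtremalIndex

namespace ExtremalIndex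

/-! ### The abstract setting: rare-event arrays and local statistics -/

/-- A stationary law on the path space with thresholds `u_n`, block lengths `s_n`, big block lengths
`s_n q_n` and mixing coefficients `β_n`, satisfying the analogues of (θ1), (θ2) and (θP). -/
structure RareEventArray (P : Measure (ℤ → ℝ)) (u : ℕ → ℝ) (s q : ℕ → ℕ) (β : ℕ → ℝ) (c : ℝ) :
    Prop where
  inv : ∀ h, P.map (shift h) = P
  length : Tendsto s atTop atTop
  ratio : Tendsto q atTop atTop
  count : Tendsto (fun n : ℕ => n * excProb P (u n)) atTop atTop
  big_exceed : Tendsto (fun n => ((s n * q n : ℕ) : ℝ) * excProb P (u n)) atTop (𝓝 0)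
  big_sqrt : Tendsto (fun n : ℕ => ((s n * q n : ℕ) : ℝ) / √(n * excProb P (u n))) atTop (𝓝 0)
  mix_zero : Tendsto (fun n : ℕ => (n : ℝ) / ((s n * q n : ℕ) : ℝ) * β n) atTop (𝓝 0)
  mix_nonneg : ∀ n, 0 ≤ β n
  mix : ∀ᶠ n in atTop, MixingBound P n (s n) (β n)
  second : Tendsto (fun n => (∫ x, cnt (u n) 0 (s n * q n : ℕ) x ^ 2 ∂P)
    / (((s n * q n : ℕ) : ℝ) * excProb P (u n))) atTop (𝓝 c)
  tail : ∀ ε > 0, ∃ m : ℕ, ∀ᶠ n in atTop,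
    ∑ k ∈ Finset.Ioc m (s n * q n), pairProb P (u n) k ≤ ε * excProb P (u n)

/-- A family `h_i`, `i ∈ ℤ`, of functions of `X_i, …, X_{i+s-1}`, periodic up to time shifts by `s`,
whose sums are dominated by `K` times the number of exceedances. -/
structure LocalStatistic (u : ℝ) (s : ℕ) (h : ℤ → (ℤ → ℝ) → ℝ) (K : ℝ) : Prop where
  nonneg : 0 ≤ K
  dependsOn : ∀ i, DependsOn (h i) (Set.Icc i (i + s - 1))
  comp_shift : ∀ (i j : ℤ) x, h i (shift (j * s) x) = h (i + j * s) x
  abs_sum_le : ∀ (a b : ℤ) x, a ≤ b → |∑ i ∈ Finset.Ioc a b, h i x| ≤ K * cnt u a (b + s) x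

section Local

variable {P : Measure (ℤ → ℝ)} [IsProbabilityMeasure P]

lemma dependsOn_sum_Ioc {h : ℤ → (ℤ → ℝ) → ℝ} {s : ℕ}
    (hd : ∀ i, DependsOn (h i) (Set.Icc i (i + s - 1))) (a b : ℤ) :
    DependsOn (fun x => ∑ i ∈ Finset.Ioc a b, h i x) (Set.Icc (a + 1) (b + s - 1)) := by
  intro x y hxy
  refine Finset.sum_congr rfl fun i hi => hd i fun t ht => hxy t ?_
  rw [Finset.mem_Ioc] at hi
  exact ⟨by linarith [ht.1], by linarith [ht.2]⟩

lemma LocalStatistic.integrable_sum {u : ℝ} {s : ℕ} {h : ℤ → (ℤ → ℝ) → ℝ} {K : ℝ}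
    (hl : LocalStatistic u s h K) (hm : ∀ i, Measurable (h i)) {a b : ℤ} (hab : a ≤ b) :
    Integrable (fun x => ∑ i ∈ Finset.Ioc a b, h i x) P :=
  integrable_of_measurable_of_bound (by fun_prop) (K * (b + s - a).toNat) fun x =>
    (hl.abs_sum_le a b x hab).trans (mul_le_mul_of_nonneg_left (cnt_le _ _ _ _) hl.nonneg)

lemma LocalStatistic.integral_abs_sum_le (hP : ∀ h, P.map (shift h) = P) {u : ℝ} {s : ℕ}
    {h : ℤ → (ℤ → ℝ) → ℝ} {K : ℝ} (hl : LocalStatistic u s h K) (hm : ∀ i, Measurable (h i))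
    {a b : ℤ} (hab : a ≤ b) :
    ∫ x, |∑ i ∈ Finset.Ioc a b, h i x| ∂P ≤ K * ((b + s - a) * excProb P u) := by
  have hab' : a ≤ b + s := by omega
  refine (integral_mono (hl.integrable_sum hm hab).abs ((integrable_cnt u a (b + s)).const_mul K)
    fun x => hl.abs_sum_le a b x hab).trans ?_
  rw [integral_const_mul, integral_cnt hP u hab']
  push_cast
  exact le_rfl

lemma integral_sq_cnt_le (hP : ∀ h, P.map (shift h) = P) (u : ℝ) {a b : ℤ} {K : ℕ} (hab : a ≤ b)
    (hb : b - a ≤ K) :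
    ∫ x, cnt u a b x ^ 2 ∂P
      ≤ (b - a) * (excProb P u + 2 * ∑ k ∈ Finset.Ioc 0 K, pairProb P u k) := by
  have e : ∫ x, cnt u a b x ^ 2 ∂P = ∫ x, cnt u 0 (b - a) x ^ 2 ∂P := by
    rw [← integral_comp_shift hP (f := fun x => cnt u 0 (b - a) x ^ 2)
      (Measurable.stronglyMeasurable (by fun_prop)) a]
    simp only [cnt_shift, zero_add, sub_add_cancel]
  have h2 := integral_cnt_mul_cnt_le hP u (a := 0) (b := b - a) (K := K) le_rfl (by omega) hb
  rw [e]
  simp only [Int.cast_zero, sub_zero, Int.cast_sub] at h2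
  refine le_trans ?_ h2
  have i1 : Integrable (fun x => cnt u 0 (b - a) x ^ 2) P := by
    simpa only [sq] using integrable_cnt_mul_cnt u 0 (b - a) 0 (b - a)
  refine integral_mono i1 (integrable_cnt_mul_cnt _ _ _ _ _) fun x => ?_
  rw [sq]
  exact mul_le_mul_of_nonneg_left (cnt_mono _ le_rfl hb _) (cnt_nonneg _ _ _ _)

lemma LocalStatistic.integral_sq_sum_le (hP : ∀ h, P.map (shift h) = P) {u : ℝ} {s : ℕ}
    {h : ℤ → (ℤ → ℝ) → ℝ} {K : ℝ} (hl : LocalStatistic u s h K) (hm : ∀ i, Measurable (h i))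
    {a b : ℤ} {N : ℕ} (hab : a ≤ b) (hb : b + s - a ≤ N) :
    ∫ x, (∑ i ∈ Finset.Ioc a b, h i x) ^ 2 ∂P
      ≤ K ^ 2 * ((b + s - a) * (excProb P u + 2 * ∑ k ∈ Finset.Ioc 0 N, pairProb P u k)) := by
  have h2 := integral_sq_cnt_le hP u (a := a) (b := b + s) (K := N) (by omega) hb
  push_cast at h2
  refine le_trans ?_ (mul_le_mul_of_nonneg_left h2 (sq_nonneg K))
  rw [← integral_const_mul]
  have le (x : ℤ → ℝ) : (∑ i ∈ Finset.Ioc a b, h i x) ^ 2 ≤ K ^ 2 * cnt u a (b + s) x ^ 2 := by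
    rw [← mul_pow, ← sq_abs]
    exact pow_le_pow_left₀ (abs_nonneg _) (hl.abs_sum_le a b x hab) 2
  have i2 : Integrable (fun x => K ^ 2 * cnt u a (b + s) x ^ 2) P := by
    simpa only [sq] using (integrable_cnt_mul_cnt u a (b + s) a (b + s)).const_mul (K * K)
  refine integral_mono (i2.mono' (Measurable.aestronglyMeasurable (by fun_prop))
    (ae_of_all _ fun x => ?_)) i2 le
  rw [Real.norm_eq_abs, abs_of_nonneg (sq_nonneg _)]
  exact le x

lemma tendstoInMeasure_zero_of_integral_abs {Y : ℕ → (ℤ → ℝ) → ℝ} {b : ℕ → ℝ}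
    (h : ∀ᶠ n in atTop, Integrable (Y n) P ∧ ∫ x, |Y n x| ∂P ≤ b n)
    (hb : Tendsto b atTop (𝓝 0)) : TendstoInMeasure P Y atTop fun _ => 0 := by
  rw [tendstoInMeasure_iff_measureReal_norm]
  intro ε hε
  have h0 : Tendsto (fun n => b n / ε) atTop (𝓝 0) := by simpa using hb.div_const ε
  refine squeeze_zero' (Eventually.of_forall fun _ => measureReal_nonneg) ?_ h0
  filter_upwards [h] with n ⟨h1, h2⟩
  rw [le_div_iff₀ hε, mul_comm]
  have := mul_meas_ge_le_integral_of_nonneg (μ := P) (f := fun x => |Y n x|)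
    (ae_of_all _ fun x => abs_nonneg _) h1.abs ε
  simp only [sub_zero, Real.norm_eq_abs]
  exact this.trans h2

/-- Big blocks, small blocks and a remainder. The period `s * q` is a multiple of `s` because the
statistics are only periodic up to shifts by `s`; this makes all blocks time shifts of the first. -/
lemma LocalStatistic.sum_eq_blocks {u : ℝ} {s : ℕ} {h : ℤ → (ℤ → ℝ) → ℝ} {K : ℝ}
    (hl : LocalStatistic u s h K) (q m : ℕ) {L N : ℤ} (hL0 : 0 ≤ L) (hL : L ≤ (s * q : ℕ))
    (hN : (m : ℤ) * (s * q : ℕ) ≤ N) (x : ℤ → ℝ) :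
    ∑ i ∈ Finset.Ioc 0 N, h i x
      = ∑ j ∈ Finset.range m, ∑ i ∈ Finset.Ioc 0 L, h i (shift (j * (s * q : ℕ)) x)
        + ∑ j ∈ Finset.range m, ∑ i ∈ Finset.Ioc L (s * q : ℕ), h i (shift (j * (s * q : ℕ)) x)
        + ∑ i ∈ Finset.Ioc ((m : ℤ) * (s * q : ℕ)) N, h i x := by
  rw [← sum_Ioc_add_sum_Ioc _ (by positivity) hN, sum_Ioc_mul, ← Finset.sum_add_distrib]
  congr 1
  refine Finset.sum_congr rfl fun j _ => ?_
  have e (i : ℤ) : h i (shift (j * (s * q : ℕ)) x) = h (i + j * (s * q : ℕ)) x := by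
    have := hl.comp_shift i (j * q) x
    push_cast
    rwa [show (j : ℤ) * q * s = j * (s * q) by ring] at this
  simp only [e]
  rw [sum_Ioc_add_sum_Ioc _ hL0 hL]

variable {u : ℕ → ℝ} {s q : ℕ → ℕ} {β : ℕ → ℝ} {c : ℝ}

/-- The first `m` lags contribute at most `m v` by `pairProb_le` and the others at most `v`, whence
the constant `1 + 2 (m + 1)`. -/
lemma exists_pair_bound_of_tail {K : ℕ → ℕ} (h : ∃ m : ℕ, ∀ᶠ n in atTop,
      ∑ k ∈ Finset.Ioc m (K n), pairProb P (u n) k ≤ excProb P (u n)) :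
    ∃ C : ℝ, 0 ≤ C ∧ ∀ᶠ n in atTop, excProb P (u n)
      + 2 * ∑ k ∈ Finset.Ioc 0 (K n), pairProb P (u n) k ≤ C * excProb P (u n) := by
  obtain ⟨m, hm⟩ := h
  refine ⟨1 + 2 * (m + 1), by positivity, hm.mono fun n hn => ?_⟩
  have h1 : ∑ k ∈ Finset.Ioc 0 m, pairProb P (u n) k ≤ m * excProb P (u n) := by
    refine (Finset.sum_le_card_nsmul _ _ _ fun k _ => pairProb_le (u n) k).trans ?_
    simp
  have h2 : ∑ k ∈ Finset.Ioc 0 (K n), pairProb P (u n) k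
      ≤ ∑ k ∈ Finset.Ioc 0 m ∪ Finset.Ioc m (K n), pairProb P (u n) k := by
    refine Finset.sum_le_sum_of_subset_of_nonneg (fun k hk => ?_) fun _ _ _ => pairProb_nonneg _ _
    rw [Finset.mem_union, Finset.mem_Ioc, Finset.mem_Ioc]
    rw [Finset.mem_Ioc] at hk
    omega
  rw [Finset.sum_union (by
    rw [Finset.disjoint_left]
    intro k hk hk'
    rw [Finset.mem_Ioc] at hk hk'
    omega)] at h2
  linarith

lemma RareEventArray.exists_pair_bound (hR : RareEventArray P u s q β c) :
    ∃ C : ℝ, 0 ≤ C ∧ ∀ᶠ n in atTop, excProb P (u n)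
      + 2 * ∑ k ∈ Finset.Ioc 0 (s n * q n), pairProb P (u n) k ≤ C * excProb P (u n) :=
  exists_pair_bound_of_tail (by simpa only [one_mul] using hR.tail 1 one_pos)

lemma sqrt_le_self_of_one_le {x : ℝ} (h : 1 ≤ x) : √x ≤ x :=
  Real.sqrt_le_iff.2 ⟨by linarith, by nlinarith⟩

lemma RareEventArray.eventually_pos (hR : RareEventArray P u s q β c) :
    ∀ᶠ n : ℕ in atTop, 1 ≤ s n ∧ 4 ≤ q n ∧ 0 < excProb P (u n) ∧ s n * q n ≤ n ∧ 1 ≤ n := by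
  have h1 := hR.big_sqrt.eventually_lt_const one_pos
  filter_upwards [hR.length.eventually_ge_atTop 1, hR.ratio.eventually_ge_atTop 4,
    hR.count.eventually_ge_atTop 1, h1, eventually_ge_atTop 1] with n h2 h3 h4 h5 h6
  have hv : 0 < excProb P (u n) := by
    by_contra! h0
    have : (n : ℝ) * excProb P (u n) ≤ 0 := mul_nonpos_of_nonneg_of_nonpos (by positivity) h0
    linarith
  refine ⟨h2, h3, hv, ?_, h6⟩
  -- The chain `s q ≤ √(n v) ≤ n v ≤ n` shows that a big block fits into the sample.
  have h7 : 0 < √(n * excProb P (u n)) := Real.sqrt_pos.2 (by linarith)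
  rw [div_lt_one h7] at h5
  have h8 : √(n * excProb P (u n)) ≤ n * excProb P (u n) :=
    sqrt_le_self_of_one_le h4
  have h9 : (n : ℝ) * excProb P (u n) ≤ n :=
    mul_le_of_le_one_right (by positivity) (excProb_le_one _)
  exact_mod_cast (h5.trans_le (h8.trans h9)).le

lemma RareEventArray.tendsto_big_div (hR : RareEventArray P u s q β c) :
    Tendsto (fun n : ℕ => ((s n * q n : ℕ) : ℝ) / n) atTop (𝓝 0) := by
  refine squeeze_zero' (Eventually.of_forall fun n => by positivity) ?_ hR.big_sqrt
  filter_upwards [hR.eventually_pos, hR.count.eventually_ge_atTop 1] with n ⟨_, _, h3, _, h5⟩ h6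
  refine div_le_div_of_nonneg_left (by positivity) (Real.sqrt_pos.2 (by linarith)) ?_
  exact (sqrt_le_self_of_one_le h6).trans (mul_le_of_le_one_right (by positivity) (excProb_le_one _))

/-- The `n + 1 - s` start indices are cut into full periods. Incomplete periods lose fewer than `s
q` indices and the estimators' range about `s`, altogether at most two periods out of `n`. -/
lemma RareEventArray.tendsto_blocks (hR : RareEventArray P u s q β c) :
    Tendsto (fun n : ℕ => (((n + 1 - s n) / (s n * q n) : ℕ) : ℝ) * ((s n * q n : ℕ) : ℝ) / n)
      atTop (𝓝 1) := by
  have lo : Tendsto (fun n : ℕ => 1 - 2 * (((s n * q n : ℕ) : ℝ) / n)) atTop (𝓝 1) := by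
    simpa using (hR.tendsto_big_div.const_mul 2).const_sub 1
  refine tendsto_of_tendsto_of_tendsto_of_le_of_le' lo tendsto_const_nhds ?_ ?_
  · filter_upwards [hR.eventually_pos] with n ⟨h1, h2, h3, h4, h5⟩
    have hn : (0 : ℝ) < n := by exact_mod_cast h5
    have hr : 0 < s n * q n := by positivity
    rw [le_div_iff₀ hn, sub_mul, one_mul, mul_assoc, div_mul_cancel₀ _ hn.ne']
    have h6 := Nat.lt_div_mul_add (a := n + 1 - s n) hr
    have h7 : s n ≤ s n * q n := Nat.le_mul_of_pos_right _ (by omega)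
    have h8 : n ≤ (n + 1 - s n) / (s n * q n) * (s n * q n) + 2 * (s n * q n) := by omega
    have h9 : (n : ℝ) ≤ ((n + 1 - s n) / (s n * q n) : ℕ) * (s n * q n : ℕ)
      + 2 * (s n * q n : ℕ) := by exact_mod_cast h8
    linarith
  · filter_upwards [hR.eventually_pos] with n ⟨h1, h2, h3, h4, h5⟩
    have hn : (0 : ℝ) < n := by exact_mod_cast h5
    rw [div_le_one hn]
    have := Nat.div_mul_le_self (n + 1 - s n) (s n * q n)
    exact_mod_cast this.trans (by omega)

lemma RareEventArray.blocks_mul_le (hR : RareEventArray P u s q β c) :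
    ∀ᶠ n : ℕ in atTop, (((n + 1 - s n) / (s n * q n) : ℕ) : ℝ) ≤ n / ((s n * q n : ℕ) : ℝ) := by
  filter_upwards [hR.eventually_pos] with n ⟨h1, h2, h3, h4, h5⟩
  have hr : (0 : ℝ) < ((s n * q n : ℕ) : ℝ) := by exact_mod_cast (by positivity : 0 < s n * q n)
  rw [le_div_iff₀ hr]
  exact_mod_cast (Nat.div_mul_le_self (n + 1 - s n) (s n * q n)).trans (by omega)

end Local

end ExtremalIndex

namespace ExtremalIndex

/-! ### The central limit theorem by big and small blocks -/

section Local

variable {P : Measure (ℤ → ℝ)} [IsProbabilityMeasure P]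
  {u : ℕ → ℝ} {s q : ℕ → ℕ} {β : ℕ → ℝ} {c : ℝ}

lemma RareEventArray.tendsto_blocks_scaled (hR : RareEventArray P u s q β c) {a V : ℕ → ℝ}
    {ρ κ : ℝ} (hκ : Tendsto (fun n : ℕ => n * excProb P (u n) / a n ^ 2) atTop (𝓝 κ))
    (hρ : Tendsto (fun n => V n / (((s n * q n : ℕ) : ℝ) * excProb P (u n))) atTop (𝓝 ρ)) :
    Tendsto (fun n : ℕ => (((n + 1 - s n) / (s n * q n) : ℕ) : ℝ) * (V n / a n ^ 2)) atTop
      (𝓝 (ρ * κ)) := by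
  have h := (hR.tendsto_blocks.mul hκ).mul hρ
  rw [one_mul, mul_comm] at h
  refine h.congr' ?_
  filter_upwards [hR.eventually_pos] with n ⟨h1, h2, h3, h4, h5⟩
  have hr : (0 : ℝ) < ((s n * q n : ℕ) : ℝ) := by exact_mod_cast (by positivity : 0 < s n * q n)
  have hn : (0 : ℝ) < n := by exact_mod_cast h5
  field_simp

/-- Start indices in `(lo, hi]` involve the times `lo + 1, …, hi + s - 1`; the third condition in
`hlohi` is the gap `s` between consecutive windows, and the fourth bounds each block by `K` times
the period. Any such pattern is allowed, so the same statement serves big and small blocks. -/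
lemma RareEventArray.tendstoInDistribution_blocks (hR : RareEventArray P u s q β c)
    {h : ℕ → ℤ → (ℤ → ℝ) → ℝ} {K ρ κ : ℝ} (hm : ∀ n i, Measurable (h n i))
    (hl : ∀ᶠ n in atTop, LocalStatistic (u n) (s n) (h n) K) {a : ℕ → ℝ}
    (ha : ∀ᶠ n in atTop, 0 < a n)
    (hra : Tendsto (fun n => ((s n * q n : ℕ) : ℝ) / a n) atTop (𝓝 0))
    (hκ : Tendsto (fun n : ℕ => n * excProb P (u n) / a n ^ 2) atTop (𝓝 κ))
    {lo hi : ℕ → ℕ} (hlohi : ∀ᶠ n in atTop, lo n + 1 ≤ hi n ∧ hi n ≤ s n * q n ∧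
      hi n + 2 * s n ≤ lo n + 2 + s n * q n ∧ hi n + s n ≤ lo n + s n * q n)
    (hρ : Tendsto (fun n => (∫ x, (∑ i ∈ Finset.Ioc (lo n : ℤ) (hi n), h n i x) ^ 2 ∂P)
      / (((s n * q n : ℕ) : ℝ) * excProb P (u n))) atTop (𝓝 ρ)) (hρκ : 0 ≤ ρ * κ) :
    TendstoInDistribution
      (fun n x => ∑ j ∈ Finset.range ((n + 1 - s n) / (s n * q n)),
        ((∑ i ∈ Finset.Ioc (lo n : ℤ) (hi n), h n i (shift (j * (s n * q n : ℕ)) x)) / a n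
          - ∫ y, (∑ i ∈ Finset.Ioc (lo n : ℤ) (hi n), h n i y) / a n ∂P))
      atTop (id : ℝ → ℝ) (fun _ => P) (gaussianReal 0 (ρ * κ).toNNReal) := by
  refine tendstoInDistribution_blockSum hR.inv
    (A := fun n x => (∑ i ∈ Finset.Ioc (lo n : ℤ) (hi n), h n i x) / a n)
    (s := s) (a := fun n => lo n + 1) (b := fun n => hi n + s n - 1) (r := fun n => s n * q n)
    (β := β) (B := fun n => K * (((s n * q n : ℕ) : ℝ) / a n)) (fun n => by fun_prop) ?_ ?_ ?_ ?_ hρκ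
  · filter_upwards [hR.mix, hl, ha, hlohi, hR.eventually_pos] with
      n h1 h2 h3 ⟨h4, h5, h6, h7⟩ ⟨h8, h9, _, h10, _⟩
    have hdiv := Nat.div_mul_le_self (n + 1 - s n) (s n * q n)
    have hsr : s n ≤ s n * q n := Nat.le_mul_of_pos_right _ (by omega)
    refine ⟨h1, hR.mix_nonneg n, by omega, by omega, by omega, by omega, ?_, fun x => ?_⟩
    · refine DependsOn.mono ?_ (s := Set.Icc ((lo n : ℤ) + 1) (hi n + s n - 1)) fun x y hxy => by
        simp only [dependsOn_sum_Ioc h2.dependsOn _ _ hxy]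
      rintro t ⟨ht1, ht2⟩
      constructor <;> push_cast <;> omega
    · rw [abs_div, abs_of_pos h3, ← mul_div_assoc]
      refine div_le_div_of_nonneg_right ?_ h3.le
      refine (h2.abs_sum_le _ _ x (by omega)).trans (mul_le_mul_of_nonneg_left ?_ h2.nonneg)
      refine (cnt_le _ _ _ _).trans ?_
      exact_mod_cast (by omega : ((hi n : ℤ) + s n - lo n).toNat ≤ s n * q n)
  · refine squeeze_zero' (Eventually.of_forall fun n =>
      mul_nonneg (by positivity) (hR.mix_nonneg n)) ?_ hR.mix_zero
    filter_upwards [hR.blocks_mul_le] with n hn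
    exact mul_le_mul_of_nonneg_right hn (hR.mix_nonneg n)
  · simpa using hra.const_mul K
  -- A block mean is at most `K r v`, so its square is `O((r v)²) = o(r v)` and the second moment
  -- may replace the variance.
  · have sq_mean : Tendsto (fun n => (∫ x, ∑ i ∈ Finset.Ioc (lo n : ℤ) (hi n), h n i x ∂P) ^ 2
        / (((s n * q n : ℕ) : ℝ) * excProb P (u n))) atTop (𝓝 0) := by
      have h0 := hR.big_exceed.const_mul (K ^ 2)
      rw [mul_zero] at h0
      refine squeeze_zero' (Eventually.of_forall fun n => ?_) ?_ h0
      · exact div_nonneg (sq_nonneg _) (mul_nonneg (by positivity) (excProb_nonneg _))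
      filter_upwards [hl, hlohi, hR.eventually_pos] with n h2 ⟨h4, h5, h6, h7⟩ ⟨h8, h9, h10, _⟩
      have hr : (0 : ℝ) < ((s n * q n : ℕ) : ℝ) := by
        exact_mod_cast (by positivity : 0 < s n * q n)
      rw [div_le_iff₀ (by positivity)]
      have h11 : |∫ x, ∑ i ∈ Finset.Ioc (lo n : ℤ) (hi n), h n i x ∂P|
          ≤ K * (((s n * q n : ℕ) : ℝ) * excProb P (u n)) := by
        refine (abs_integral_le_integral_abs).trans
          ((h2.integral_abs_sum_le hR.inv (hm n) (by omega)).trans ?_)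
        refine mul_le_mul_of_nonneg_left (mul_le_mul_of_nonneg_right ?_ h10.le) h2.nonneg
        have : (hi n : ℝ) + s n ≤ lo n + (s n * q n : ℕ) := by exact_mod_cast h7
        push_cast at this ⊢
        linarith
      rw [← sq_abs]
      refine (pow_le_pow_left₀ (abs_nonneg _) h11 2).trans (le_of_eq ?_)
      ring
    have lim := (hR.tendsto_blocks_scaled hκ hρ).sub (hR.tendsto_blocks_scaled hκ sq_mean)
    rw [zero_mul, sub_zero] at lim
    refine lim.congr fun n => ?_
    simp only [div_pow, integral_div]
    ring

/-- A small block has `2 s` start indices and is dominated by the exceedances at `3 s` times. Its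
second moment is thus `O(s v)`, smaller than `s q v` by a factor of order `1 / q`. -/
lemma RareEventArray.tendsto_small_blocks (hR : RareEventArray P u s q β c)
    {h : ℕ → ℤ → (ℤ → ℝ) → ℝ} {K : ℝ} (hm : ∀ n i, Measurable (h n i))
    (hl : ∀ᶠ n in atTop, LocalStatistic (u n) (s n) (h n) K) :
    Tendsto (fun n => (∫ x, (∑ i ∈ Finset.Ioc ((s n * (q n - 2) : ℕ) : ℤ) (s n * q n : ℕ),
      h n i x) ^ 2 ∂P) / (((s n * q n : ℕ) : ℝ) * excProb P (u n))) atTop (𝓝 0) := by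
  obtain ⟨C, hC0, hC⟩ := hR.exists_pair_bound
  have h0 : Tendsto (fun n => K ^ 2 * 3 * C * ((q n : ℝ))⁻¹) atTop (𝓝 0) := by
    have h := (tendsto_inv_atTop_zero.comp
      (tendsto_natCast_atTop_atTop (R := ℝ) |>.comp hR.ratio)).const_mul (K ^ 2 * 3 * C)
    rw [mul_zero] at h
    exact h
  refine squeeze_zero' (Eventually.of_forall fun n => ?_) ?_ h0
  · exact div_nonneg (integral_nonneg fun x => sq_nonneg _)
      (mul_nonneg (by positivity) (excProb_nonneg _))
  filter_upwards [hl, hR.eventually_pos, hC] with n h1 ⟨h2, h3, h4, _⟩ h5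
  have hs : (0 : ℝ) < s n := by exact_mod_cast h2
  have hq : (0 : ℝ) < q n := by exact_mod_cast (by omega : 0 < q n)
  obtain ⟨k, hk⟩ : ∃ k, q n = k + 2 := ⟨q n - 2, by omega⟩
  have e : ((s n * q n : ℕ) : ℤ) + s n - (s n * (q n - 2) : ℕ) = 3 * s n := by
    rw [hk]
    push_cast [Nat.add_sub_cancel]
    ring
  have h6 := h1.integral_sq_sum_le hR.inv (hm n) (a := (s n * (q n - 2) : ℕ)) (b := (s n * q n : ℕ))
    (N := s n * q n) (by
      have : s n * (q n - 2) ≤ s n * q n := Nat.mul_le_mul_left _ (by omega)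
      exact_mod_cast this) (by
      rw [e]
      have : 3 * s n ≤ s n * q n := by rw [mul_comm]; exact Nat.mul_le_mul_left _ (by omega)
      exact_mod_cast this)
  have e' : (((s n * q n : ℕ) : ℤ) : ℝ) + s n - ((s n * (q n - 2) : ℕ) : ℤ) = 3 * s n := by
    exact_mod_cast e
  rw [e'] at h6
  rw [div_le_iff₀ (by positivity)]
  refine h6.trans ?_
  have h7 := mul_le_mul_of_nonneg_left h5 (show 0 ≤ K ^ 2 * (3 * s n) by positivity)
  rw [mul_assoc] at h7
  refine h7.trans (le_of_eq ?_)
  push_cast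
  field_simp

/-- Each period sets aside `2 s` indices: one `s` because the statistics look ahead, another for the
mixing gap. The small blocks are themselves separated, since `4 ≤ q`, and so converge to a normal
law with variance zero. The scaling `a` is left free: `√(n v)` gives the limit theorem for the
estimators, `n v` the law of large numbers for the exceedance count. -/
theorem RareEventArray.tendstoInDistribution_sum (hR : RareEventArray P u s q β c)
    {h : ℕ → ℤ → (ℤ → ℝ) → ℝ} {K ρ κ : ℝ} (hm : ∀ n i, Measurable (h n i))
    (hl : ∀ᶠ n in atTop, LocalStatistic (u n) (s n) (h n) K) {a : ℕ → ℝ}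
    (ha : ∀ᶠ n in atTop, 0 < a n)
    (hra : Tendsto (fun n => ((s n * q n : ℕ) : ℝ) / a n) atTop (𝓝 0))
    (hκ : Tendsto (fun n : ℕ => n * excProb P (u n) / a n ^ 2) atTop (𝓝 κ))
    (hρ : Tendsto (fun n => (∫ x, (∑ i ∈ Finset.Ioc (0 : ℤ) (s n * (q n - 2) : ℕ), h n i x) ^ 2 ∂P)
      / (((s n * q n : ℕ) : ℝ) * excProb P (u n))) atTop (𝓝 ρ)) :
    0 ≤ ρ * κ ∧ TendstoInDistribution
      (fun (n : ℕ) x => (∑ i ∈ Finset.Ioc (0 : ℤ) ((n : ℤ) - s n + 1), h n i x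
        - ∫ y, ∑ i ∈ Finset.Ioc (0 : ℤ) ((n : ℤ) - s n + 1), h n i y ∂P) / a n)
      atTop (id : ℝ → ℝ) (fun _ => P) (gaussianReal 0 (ρ * κ).toNNReal) := by
  have hρ0 : 0 ≤ ρ := ge_of_tendsto' hρ fun n => div_nonneg (integral_nonneg fun x => sq_nonneg _)
    (mul_nonneg (by positivity) (excProb_nonneg _))
  have hκ0 : 0 ≤ κ := ge_of_tendsto' hκ fun n =>
    div_nonneg (mul_nonneg (by positivity) (excProb_nonneg _)) (sq_nonneg _)
  have hρκ : 0 ≤ ρ * κ := mul_nonneg hρ0 hκ0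
  refine ⟨hρκ, ?_⟩
  have index : ∀ᶠ n in atTop, 1 ≤ s n ∧ s n * (q n - 2) + 2 * s n = s n * q n ∧
      2 * s n ≤ s n * (q n - 2) ∧ s n * q n ≤ n := by
    filter_upwards [hR.eventually_pos] with n ⟨h1, h2, _, h3, _⟩
    obtain ⟨k, hk⟩ : ∃ k, q n = k + 4 := ⟨q n - 4, by omega⟩
    refine ⟨h1, ?_, ?_, h3⟩
    · rw [hk, show k + 4 - 2 = k + 2 by omega]; ring
    · rw [hk, show k + 4 - 2 = k + 2 by omega, mul_add, mul_comm 2]; omega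
  have big := hR.tendstoInDistribution_blocks hm hl ha hra hκ (lo := fun _ => 0)
    (hi := fun n => s n * (q n - 2)) (index.mono fun n hn => by omega)
    (by simpa only [Nat.cast_zero] using hρ) hρκ
  have small := hR.tendstoInDistribution_blocks hm hl ha hra hκ (lo := fun n => s n * (q n - 2))
    (hi := fun n => s n * q n) (index.mono fun n hn => by omega)
    (hR.tendsto_small_blocks hm hl) (by simp)
  rw [zero_mul] at small
  have small' := tendstoInMeasure_zero_of_tendstoInDistribution small
  set R : ℕ → (ℤ → ℝ) → ℝ := fun n x =>
    ∑ i ∈ Finset.Ioc ((((n + 1 - s n) / (s n * q n) : ℕ) : ℤ) * (s n * q n : ℕ))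
      ((n : ℤ) - s n + 1), h n i x with hRdef
  have mR (n : ℕ) : Measurable (R n) := by simp only [hRdef]; fun_prop
  have rem_index : ∀ᶠ n in atTop,
      (((n + 1 - s n) / (s n * q n) : ℕ) : ℤ) * (s n * q n : ℕ) ≤ (n : ℤ) - s n + 1 ∧
      (n : ℤ) - s n + 1 + s n - (((n + 1 - s n) / (s n * q n) : ℕ) : ℤ) * (s n * q n : ℕ)
        ≤ 2 * (s n * q n : ℕ) := by
    filter_upwards [index] with n ⟨h1, h2, h3, h4⟩
    have h5 := Nat.div_mul_le_self (n + 1 - s n) (s n * q n)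
    have h6 := Nat.lt_div_mul_add (a := n + 1 - s n) (b := s n * q n) (by omega)
    have h7 : (((n + 1 - s n) / (s n * q n) * (s n * q n) : ℕ) : ℤ)
      = (((n + 1 - s n) / (s n * q n) : ℕ) : ℤ) * (s n * q n : ℕ) := by push_cast; ring
    rw [← h7]
    omega
  have rem : TendstoInMeasure P (fun n x => (R n x - ∫ y, R n y ∂P) / a n) atTop fun _ => 0 := by
    -- The remainder is dominated by exceedances at no more than two periods of times, so its `L¹`
    -- norm is at most `2 K` times the period; centring doubles this.
    have h0 := hra.const_mul (4 * K)
    rw [mul_zero] at h0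
    refine tendstoInMeasure_zero_of_integral_abs ?_ h0
    filter_upwards [hl, ha, rem_index] with n h1 h2 ⟨h3, h4⟩
    have iR : Integrable (R n) P := h1.integrable_sum (hm n) h3
    refine ⟨(iR.sub (integrable_const _)).div_const _, ?_⟩
    have hK := h1.nonneg
    have h5 : ∫ x, |R n x| ∂P ≤ K * (2 * (s n * q n : ℕ)) := by
      refine (h1.integral_abs_sum_le hR.inv (hm n) h3).trans (mul_le_mul_of_nonneg_left ?_ hK)
      have h4' : ((n : ℤ) - s n + 1 : ℤ) + (s n : ℝ)
          - ((((n + 1 - s n) / (s n * q n) : ℕ) : ℤ) * (s n * q n : ℕ) : ℤ)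
          ≤ 2 * (s n * q n : ℕ) := by exact_mod_cast h4
      refine (mul_le_mul_of_nonneg_right h4' (excProb_nonneg _)).trans ?_
      exact mul_le_of_le_one_right (by positivity) (excProb_le_one _)
    have h6 : |∫ y, R n y ∂P| ≤ K * (2 * (s n * q n : ℕ)) :=
      abs_integral_le_integral_abs.trans h5
    have h7 : ∫ x, |R n x - ∫ y, R n y ∂P| ∂P ≤ 2 * (K * (2 * (s n * q n : ℕ))) := by
      refine (integral_mono (iR.sub (integrable_const _)).abs (iR.abs.add (integrable_const _))
        fun x => abs_sub _ _).trans ?_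
      have := integral_add iR.abs (integrable_const (μ := P) |∫ y, R n y ∂P|)
      simp only [Pi.add_apply] at this ⊢
      rw [this]
      simp only [integral_const, probReal_univ, smul_eq_mul, one_mul]
      linarith
    simp only [abs_div, abs_of_pos h2, integral_div]
    rw [div_le_iff₀ h2]
    refine h7.trans (le_of_eq ?_)
    field_simp
    ring
  have sum1 := big.add_of_tendstoInMeasure_const small' small.forall_aemeasurable
  have sum2 := sum1.add_of_tendstoInMeasure_const rem fun n =>
    (((mR n).sub_const _).div_const _).aemeasurable
  simp only [id, add_zero] at sum2
  refine tendstoInDistribution_of_tendstoInMeasure_sub _ _ sum2 ?_ fun n =>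
    Measurable.aemeasurable (by fun_prop)
  -- For large `n` the three centred pieces add up exactly to the centred sum.
  refine TendstoInMeasure.congr' (f := fun _ _ => 0) (g := 0) ?_ (ae_eq_refl _) ?_
  · filter_upwards [hl, ha, rem_index, index] with n h1 h2 ⟨h3, h4⟩ ⟨h5, h6, h7, h8⟩
    refine ae_of_all _ fun x => ?_
    have hLr : ((s n * (q n - 2) : ℕ) : ℤ) ≤ (s n * q n : ℕ) := by exact_mod_cast (by omega)
    have split := h1.sum_eq_blocks (q n) ((n + 1 - s n) / (s n * q n)) (by positivity) hLr h3
    have i1 (j : ℕ) : Integrable (fun x => ∑ i ∈ Finset.Ioc (0 : ℤ) (s n * (q n - 2) : ℕ),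
        h n i (shift (j * (s n * q n : ℕ)) x)) P := by
      have := h1.integrable_sum (P := P) (hm n) (a := 0) (b := (s n * (q n - 2) : ℕ)) (by positivity)
      rw [← hR.inv (j * (s n * q n : ℕ))] at this
      exact this.comp_measurable (measurable_shift _)
    have i2 (j : ℕ) : Integrable (fun x => ∑ i ∈ Finset.Ioc ((s n * (q n - 2) : ℕ) : ℤ)
        (s n * q n : ℕ), h n i (shift (j * (s n * q n : ℕ)) x)) P := by
      have := h1.integrable_sum (P := P) (hm n) hLr
      rw [← hR.inv (j * (s n * q n : ℕ))] at this
      exact this.comp_measurable (measurable_shift _)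
    have i3 : Integrable (R n) P := h1.integrable_sum (hm n) h3
    have mean : ∫ y, ∑ i ∈ Finset.Ioc (0 : ℤ) ((n : ℤ) - s n + 1), h n i y ∂P
        = ((n + 1 - s n) / (s n * q n) : ℕ)
            * (∫ y, ∑ i ∈ Finset.Ioc (0 : ℤ) (s n * (q n - 2) : ℕ), h n i y ∂P)
          + ((n + 1 - s n) / (s n * q n) : ℕ)
            * (∫ y, ∑ i ∈ Finset.Ioc ((s n * (q n - 2) : ℕ) : ℤ) (s n * q n : ℕ), h n i y ∂P)
          + ∫ y, R n y ∂P := by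
      simp only [split]
      have i12 : Integrable (fun x => ∑ j ∈ Finset.range ((n + 1 - s n) / (s n * q n)),
            ∑ i ∈ Finset.Ioc (0 : ℤ) (s n * (q n - 2) : ℕ), h n i (shift (j * (s n * q n : ℕ)) x)
          + ∑ j ∈ Finset.range ((n + 1 - s n) / (s n * q n)),
            ∑ i ∈ Finset.Ioc ((s n * (q n - 2) : ℕ) : ℤ) (s n * q n : ℕ),
              h n i (shift (j * (s n * q n : ℕ)) x)) P :=
        (integrable_finsetSum _ fun j _ => i1 j).add (integrable_finsetSum _ fun j _ => i2 j)
      rw [integral_add i12 i3,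
        integral_add (integrable_finsetSum _ fun j _ => i1 j)
          (integrable_finsetSum _ fun j _ => i2 j),
        integral_finsetSum _ fun j _ => i1 j, integral_finsetSum _ fun j _ => i2 j]
      have e1 (j : ℕ) := integral_comp_shift hR.inv
        (f := fun y => ∑ i ∈ Finset.Ioc (0 : ℤ) (s n * (q n - 2) : ℕ), h n i y)
        (Measurable.stronglyMeasurable (by fun_prop)) (j * (s n * q n : ℕ))
      have e2 (j : ℕ) := integral_comp_shift hR.inv
        (f := fun y => ∑ i ∈ Finset.Ioc ((s n * (q n - 2) : ℕ) : ℤ) (s n * q n : ℕ), h n i y)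
        (Measurable.stronglyMeasurable (by fun_prop)) (j * (s n * q n : ℕ))
      simp only [e1, e2, Finset.sum_const, Finset.card_range, nsmul_eq_mul]
    simp only [Pi.sub_apply, Pi.add_apply]
    rw [mean, split x]
    simp only [Finset.sum_sub_distrib, ← Finset.sum_div, Finset.sum_const, Finset.card_range,
      nsmul_eq_mul, integral_div, Nat.cast_zero, hRdef]
    ring
  · rw [tendstoInMeasure_iff_norm]
    intro ε hε
    simp [hε.not_ge]

end Local

end ExtremalIndex

namespace ExtremalIndex

/-- A family `t_i`, `i ∈ ℤ`, of nonnegative functions of `X_i, …, X_{i+s-1}`, periodic up to time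
shifts by `s`, whose sums are dominated by the number of exceedances. -/
structure NumeratorStatistic (u : ℝ) (s : ℕ) (t : ℤ → (ℤ → ℝ) → ℝ) : Prop where
  nonneg : ∀ i x, 0 ≤ t i x
  dependsOn : ∀ i, DependsOn (t i) (Set.Icc i (i + s - 1))
  comp_shift : ∀ (i j : ℤ) x, t i (shift (j * s) x) = t (i + j * s) x
  sum_le : ∀ (a b : ℤ) x, a ≤ b → ∑ i ∈ Finset.Ioc a b, t i x ≤ cnt u a (b + s) x

/-! ### The asymptotic variance of numerator minus `θ` times denominator -/

section Ratio

variable {P : Measure (ℤ → ℝ)} [IsProbabilityMeasure P]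

lemma NumeratorStatistic.localStatistic_sub {u : ℝ} {s : ℕ} {t : ℤ → (ℤ → ℝ) → ℝ} (hs : 1 ≤ s)
    (ht : NumeratorStatistic u s t) {θ : ℝ} (hθ : 0 ≤ θ) :
    LocalStatistic u s (fun i x => t i x - θ * exc u i x) (1 + θ) where
  nonneg := by positivity
  dependsOn i x y hxy := by
    simp only [ht.dependsOn i hxy]
    rw [exc_congr (hxy i ⟨le_rfl, by omega⟩)]
  comp_shift i j x := by simp only [ht.comp_shift, exc_shift]
  abs_sum_le a b x hab := by
    rw [Finset.sum_sub_distrib, ← Finset.mul_sum]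
    have h1 := ht.sum_le a b x hab
    have h2 : 0 ≤ ∑ i ∈ Finset.Ioc a b, t i x := Finset.sum_nonneg fun i _ => ht.nonneg i x
    have h3 : cnt u a b x ≤ cnt u a (b + s) x := cnt_mono u le_rfl (by omega) x
    have h4 := mul_le_mul_of_nonneg_left h3 hθ
    have h5 := mul_nonneg hθ (cnt_nonneg u a b x)
    change |_ - θ * cnt u a b x| ≤ _
    rw [abs_le]
    constructor <;> linarith [cnt_nonneg u a (b + s) x]

lemma NumeratorStatistic.localStatistic {u : ℝ} {s : ℕ} {t : ℤ → (ℤ → ℝ) → ℝ} (hs : 1 ≤ s)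
    (ht : NumeratorStatistic u s t) : LocalStatistic u s t 1 := by
  simpa using ht.localStatistic_sub hs le_rfl

lemma numeratorStatistic_exc {u : ℝ} {s : ℕ} (hs : 1 ≤ s) : NumeratorStatistic u s (exc u) where
  nonneg i x := exc_nonneg u i x
  dependsOn i _ _ hxy := exc_congr (hxy i ⟨le_rfl, by omega⟩)
  comp_shift i j x := exc_shift u i _ x
  sum_le a b x _ := cnt_mono u le_rfl (by omega) x

/-- The means of single terms may vary with `i`, as they do for disjoint blocks; only sums over full
periods of length `s` have a common mean. -/
lemma NumeratorStatistic.integral_sum_mul (hP : ∀ h, P.map (shift h) = P) {u : ℝ} {s : ℕ}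
    {t : ℤ → (ℤ → ℝ) → ℝ} (hs : 1 ≤ s) (ht : NumeratorStatistic u s t)
    (hm : ∀ i, Measurable (t i)) (k : ℕ) :
    ∫ x, ∑ i ∈ Finset.Ioc (0 : ℤ) (k * s), t i x ∂P
      = k * ∫ x, ∑ i ∈ Finset.Ioc (0 : ℤ) s, t i x ∂P := by
  simp only [sum_Ioc_mul]
  have e (j : ℕ) (x : ℤ → ℝ) : ∑ i ∈ Finset.Ioc (0 : ℤ) s, t (i + j * s) x
      = ∑ i ∈ Finset.Ioc (0 : ℤ) s, t i (shift (j * s) x) := by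
    simp only [ht.comp_shift]
  have int (j : ℕ) : Integrable (fun x => ∑ i ∈ Finset.Ioc (0 : ℤ) s, t i (shift (j * s) x)) P := by
    have := (ht.localStatistic hs).integrable_sum (P := P) hm (a := 0) (b := s) (by positivity)
    rw [← hP (j * s)] at this
    exact this.comp_measurable (measurable_shift _)
  simp only [e]
  rw [integral_finsetSum _ fun j _ => int j]
  have e1 (j : ℕ) := integral_comp_shift hP
    (f := fun y => ∑ i ∈ Finset.Ioc (0 : ℤ) s, t i y)
    (Measurable.stronglyMeasurable (by fun_prop)) (j * s)
  simp only [e1, Finset.sum_const, Finset.card_range, nsmul_eq_mul]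

variable {u : ℕ → ℝ} {s q : ℕ → ℕ} {β : ℕ → ℝ} {c : ℝ}

lemma RareEventArray.tendsto_ratio_sub (hR : RareEventArray P u s q β c) :
    Tendsto (fun n => ((s n * (q n - 2) : ℕ) : ℝ) / ((s n * q n : ℕ) : ℝ)) atTop (𝓝 1) := by
  have h0 : Tendsto (fun n => 1 - 2 * ((q n : ℝ))⁻¹) atTop (𝓝 1) := by
    have h := ((tendsto_inv_atTop_zero.comp
      (tendsto_natCast_atTop_atTop (R := ℝ) |>.comp hR.ratio)).const_mul 2).const_sub 1
    rw [mul_zero, sub_zero] at h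
    exact h
  refine h0.congr' ?_
  filter_upwards [hR.eventually_pos] with n ⟨h1, h2, _⟩
  have hs : (s n : ℝ) ≠ 0 := by exact_mod_cast (by omega : s n ≠ 0)
  have hq : (q n : ℝ) ≠ 0 := by exact_mod_cast (by omega : q n ≠ 0)
  rw [Nat.cast_mul, Nat.cast_mul, Nat.cast_sub (by omega)]
  field_simp
  push_cast
  ring

/-- For counts `N_L ≤ N_K` one has `N_K² - N_L² ≤ 2 (N_K - N_L) N_K`, and `N_K - N_L` is a count
over `K - L` times. So `c` is unaffected by shortening the blocks by a negligible proportion. -/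
lemma integral_sq_cnt_sub_le (hP : ∀ h, P.map (shift h) = P) (u : ℝ) {L K : ℕ} (hLK : L ≤ K) :
    0 ≤ ∫ x, cnt u 0 K x ^ 2 ∂P - ∫ x, cnt u 0 L x ^ 2 ∂P ∧
    ∫ x, cnt u 0 K x ^ 2 ∂P - ∫ x, cnt u 0 L x ^ 2 ∂P
      ≤ 2 * (((K : ℝ) - L) * (excProb P u + 2 * ∑ k ∈ Finset.Ioc 0 K, pairProb P u k)) := by
  have hLK' : (L : ℤ) ≤ K := by exact_mod_cast hLK
  have i1 (N : ℕ) : Integrable (fun x => cnt u 0 N x ^ 2) P := by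
    simpa only [sq] using integrable_cnt_mul_cnt u 0 N 0 N
  rw [← integral_sub (i1 _) (i1 _)]
  constructor
  · refine integral_nonneg fun x => sub_nonneg.2 ?_
    exact pow_le_pow_left₀ (cnt_nonneg _ _ _ _) (cnt_mono _ le_rfl hLK' _) 2
  · have h5 := integral_cnt_mul_cnt_le hP u (a := L) (b := K) (K := K) (by positivity) hLK' le_rfl
    refine le_trans ?_ (mul_le_mul_of_nonneg_left h5 zero_le_two)
    rw [← integral_const_mul]
    refine integral_mono ((i1 _).sub (i1 _)) ((integrable_cnt_mul_cnt _ _ _ _ _).const_mul 2)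
      fun x => ?_
    have e := cnt_add_cnt u (a := 0) (b := L) (c := K) (by positivity) hLK' x
    dsimp only
    rw [← e]
    nlinarith [cnt_nonneg u 0 L x, cnt_nonneg u L K x]

lemma RareEventArray.tendsto_second_moment (hR : RareEventArray P u s q β c) :
    Tendsto (fun n => (∫ x, cnt (u n) 0 (s n * (q n - 2) : ℕ) x ^ 2 ∂P)
      / (((s n * q n : ℕ) : ℝ) * excProb P (u n))) atTop (𝓝 c) := by
  obtain ⟨C, hC0, hC⟩ := hR.exists_pair_bound
  have h0 : Tendsto (fun n => 4 * C * ((q n : ℝ))⁻¹) atTop (𝓝 0) := by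
    have h := (tendsto_inv_atTop_zero.comp
      (tendsto_natCast_atTop_atTop (R := ℝ) |>.comp hR.ratio)).const_mul (4 * C)
    rw [mul_zero] at h
    exact h
  have diff : Tendsto (fun n => (∫ x, cnt (u n) 0 (s n * q n : ℕ) x ^ 2 ∂P
      - ∫ x, cnt (u n) 0 (s n * (q n - 2) : ℕ) x ^ 2 ∂P)
      / (((s n * q n : ℕ) : ℝ) * excProb P (u n))) atTop (𝓝 0) := by
    refine squeeze_zero' ?_ ?_ h0
    all_goals
      filter_upwards [hR.eventually_pos, hC] with n ⟨h1, h2, h3, _⟩ h4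
      have hLr : s n * (q n - 2) ≤ s n * q n := Nat.mul_le_mul_left _ (by omega)
      obtain ⟨h5, h6⟩ := integral_sq_cnt_sub_le hR.inv (u n) hLr
    · exact div_nonneg h5 (by positivity)
    · have hs : (0 : ℝ) < s n := by exact_mod_cast h1
      have hq : (0 : ℝ) < q n := by exact_mod_cast (by omega : 0 < q n)
      rw [div_le_iff₀ (by positivity)]
      have e' : ((s n * q n : ℕ) : ℝ) - ((s n * (q n - 2) : ℕ) : ℝ) = 2 * s n := by
        rw [Nat.cast_mul, Nat.cast_mul, Nat.cast_sub (by omega)]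
        push_cast
        ring
      rw [e'] at h6
      have h7 := mul_le_mul_of_nonneg_left h4 (show (0 : ℝ) ≤ 2 * s n by positivity)
      have e2 : 4 * C * (q n : ℝ)⁻¹ * (((s n * q n : ℕ) : ℝ) * excProb P (u n))
          = 2 * (2 * s n * (C * excProb P (u n))) := by
        push_cast
        field_simp
        ring
      rw [e2]
      linarith
  have := hR.second.sub diff
  rw [sub_zero] at this
  refine this.congr fun n => ?_
  rw [← sub_div]
  ring

lemma RareEventArray.tendsto_mean_cnt (hR : RareEventArray P u s q β c) :
    Tendsto (fun n => (∫ x, cnt (u n) 0 (s n * (q n - 2) : ℕ) x ∂P)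
      / (((s n * q n : ℕ) : ℝ) * excProb P (u n))) atTop (𝓝 1) := by
  refine hR.tendsto_ratio_sub.congr' ?_
  filter_upwards [hR.eventually_pos] with n ⟨h1, h2, h3, _⟩
  rw [integral_cnt hR.inv _ (by positivity)]
  have hr : ((s n * q n : ℕ) : ℝ) ≠ 0 := by
    exact_mod_cast (by positivity : 0 < s n * q n).ne'
  push_cast at hr ⊢
  field_simp
  ring

lemma RareEventArray.tendsto_mean_sum (hR : RareEventArray P u s q β c)
    {t : ℕ → ℤ → (ℤ → ℝ) → ℝ} (hm : ∀ n i, Measurable (t n i))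
    (ht : ∀ᶠ n in atTop, NumeratorStatistic (u n) (s n) (t n)) {θ : ℝ}
    (hτ : Tendsto (fun n => (∫ x, ∑ i ∈ Finset.Ioc (0 : ℤ) (s n), t n i x ∂P)
      / (s n * excProb P (u n))) atTop (𝓝 θ)) :
    Tendsto (fun n => (∫ x, ∑ i ∈ Finset.Ioc (0 : ℤ) (s n * (q n - 2) : ℕ), t n i x ∂P)
      / (((s n * q n : ℕ) : ℝ) * excProb P (u n))) atTop (𝓝 θ) := by
  have h := hR.tendsto_ratio_sub.mul hτ
  rw [one_mul] at h
  refine h.congr' ?_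
  filter_upwards [hR.eventually_pos, ht] with n ⟨h1, h2, h3, _⟩ h4
  have e := h4.integral_sum_mul hR.inv h1 (hm n) (q n - 2)
  have e' : ((s n * (q n - 2) : ℕ) : ℤ) = ((q n - 2 : ℕ) : ℤ) * s n := by
    push_cast; ring
  rw [e', e]
  have hs : (s n : ℝ) ≠ 0 := by exact_mod_cast (by omega : s n ≠ 0)
  have hq : (q n : ℝ) ≠ 0 := by exact_mod_cast (by omega : q n ≠ 0)
  rw [Nat.cast_mul, Nat.cast_mul]
  field_simp

/-- In `E[(T - θ N)²]`, `hkey` permits replacing `T²` by `T` and `N T` by `N`, because both `T` and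
`N` are at most the count over `(0, s (q - 1)]`, which includes the `s` times that the last
statistics look ahead. The rest has limit `θ - 2θ + θ² c`. -/
lemma RareEventArray.tendsto_second_moment_sub (hR : RareEventArray P u s q β c)
    {t : ℕ → ℤ → (ℤ → ℝ) → ℝ} (hm : ∀ n i, Measurable (t n i))
    (ht : ∀ᶠ n in atTop, NumeratorStatistic (u n) (s n) (t n)) {θ : ℝ} (hθ : 0 ≤ θ)
    (hτ : Tendsto (fun n => (∫ x, ∑ i ∈ Finset.Ioc (0 : ℤ) (s n), t n i x ∂P)
      / (s n * excProb P (u n))) atTop (𝓝 θ))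
    (hkey : Tendsto (fun n => (∫ x, cnt (u n) 0 (s n * (q n - 1) : ℕ) x
        * |∑ i ∈ Finset.Ioc (0 : ℤ) (s n * (q n - 2) : ℕ), t n i x - 1| ∂P)
      / (((s n * q n : ℕ) : ℝ) * excProb P (u n))) atTop (𝓝 0)) :
    Tendsto (fun n => (∫ x, (∑ i ∈ Finset.Ioc (0 : ℤ) (s n * (q n - 2) : ℕ),
        (t n i x - θ * exc (u n) i x)) ^ 2 ∂P)
      / (((s n * q n : ℕ) : ℝ) * excProb P (u n))) atTop (𝓝 (θ * (θ * c - 1))) := by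
  have main := ((hR.tendsto_mean_sum hm ht hτ).sub (hR.tendsto_mean_cnt.const_mul (2 * θ))).add
    (hR.tendsto_second_moment.const_mul (θ ^ 2))
  have e : θ - 2 * θ * 1 + θ ^ 2 * c = θ * (θ * c - 1) := by ring
  rw [e] at main
  have err := hkey.const_mul (1 + 2 * θ)
  rw [mul_zero] at err
  refine tendsto_of_tendsto_of_dist main (squeeze_zero' (Eventually.of_forall fun n => dist_nonneg)
    ?_ err)
  filter_upwards [hR.eventually_pos, ht] with n ⟨h1, h2, h3, _⟩ h4
  set L : ℤ := ((s n * (q n - 2) : ℕ) : ℤ) with hL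
  set L' : ℤ := ((s n * (q n - 1) : ℕ) : ℤ) with hL'
  have hLL' : L + s n = L' := by
    obtain ⟨k, hk⟩ : ∃ k, q n = k + 2 := ⟨q n - 2, by omega⟩
    rw [hL, hL', hk, show k + 2 - 2 = k by omega, show k + 2 - 1 = k + 1 by omega]
    push_cast
    ring
  have hL0 : 0 ≤ L := by positivity
  set T : (ℤ → ℝ) → ℝ := fun x => ∑ i ∈ Finset.Ioc 0 L, t n i x with hT
  have mT : Measurable T := by simp only [hT]; fun_prop
  have T0 (x : ℤ → ℝ) : 0 ≤ T x := Finset.sum_nonneg fun i _ => h4.nonneg i x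
  have T1 (x : ℤ → ℝ) : T x ≤ cnt (u n) 0 L' x := hLL' ▸ h4.sum_le 0 L x hL0
  have N1 (x : ℤ → ℝ) : cnt (u n) 0 L x ≤ cnt (u n) 0 L' x :=
    cnt_mono _ le_rfl (by omega) x
  have N0 (x : ℤ → ℝ) : 0 ≤ cnt (u n) 0 L x := cnt_nonneg _ _ _ _
  have B1 (x : ℤ → ℝ) : cnt (u n) 0 L' x ≤ (L' - 0).toNat := cnt_le _ _ _ _
  have iT : Integrable T P := (h4.localStatistic h1).integrable_sum (hm n) hL0
  have iN : Integrable (cnt (u n) 0 L) P := integrable_cnt _ _ _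
  have iN2 : Integrable (fun x => cnt (u n) 0 L x ^ 2) P := by
    simpa only [sq] using integrable_cnt_mul_cnt (u n) 0 L 0 L
  set D : ℝ := ((L' - 0).toNat : ℝ) with hD
  have D0 : 0 ≤ D := by positivity
  have iK : Integrable (fun x => cnt (u n) 0 L' x * |T x - 1|) P := by
    refine integrable_of_measurable_of_bound (by fun_prop) (D * (D + 1)) fun x => ?_
    rw [abs_mul, abs_abs, abs_of_nonneg (cnt_nonneg _ _ _ _)]
    refine mul_le_mul (B1 x) ?_ (abs_nonneg _) D0
    rw [abs_le]
    constructor <;> linarith [T0 x, T1 x, B1 x]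
  have iS : Integrable (fun x => (T x - θ * cnt (u n) 0 L x) ^ 2) P := by
    refine integrable_of_measurable_of_bound (by fun_prop) (((1 + θ) * D) ^ 2) fun x => ?_
    rw [abs_pow]
    refine pow_le_pow_left₀ (abs_nonneg _) ?_ 2
    have h5 := mul_le_mul_of_nonneg_left ((N1 x).trans (B1 x)) hθ
    have h6 := mul_nonneg hθ (N0 x)
    rw [abs_le]
    constructor <;> nlinarith [T0 x, T1 x, B1 x]
  have eS : ∫ x, (∑ i ∈ Finset.Ioc 0 L, (t n i x - θ * exc (u n) i x)) ^ 2 ∂P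
      = ∫ x, (T x - θ * cnt (u n) 0 L x) ^ 2 ∂P := by
    simp only [Finset.sum_sub_distrib, ← Finset.mul_sum, hT, cnt]
  rw [eS, Real.dist_eq]
  have hr : (0 : ℝ) < ((s n * q n : ℕ) : ℝ) * excProb P (u n) :=
    mul_pos (by exact_mod_cast (by positivity : 0 < s n * q n)) h3
  rw [← mul_div_assoc, ← mul_div_assoc, ← mul_div_assoc, ← sub_div, ← add_div, ← sub_div, abs_div,
    abs_of_pos hr]
  refine div_le_div_of_nonneg_right ?_ hr.le
  have i1 : Integrable (fun x => T x - 2 * θ * cnt (u n) 0 L x) P := iT.sub (iN.const_mul _)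
  have i2 : Integrable (fun x => T x - 2 * θ * cnt (u n) 0 L x + θ ^ 2 * cnt (u n) 0 L x ^ 2) P :=
    i1.add (iN2.const_mul _)
  rw [← integral_const_mul, ← integral_const_mul, ← integral_sub iT (iN.const_mul (2 * θ)),
    ← integral_add i1 (iN2.const_mul (θ ^ 2)), ← integral_sub i2 iS, ← integral_const_mul,
    ← Real.norm_eq_abs]
  refine norm_integral_le_of_norm_le (iK.const_mul (1 + 2 * θ)) (ae_of_all _ fun x => ?_)
  have e1 : T x - 2 * θ * cnt (u n) 0 L x + θ ^ 2 * cnt (u n) 0 L x ^ 2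
      - (T x - θ * cnt (u n) 0 L x) ^ 2
      = -(T x * (T x - 1)) + 2 * θ * (cnt (u n) 0 L x * (T x - 1)) := by ring
  rw [e1, Real.norm_eq_abs]
  refine (abs_add_le _ _).trans ?_
  rw [abs_neg, abs_mul, abs_mul (2 * θ), abs_mul (cnt _ _ _ _), abs_of_nonneg (T0 x),
    abs_of_nonneg (N0 x), abs_of_nonneg (show 0 ≤ 2 * θ by positivity)]
  change _ ≤ (1 + 2 * θ) * (cnt (u n) 0 L' x * |T x - 1|)
  have h5 := mul_le_mul_of_nonneg_right (T1 x) (abs_nonneg (T x - 1))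
  have h6 := mul_le_mul_of_nonneg_left (mul_le_mul_of_nonneg_right (N1 x) (abs_nonneg (T x - 1)))
    (show 0 ≤ 2 * θ by positivity)
  linarith

end Ratio

end ExtremalIndex

namespace ExtremalIndex

/-! ### Law of large numbers, bias and the limit law of the ratio -/

section RatioLimit

variable {P : Measure (ℤ → ℝ)} [IsProbabilityMeasure P]
  {u : ℕ → ℝ} {s q : ℕ → ℕ} {β : ℕ → ℝ} {c : ℝ}

lemma RareEventArray.tendsto_exceedCount (hR : RareEventArray P u s q β c) :
    TendstoInMeasure P (fun (n : ℕ) x => cnt (u n) 0 ((n : ℤ) - s n + 1) x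
      / (n * excProb P (u n))) atTop fun _ => 1 := by
  have ha : ∀ᶠ n : ℕ in atTop, 0 < n * excProb P (u n) := hR.count.eventually_gt_atTop 0
  have inv : Tendsto (fun n : ℕ => (n * excProb P (u n))⁻¹) atTop (𝓝 0) :=
    tendsto_inv_atTop_zero.comp hR.count
  have hra : Tendsto (fun n : ℕ => ((s n * q n : ℕ) : ℝ) / (n * excProb P (u n))) atTop (𝓝 0) := by
    refine squeeze_zero' ?_ ?_ hR.big_sqrt
    all_goals filter_upwards [hR.count.eventually_ge_atTop 1] with n hn
    · positivity
    · exact div_le_div_of_nonneg_left (by positivity) (Real.sqrt_pos.2 (by linarith))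
        (sqrt_le_self_of_one_le hn)
  have hκ : Tendsto (fun n : ℕ => n * excProb P (u n) / (n * excProb P (u n)) ^ 2) atTop (𝓝 0) := by
    refine inv.congr' ?_
    filter_upwards [ha] with n hn
    field_simp
  obtain ⟨_, h⟩ := hR.tendstoInDistribution_sum (h := fun n => exc (u n)) (fun n i => by fun_prop)
    (hR.eventually_pos.mono fun n hn => (numeratorStatistic_exc hn.1).localStatistic hn.1)
    ha hra hκ hR.tendsto_second_moment
  rw [mul_zero] at h
  have h' := tendstoInMeasure_zero_of_tendstoInDistribution h
  rw [tendstoInMeasure_iff_measureReal_norm] at h' ⊢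
  intro ε hε
  have mean : Tendsto (fun n : ℕ => (∫ x, cnt (u n) 0 ((n : ℤ) - s n + 1) x ∂P)
      / (n * excProb P (u n))) atTop (𝓝 1) := by
    have lo : Tendsto (fun n : ℕ => 1 - ((s n * q n : ℕ) : ℝ) / n) atTop (𝓝 1) := by
      simpa using hR.tendsto_big_div.const_sub 1
    refine tendsto_of_tendsto_of_tendsto_of_le_of_le' lo tendsto_const_nhds ?_ ?_
    all_goals
      filter_upwards [hR.eventually_pos] with n ⟨h1, h2, h3, h4, h5⟩
      have hn : (0 : ℝ) < n := by exact_mod_cast h5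
      have hsr : s n ≤ s n * q n := Nat.le_mul_of_pos_right _ (by omega)
      have h6 : (s n : ℝ) ≤ (s n * q n : ℕ) := by exact_mod_cast hsr
      have h7 : (1 : ℝ) ≤ s n := by exact_mod_cast h1
      rw [integral_cnt hR.inv _ (by omega), mul_div_mul_right _ _ h3.ne']
      push_cast at h6 ⊢
    · rw [le_div_iff₀ hn, sub_mul, div_mul_cancel₀ _ hn.ne']
      linarith
    · rw [div_le_one hn]
      linarith
  have close : ∀ᶠ n : ℕ in atTop, |(∫ x, cnt (u n) 0 ((n : ℤ) - s n + 1) x ∂P)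
      / (n * excProb P (u n)) - 1| < ε / 2 := by
    have := (tendsto_iff_norm_sub_tendsto_zero.1 mean).eventually_lt_const (half_pos hε)
    simpa only [Real.norm_eq_abs] using this
  refine squeeze_zero' (Eventually.of_forall fun n => measureReal_nonneg) ?_ (h' (ε / 2) (half_pos hε))
  filter_upwards [close] with n hn
  refine measureReal_mono fun x hx => ?_
  simp only [Set.mem_ofPred_eq, Real.norm_eq_abs, sub_zero, sub_div] at hx ⊢
  have := abs_sub_le (cnt (u n) 0 ((n : ℤ) - s n + 1) x / (n * excProb P (u n)))
    ((∫ x, cnt (u n) 0 ((n : ℤ) - s n + 1) x ∂P) / (n * excProb P (u n))) 1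
  change ε / 2 ≤ |cnt (u n) 0 ((n : ℤ) - s n + 1) x / (n * excProb P (u n))
    - (∫ x, cnt (u n) 0 ((n : ℤ) - s n + 1) x ∂P) / (n * excProb P (u n))|
  linarith

lemma RareEventArray.tendsto_bias (hR : RareEventArray P u s q β c)
    {t : ℕ → ℤ → (ℤ → ℝ) → ℝ} (hm : ∀ n i, Measurable (t n i))
    (ht : ∀ᶠ n in atTop, NumeratorStatistic (u n) (s n) (t n)) {θ : ℝ} (hθ : 0 ≤ θ)
    (hbias : Tendsto (fun n : ℕ => √(n * excProb P (u n))
      * ((∫ x, ∑ i ∈ Finset.Ioc (0 : ℤ) (s n), t n i x ∂P) / (s n * excProb P (u n)) - θ))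
      atTop (𝓝 0)) :
    Tendsto (fun n : ℕ => (∫ x, ∑ i ∈ Finset.Ioc (0 : ℤ) ((n : ℤ) - s n + 1),
      (t n i x - θ * exc (u n) i x) ∂P) / √(n * excProb P (u n))) atTop (𝓝 0) := by
  have bound := hbias.abs.add (hR.big_sqrt.const_mul (2 * (1 + θ)))
  simp only [abs_zero, mul_zero, add_zero] at bound
  refine squeeze_zero_norm' ?_ bound
  filter_upwards [hR.eventually_pos, ht] with n ⟨h1, h2, h3, h4, h5⟩ h6
  have hl := h6.localStatistic_sub h1 hθ
  have hml (i : ℤ) : Measurable fun x => t n i x - θ * exc (u n) i x := by fun_prop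
  set v := excProb P (u n) with hv
  have hn : (0 : ℝ) < n := by exact_mod_cast h5
  have hs : (0 : ℝ) < s n := by exact_mod_cast h1
  have hsr : s n ≤ s n * q n := Nat.le_mul_of_pos_right _ (by omega)
  -- The first `k s` indices form full periods, whose mean is governed by the bias condition; the
  -- leftover is dominated by exceedances at no more than `2 s` times.
  set k := (n + 1 - s n) / s n with hk
  have hk1 : k * s n ≤ n + 1 - s n := Nat.div_mul_le_self _ _
  have hk2 : n + 1 - s n < k * s n + s n := Nat.lt_div_mul_add (by omega)
  have hk3 : (k : ℤ) * s n ≤ (n : ℤ) - s n + 1 := by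
    have : (k : ℤ) * s n = (k * s n : ℕ) := by push_cast; ring
    omega
  have hk4 : (n : ℤ) - s n + 1 + s n - (k : ℤ) * s n ≤ 2 * s n := by
    have : (k : ℤ) * s n = (k * s n : ℕ) := by push_cast; ring
    omega
  have hks : (k : ℝ) * s n ≤ n := by exact_mod_cast (by omega : k * s n ≤ n)
  have i1 := hl.integrable_sum (P := P) hml (a := 0) (b := k * s n) (by positivity)
  have i2 := hl.integrable_sum (P := P) hml hk3
  have split : ∫ x, ∑ i ∈ Finset.Ioc (0 : ℤ) ((n : ℤ) - s n + 1),
      (t n i x - θ * exc (u n) i x) ∂P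
      = ∫ x, ∑ i ∈ Finset.Ioc (0 : ℤ) (k * s n), (t n i x - θ * exc (u n) i x) ∂P
        + ∫ x, ∑ i ∈ Finset.Ioc (k * s n : ℤ) ((n : ℤ) - s n + 1),
          (t n i x - θ * exc (u n) i x) ∂P := by
    rw [← integral_add i1 i2]
    simp only [sum_Ioc_add_sum_Ioc (fun i => t n i _ - θ * exc (u n) i _)
      (show 0 ≤ (k : ℤ) * s n by positivity) hk3]
  have first : ∫ x, ∑ i ∈ Finset.Ioc (0 : ℤ) (k * s n), (t n i x - θ * exc (u n) i x) ∂P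
      = k * s n * v * ((∫ x, ∑ i ∈ Finset.Ioc (0 : ℤ) (s n), t n i x ∂P) / (s n * v) - θ) := by
    simp only [Finset.sum_sub_distrib, ← Finset.mul_sum]
    have i3 := (h6.localStatistic h1).integrable_sum (P := P) (hm n) (a := 0) (b := k * s n)
      (by positivity)
    have e1 := integral_sub i3 ((integrable_cnt (P := P) (u n) 0 (k * s n)).const_mul θ)
    simp only [cnt] at e1
    rw [e1, h6.integral_sum_mul hR.inv h1 (hm n) k, integral_const_mul]
    have e2 := integral_cnt hR.inv (u n) (a := 0) (b := k * s n) (by positivity)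
    simp only [cnt] at e2
    rw [e2, ← hv]
    push_cast
    field_simp
    ring
  have second : |∫ x, ∑ i ∈ Finset.Ioc (k * s n : ℤ) ((n : ℤ) - s n + 1),
      (t n i x - θ * exc (u n) i x) ∂P| ≤ 2 * (1 + θ) * (s n * q n : ℕ) := by
    refine abs_integral_le_integral_abs.trans ((hl.integral_abs_sum_le hR.inv hml hk3).trans ?_)
    have h7 : (((n : ℤ) - s n + 1 : ℤ) : ℝ) + s n - ((k : ℤ) * s n : ℤ) ≤ 2 * (s n * q n : ℕ) := by
      have : (n : ℤ) - s n + 1 + s n - (k : ℤ) * s n ≤ 2 * (s n * q n : ℕ) := by omega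
      exact_mod_cast this
    have h8 : ((((n : ℤ) - s n + 1 : ℤ) : ℝ) + s n - ((k : ℤ) * s n : ℤ)) * v
        ≤ 2 * (s n * q n : ℕ) :=
      (mul_le_mul_of_nonneg_right h7 h3.le).trans
        (mul_le_of_le_one_right (by positivity) (excProb_le_one _))
    refine (mul_le_mul_of_nonneg_left h8 (by positivity)).trans (le_of_eq (by ring))
  set δ := (∫ x, ∑ i ∈ Finset.Ioc (0 : ℤ) (s n), t n i x ∂P) / (s n * v) - θ with hδ
  have hroot : 0 < √(n * v) := Real.sqrt_pos.2 (by positivity)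
  rw [split, first, Real.norm_eq_abs, abs_div, abs_of_pos hroot, div_le_iff₀ hroot, add_mul,
    mul_assoc (2 * (1 + θ)), div_mul_cancel₀ _ hroot.ne', abs_mul, abs_of_pos hroot]
  refine (abs_add_le _ _).trans (add_le_add ?_ second)
  rw [abs_mul, abs_of_nonneg (show 0 ≤ k * s n * v by positivity)]
  have e : √(n * v) * |δ| * √(n * v) = n * v * |δ| := by
    rw [mul_right_comm, Real.mul_self_sqrt (by positivity)]
  rw [e]
  gcongr

/-- The asymptotic normality of the ratio of a numerator statistic and the number of exceedances. -/
theorem RareEventArray.tendstoInDistribution_ratio (hR : RareEventArray P u s q β c)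
    {t : ℕ → ℤ → (ℤ → ℝ) → ℝ} (hm : ∀ n i, Measurable (t n i))
    (ht : ∀ᶠ n in atTop, NumeratorStatistic (u n) (s n) (t n)) {θ : ℝ} (hθ : 0 ≤ θ)
    (hbias : Tendsto (fun n : ℕ => √(n * excProb P (u n))
      * ((∫ x, ∑ i ∈ Finset.Ioc (0 : ℤ) (s n), t n i x ∂P) / (s n * excProb P (u n)) - θ))
      atTop (𝓝 0))
    (hkey : Tendsto (fun n => (∫ x, cnt (u n) 0 (s n * (q n - 1) : ℕ) x
        * |∑ i ∈ Finset.Ioc (0 : ℤ) (s n * (q n - 2) : ℕ), t n i x - 1| ∂P)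
      / (((s n * q n : ℕ) : ℝ) * excProb P (u n))) atTop (𝓝 0)) :
    0 ≤ θ * (θ * c - 1) ∧ TendstoInDistribution
      (fun (n : ℕ) x => √(n * excProb P (u n))
        * ((∑ i ∈ Finset.Ioc (0 : ℤ) ((n : ℤ) - s n + 1), t n i x)
          / cnt (u n) 0 ((n : ℤ) - s n + 1) x - θ))
      atTop (id : ℝ → ℝ) (fun _ => P) (gaussianReal 0 (θ * (θ * c - 1)).toNNReal) := by
  have ha : ∀ᶠ n : ℕ in atTop, 0 < √(n * excProb P (u n)) :=
    (hR.count.eventually_gt_atTop 0).mono fun n hn => Real.sqrt_pos.2 hn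
  -- As `√(n v) → ∞`, the bias condition includes convergence of the normalised mean to `θ`.
  have hτ : Tendsto (fun n => (∫ x, ∑ i ∈ Finset.Ioc (0 : ℤ) (s n), t n i x ∂P)
      / (s n * excProb P (u n))) atTop (𝓝 θ) := by
    have inv : Tendsto (fun n : ℕ => (√(n * excProb P (u n)))⁻¹) atTop (𝓝 0) :=
      tendsto_inv_atTop_zero.comp (Real.tendsto_sqrt_atTop.comp hR.count)
    have h := (inv.mul hbias).add_const θ
    rw [mul_zero, zero_add] at h
    refine h.congr' ?_
    filter_upwards [ha] with n hn
    rw [inv_mul_cancel_left₀ hn.ne', sub_add_cancel]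
  have hκ : Tendsto (fun n : ℕ => n * excProb P (u n) / √(n * excProb P (u n)) ^ 2) atTop (𝓝 1) := by
    refine tendsto_const_nhds.congr' ?_
    filter_upwards [hR.count.eventually_gt_atTop 0] with n hn
    rw [Real.sq_sqrt hn.le, div_self hn.ne']
  obtain ⟨h0, clt⟩ := hR.tendstoInDistribution_sum
    (h := fun n i x => t n i x - θ * exc (u n) i x) (fun n i => by fun_prop)
    (by filter_upwards [hR.eventually_pos, ht] with n h1 h2 using h2.localStatistic_sub h1.1 hθ)
    ha hR.big_sqrt hκ (hR.tendsto_second_moment_sub hm ht hθ hτ hkey)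
  rw [mul_one] at h0 clt
  refine ⟨h0, ?_⟩
  have bias : TendstoInMeasure P (fun (n : ℕ) (_ : ℤ → ℝ) =>
      (∫ x, ∑ i ∈ Finset.Ioc (0 : ℤ) ((n : ℤ) - s n + 1), (t n i x - θ * exc (u n) i x) ∂P)
        / √(n * excProb P (u n))) atTop fun _ => 0 :=
    tendstoInMeasure_of_tendsto_ae (fun n => aestronglyMeasurable_const)
      (ae_of_all _ fun _ => hR.tendsto_bias hm ht hθ hbias)
  have clt' := clt.add_of_tendstoInMeasure_const bias fun n => aemeasurable_const
  have hW := hR.tendsto_exceedCount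
  have mW (n : ℕ) : AEMeasurable (fun x => cnt (u n) 0 ((n : ℤ) - s n + 1) x
      / (n * excProb P (u n))) P := Measurable.aemeasurable (by fun_prop)
  -- Truncating the denominator at `1 / 2` makes the quotient continuous everywhere. It agrees with
  -- the true ratio unless the normalised count deviates from `1` by at least `1 / 2`, an event
  -- whose probability tends to zero.
  have slutsky := clt'.continuous_comp_prodMk_of_tendstoInMeasure_const
    (g := fun p : ℝ × ℝ => p.1 / max p.2 (1 / 2))
    (continuous_fst.div (continuous_snd.max continuous_const)
      fun p => (lt_of_lt_of_le (by norm_num) (le_max_right p.2 (1 / 2))).ne') hW mW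
  have lim : (fun x : ℝ => (id x + 0) / max 1 (1 / 2)) = id := by
    funext x
    norm_num
  simp only [lim] at slutsky
  refine tendstoInDistribution_of_tendstoInMeasure_sub _ _ slutsky ?_ fun n =>
    Measurable.aemeasurable (by unfold cnt; fun_prop)
  rw [tendstoInMeasure_iff_measureReal_norm] at hW ⊢
  intro ε hε
  refine squeeze_zero' (Eventually.of_forall fun n => measureReal_nonneg) ?_ (hW (1 / 2) (by norm_num))
  filter_upwards [ha, hR.count.eventually_gt_atTop 0] with n h1 h2
  refine measureReal_mono fun x hx => ?_
  by_contra hx'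
  simp only [Set.mem_ofPred_eq, Real.norm_eq_abs, not_le, abs_lt] at hx'
  simp only [Set.mem_ofPred_eq, Pi.sub_apply, Pi.add_apply, Pi.zero_apply, sub_zero] at hx
  set W := cnt (u n) 0 ((n : ℤ) - s n + 1) x with hWdef
  have hW1 : 1 / 2 < W / (n * excProb P (u n)) := by linarith [hx'.1]
  have hW0 : 0 < W := by
    by_contra! h
    have := div_nonpos_of_nonpos_of_nonneg h h2.le
    linarith
  refine hx.not_gt (lt_of_eq_of_lt ?_ hε)
  rw [norm_eq_zero, max_eq_left hW1.le, ← add_div, sub_add_cancel, Finset.sum_sub_distrib,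
    ← Finset.mul_sum]
  change √_ * (_ / W - θ) - (_ - θ * W) / _ / _ = 0
  have e : (n : ℝ) * excProb P (u n) = √(n * excProb P (u n)) * √(n * excProb P (u n)) :=
    (Real.mul_self_sqrt h2.le).symm
  set A := √(n * excProb P (u n))
  rw [e]
  field_simp
  ring

end RatioLimit

end ExtremalIndex

namespace ExtremalIndex

/-! ### Numerators are close to one in the presence of an exceedance -/

section Clusters

variable {P : Measure (ℤ → ℝ)} [IsProbabilityMeasure P]

lemma integral_cnt_mul_le_of_weights (hP : ∀ h, P.map (shift h) = P) {u : ℝ} {K : ℕ}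
    {f : (ℤ → ℝ) → ℝ} (hf : Integrable (fun x => cnt u 0 K x * f x) P) {w : ℤ → ℤ → ℝ}
    (hw : ∀ x, ∀ j ∈ Finset.Ioc (0 : ℤ) K, u < x j →
      f x ≤ ∑ k ∈ Finset.Ioc (0 : ℤ) K, w j k * exc u k x) :
    ∫ x, cnt u 0 K x * f x ∂P
      ≤ ∑ j ∈ Finset.Ioc (0 : ℤ) K, ∑ k ∈ Finset.Ioc (0 : ℤ) K,
        w j k * pairProb P u (j - k).natAbs := by
  have int (j k : ℤ) : Integrable (fun x => w j k * (exc u j x * exc u k x)) P :=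
    (integrable_exc_mul_exc u j k).const_mul _
  have e : ∫ x, ∑ j ∈ Finset.Ioc (0 : ℤ) K, ∑ k ∈ Finset.Ioc (0 : ℤ) K,
      w j k * (exc u j x * exc u k x) ∂P = ∑ j ∈ Finset.Ioc (0 : ℤ) K, ∑ k ∈ Finset.Ioc (0 : ℤ) K,
        w j k * pairProb P u (j - k).natAbs := by
    rw [integral_finsetSum _ fun j _ => integrable_finsetSum _ fun k _ => int j k]
    simp only [integral_finsetSum _ fun k _ => int _ k, integral_const_mul, integral_exc_mul_exc hP]
  rw [← e]
  refine integral_mono hf (integrable_finsetSum _ fun j _ => integrable_finsetSum _ fun k _ =>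
    int j k) fun x => ?_
  simp only [cnt, Finset.sum_mul]
  refine Finset.sum_le_sum fun j hj => ?_
  by_cases hx : u < x j
  · simp only [exc_of_lt hx, one_mul]
    exact hw x j hj hx
  · simp [exc_of_not_lt hx]

lemma sum_near_le (m K : ℕ) {j : ℤ} (hj : j ∈ Finset.Ioc (0 : ℤ) K) :
    ∑ k ∈ Finset.Ioc (0 : ℤ) K, (if (j - k).natAbs ≤ m then (1 : ℝ) else 0) ≤ 2 * m + 1 := by
  refine (sum_natAbs_sub_le (F := fun k => if k ≤ m then (1 : ℝ) else 0)
    (fun k => by positivity) K hj).trans ?_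
  have : ∑ k ∈ Finset.Ioc 0 K, (if k ≤ m then (1 : ℝ) else 0) ≤ m := by
    rw [← Finset.sum_filter]
    simp only [Finset.sum_const, nsmul_eq_mul, mul_one]
    have : (Finset.Ioc 0 K).filter (· ≤ m) ⊆ Finset.Ioc 0 m := fun k hk => by
      simp only [Finset.mem_filter, Finset.mem_Ioc] at hk ⊢
      omega
    exact_mod_cast (Finset.card_le_card this).trans (by simp)
  simp only [zero_le, if_true]
  linarith

/-- The exceptional times lie in `(0, s]` or `(L - s, L + s]`. -/
lemma sum_boundary_le (s L : ℕ) :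
    ∑ j ∈ Finset.Ioc (0 : ℤ) (L + s : ℕ),
      (if (s : ℤ) ≤ j ∧ j + s ≤ L then (0 : ℝ) else 1) ≤ 3 * s := by
  simp only [Finset.sum_ite, Finset.sum_const, smul_zero, zero_add, nsmul_eq_mul, mul_one]
  have h1 : (Finset.Ioc (0 : ℤ) (L + s : ℕ)).filter (fun j => ¬((s : ℤ) ≤ j ∧ j + s ≤ L))
      ⊆ Finset.Ioc (0 : ℤ) s ∪ Finset.Ioc ((L : ℤ) - s) (L + s) := fun k hk => by
    simp only [Finset.mem_filter, Finset.mem_union, Finset.mem_Ioc] at hk ⊢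
    push_cast at hk
    omega
  have h2 := (Finset.card_le_card h1).trans (Finset.card_union_le _ _)
  simp only [Int.card_Ioc] at h2
  exact_mod_cast h2.trans (by omega)

/-- Pairs of times are split into near pairs with `j` in the interior, near pairs with `j` at the
boundary, and pairs more than `m` apart. Near pairs use the trivial bound `pairProb ≤ excProb`;
distant ones keep `pairProb` and use weights at most `1`. -/
lemma sum_weights_mul_pairProb_le (u : ℝ) (s L m : ℕ) {w : ℤ → ℤ → ℝ}
    (hw0 : ∀ j k, 0 ≤ w j k) (hw1 : ∀ j k, w j k ≤ 1) :
    ∑ j ∈ Finset.Ioc (0 : ℤ) (L + s : ℕ), ∑ k ∈ Finset.Ioc (0 : ℤ) (L + s : ℕ),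
        (if (s : ℤ) ≤ j ∧ j + s ≤ L then w j k else 1) * pairProb P u (j - k).natAbs
      ≤ excProb P u * (∑ j ∈ Finset.Ioc (0 : ℤ) (L + s : ℕ), ∑ k ∈ Finset.Ioc (0 : ℤ) (L + s : ℕ),
          (if (j - k).natAbs ≤ m then w j k else 0))
        + excProb P u * ((2 * m + 1) * (3 * s))
        + (L + s) * (2 * ∑ k ∈ Finset.Ioc m (L + s), pairProb P u k) := by
  set K := L + s with hK
  set v := excProb P u with hv
  have v0 : 0 ≤ v := excProb_nonneg u
  set F : ℕ → ℝ := fun k => if m < k then pairProb P u k else 0 with hF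
  have F0 (k : ℕ) : 0 ≤ F k := by
    simp only [hF]
    split_ifs
    · exact pairProb_nonneg u k
    · exact le_rfl
  have term (j k : ℤ) : (if (s : ℤ) ≤ j ∧ j + s ≤ L then w j k else 1)
        * pairProb P u (j - k).natAbs
      ≤ v * (if (j - k).natAbs ≤ m then w j k else 0)
        + v * ((if (s : ℤ) ≤ j ∧ j + s ≤ L then (0 : ℝ) else 1)
          * (if (j - k).natAbs ≤ m then (1 : ℝ) else 0)) + F (j - k).natAbs := by
    have p0 := pairProb_nonneg (P := P) u (j - k).natAbs
    have p1 := pairProb_le (P := P) u (j - k).natAbs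
    have hFd : F (j - k).natAbs
      = if (j - k).natAbs ≤ m then 0 else pairProb P u (j - k).natAbs := by
      simp only [hF]
      by_cases h : (j - k).natAbs ≤ m
      · simp [h, not_lt.2 h]
      · simp [h, not_le.1 h]
    rw [hFd]
    have a0 := hw0 j k
    have a1 := hw1 j k
    split_ifs <;> nlinarith
  refine (Finset.sum_le_sum fun j _ => Finset.sum_le_sum fun k _ => term j k).trans ?_
  simp only [Finset.sum_add_distrib, ← Finset.mul_sum]
  refine add_le_add (add_le_add le_rfl (mul_le_mul_of_nonneg_left ?_ v0)) ?_
  · calc ∑ j ∈ Finset.Ioc (0 : ℤ) K, (if (s : ℤ) ≤ j ∧ j + s ≤ L then (0 : ℝ) else 1)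
          * ∑ k ∈ Finset.Ioc (0 : ℤ) K, (if (j - k).natAbs ≤ m then (1 : ℝ) else 0)
        ≤ ∑ j ∈ Finset.Ioc (0 : ℤ) K, (if (s : ℤ) ≤ j ∧ j + s ≤ L then (0 : ℝ) else 1)
          * (2 * m + 1) := Finset.sum_le_sum fun j hj =>
            mul_le_mul_of_nonneg_left (sum_near_le m K hj) (by split_ifs <;> norm_num)
      _ ≤ (2 * m + 1) * (3 * s) := by
        rw [← Finset.sum_mul, mul_comm]
        exact mul_le_mul_of_nonneg_left (sum_boundary_le s L) (by positivity)
  · refine (Finset.sum_le_card_nsmul _ _ (2 * ∑ k ∈ Finset.Ioc m K, pairProb P u k)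
      fun j hj => ?_).trans (le_of_eq ?_)
    · refine (sum_natAbs_sub_le F0 K hj).trans ?_
      have e0 : F 0 = 0 := by simp [hF]
      rw [e0, zero_add]
      refine mul_le_mul_of_nonneg_left ?_ zero_le_two
      simp only [hF]
      rw [← Finset.sum_filter]
      refine Finset.sum_le_sum_of_subset_of_nonneg (fun k hk => ?_) fun _ _ _ => pairProb_nonneg _ _
      simp only [Finset.mem_filter, Finset.mem_Ioc] at hk ⊢
      omega
    · rw [nsmul_eq_mul, Int.card_Ioc, sub_zero, Int.toNat_natCast, hK]
      push_cast
      ring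

variable {u : ℕ → ℝ} {s q : ℕ → ℕ} {β : ℕ → ℝ} {c : ℝ}

/-- If, given an exceedance at time `j`, the numerator deviates from `1` by at most a weighted
number of further exceedances, and the weights of times close to `j` are negligible, then the
numerator behaves like the indicator of an exceedance. -/
lemma RareEventArray.tendsto_key (hR : RareEventArray P u s q β c)
    {t : ℕ → ℤ → (ℤ → ℝ) → ℝ} (hm : ∀ n i, Measurable (t n i))
    (ht : ∀ᶠ n in atTop, NumeratorStatistic (u n) (s n) (t n)) {w : ℕ → ℤ → ℤ → ℝ}
    (hw01 : ∀ᶠ n in atTop, ∀ j k, 0 ≤ w n j k ∧ w n j k ≤ 1)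
    (hw : ∀ᶠ n in atTop, ∀ (L : ℕ) (x : ℤ → ℝ) (j : ℤ), (s n : ℤ) ≤ j → j + s n ≤ L → u n < x j →
      |∑ i ∈ Finset.Ioc (0 : ℤ) L, t n i x - 1|
        ≤ ∑ k ∈ Finset.Ioc (0 : ℤ) (L + s n : ℕ), w n j k * exc (u n) k x)
    (hnear : ∀ m : ℕ, Tendsto (fun n => (∑ j ∈ Finset.Ioc (0 : ℤ) (s n * (q n - 1) : ℕ),
      ∑ k ∈ Finset.Ioc (0 : ℤ) (s n * (q n - 1) : ℕ),
        (if (j - k).natAbs ≤ m then w n j k else 0)) / ((s n * q n : ℕ) : ℝ)) atTop (𝓝 0)) :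
    Tendsto (fun n => (∫ x, cnt (u n) 0 (s n * (q n - 1) : ℕ) x
        * |∑ i ∈ Finset.Ioc (0 : ℤ) (s n * (q n - 2) : ℕ), t n i x - 1| ∂P)
      / (((s n * q n : ℕ) : ℝ) * excProb P (u n))) atTop (𝓝 0) := by
  have nonneg (n : ℕ) : 0 ≤ (∫ x, cnt (u n) 0 (s n * (q n - 1) : ℕ) x
        * |∑ i ∈ Finset.Ioc (0 : ℤ) (s n * (q n - 2) : ℕ), t n i x - 1| ∂P)
      / (((s n * q n : ℕ) : ℝ) * excProb P (u n)) :=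
    div_nonneg (integral_nonneg fun x => mul_nonneg (cnt_nonneg _ _ _ _) (abs_nonneg _))
      (mul_nonneg (by positivity) (excProb_nonneg _))
  refine squeeze_zero_norm' (a := fun n => (∫ x, cnt (u n) 0 (s n * (q n - 1) : ℕ) x
        * |∑ i ∈ Finset.Ioc (0 : ℤ) (s n * (q n - 2) : ℕ), t n i x - 1| ∂P)
      / (((s n * q n : ℕ) : ℝ) * excProb P (u n)))
    (Eventually.of_forall fun n => by rw [Real.norm_eq_abs, abs_of_nonneg (nonneg n)]) ?_
  rw [Metric.tendsto_nhds]
  intro ε hε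
  -- The cutoff `m` is fixed before `n` grows. Interior near pairs and boundary pairs each
  -- contribute `ε / 4`; distant pairs occur on both sides of `j` and contribute `2 (ε / 4)`.
  obtain ⟨m, hm'⟩ := hR.tail (ε / 4) (by positivity)
  have invq : Tendsto (fun n => (2 * m + 1) * 3 * ((q n : ℝ))⁻¹) atTop (𝓝 0) := by
    have h := (tendsto_inv_atTop_zero.comp
      (tendsto_natCast_atTop_atTop (R := ℝ) |>.comp hR.ratio)).const_mul ((2 * m + 1 : ℝ) * 3)
    rw [mul_zero] at h
    exact h
  filter_upwards [hR.eventually_pos, ht, hw01, hw, hm',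
    (hnear m).eventually_lt_const (show 0 < ε / 4 by positivity),
    invq.eventually_lt_const (show 0 < ε / 4 by positivity)]
    with n ⟨h1, h2, h3, h4, h5⟩ h6 h7 h8 h9 h10 h11
  rw [Real.dist_eq, sub_zero, abs_of_nonneg (nonneg n)]
  obtain ⟨l, hl⟩ : ∃ l, q n = l + 2 := ⟨q n - 2, by omega⟩
  set L := s n * (q n - 2) with hL
  have hLs : s n * (q n - 1) = L + s n := by
    rw [hL, hl, show l + 2 - 2 = l by omega, show l + 2 - 1 = l + 1 by omega]
    ring
  have hLr : L + 2 * s n = s n * q n := by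
    rw [hL, hl, show l + 2 - 2 = l by omega]
    ring
  rw [hLs] at h10 ⊢
  set v := excProb P (u n) with hv
  set r := s n * q n with hr
  have hs : (0 : ℝ) < s n := by exact_mod_cast h1
  have hq : (0 : ℝ) < q n := by exact_mod_cast (by omega : 0 < q n)
  have hr0 : (0 : ℝ) < (r : ℝ) := by rw [hr]; push_cast; positivity
  have T0 (x : ℤ → ℝ) : 0 ≤ ∑ i ∈ Finset.Ioc (0 : ℤ) L, t n i x :=
    Finset.sum_nonneg fun i _ => h6.nonneg i x
  have T1 (x : ℤ → ℝ) : ∑ i ∈ Finset.Ioc (0 : ℤ) L, t n i x ≤ cnt (u n) 0 (L + s n : ℕ) x := by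
    have := h6.sum_le 0 L x (by positivity)
    push_cast
    exact this
  have int : Integrable (fun x => cnt (u n) 0 (L + s n : ℕ) x
      * |∑ i ∈ Finset.Ioc (0 : ℤ) L, t n i x - 1|) P := by
    set D : ℝ := ((((L + s n : ℕ) : ℤ) - 0).toNat : ℝ)
    have D0 : 0 ≤ D := by positivity
    refine integrable_of_measurable_of_bound (by fun_prop) (D * (D + 1)) fun x => ?_
    have B := cnt_le (u n) 0 (L + s n : ℕ) x
    rw [abs_mul, abs_abs, abs_of_nonneg (cnt_nonneg _ _ _ _)]
    refine mul_le_mul B ?_ (abs_nonneg _) D0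
    rw [abs_le]
    constructor <;> linarith [T0 x, T1 x]
  have main := (integral_cnt_mul_le_of_weights hR.inv int
    (w := fun j k => if (s n : ℤ) ≤ j ∧ j + s n ≤ L then w n j k else 1) fun x j hj hx => by
      by_cases hint : (s n : ℤ) ≤ j ∧ j + s n ≤ L
      · simp only [hint, and_self, if_true]
        exact h8 L x j hint.1 hint.2 hx
      -- Near the boundary the crude bound `|T - 1| ≤ N` suffices: `0 ≤ T ≤ N`, and `1 ≤ N` because
      -- `j` itself is an exceedance.
      · simp only [hint, if_false, one_mul]
        change _ ≤ cnt (u n) 0 (L + s n : ℕ) x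
        have := exc_le_cnt (u n) hj x
        rw [exc_of_lt hx] at this
        rw [abs_le]
        constructor <;> linarith [T0 x, T1 x]).trans
    (sum_weights_mul_pairProb_le (P := P) (u n) (s n) L m (fun j k => (h7 j k).1) fun j k => (h7 j k).2)
  rw [div_lt_iff₀ (by positivity)]
  refine main.trans_lt ?_
  rw [div_lt_iff₀ hr0] at h10
  have far : ∑ k ∈ Finset.Ioc m (L + s n), pairProb P (u n) k ≤ ε / 4 * v :=
    (Finset.sum_le_sum_of_subset_of_nonneg (Finset.Ioc_subset_Ioc le_rfl (by omega))
      fun _ _ _ => pairProb_nonneg _ _).trans h9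
  have hLr' : (L : ℝ) + s n ≤ r := by exact_mod_cast (by omega : L + s n ≤ r)
  have t1 := mul_lt_mul_of_pos_left h10 h3
  have t2 : v * ((2 * m + 1) * (3 * s n)) < v * (ε / 4 * r) := by
    refine mul_lt_mul_of_pos_left ?_ h3
    have := mul_lt_mul_of_pos_right h11 hr0
    refine lt_of_eq_of_lt ?_ this
    rw [hr]
    push_cast
    field_simp
  have t3 : ((L : ℝ) + s n) * (2 * ∑ k ∈ Finset.Ioc m (L + s n), pairProb P (u n) k)
      ≤ r * (2 * (ε / 4 * v)) :=
    mul_le_mul hLr' (mul_le_mul_of_nonneg_left far zero_le_two)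
      (mul_nonneg zero_le_two (Finset.sum_nonneg fun _ _ => pairProb_nonneg _ _)) hr0.le
  calc _ < v * (ε / 4 * r) + v * (ε / 4 * r) + r * (2 * (ε / 4 * v)) := by linarith
    _ = ε * (r * v) := by ring

end Clusters

end ExtremalIndex

namespace ExtremalIndex

/-! ### Disjoint and sliding blocks as weighted block indicators -/

/-- The indicator of an exceedance within the time interval `[a, b]`. -/
noncomputable def hit (u : ℝ) (a b : ℤ) (x : ℤ → ℝ) : ℝ :=
  Set.indicator {y : ℤ → ℝ | ∃ t ∈ Finset.Icc a b, u < y t} (fun _ => (1 : ℝ)) x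

lemma measurableSet_hit (u : ℝ) (a b : ℤ) :
    MeasurableSet {y : ℤ → ℝ | ∃ t ∈ Finset.Icc a b, u < y t} := by
  have : {y : ℤ → ℝ | ∃ t ∈ Finset.Icc a b, u < y t}
      = ⋃ t ∈ Finset.Icc a b, {y : ℤ → ℝ | u < y t} := by
    ext y
    simp
  rw [this]
  exact Finset.measurableSet_biUnion _ fun t _ => measurableSet_exc u t

@[fun_prop]
lemma measurable_hit (u : ℝ) (a b : ℤ) : Measurable (hit u a b) :=
  measurable_const.indicator (measurableSet_hit u a b)

lemma hit_of_lt {u : ℝ} {a b t : ℤ} {x : ℤ → ℝ} (ht : t ∈ Finset.Icc a b) (h : u < x t) :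
    hit u a b x = 1 :=
  Set.indicator_of_mem (s := {y : ℤ → ℝ | ∃ t ∈ Finset.Icc a b, u < y t}) ⟨t, ht, h⟩ _

lemma hit_of_not_exists {u : ℝ} {a b : ℤ} {x : ℤ → ℝ} (h : ¬∃ t ∈ Finset.Icc a b, u < x t) :
    hit u a b x = 0 :=
  Set.indicator_of_notMem (s := {y : ℤ → ℝ | ∃ t ∈ Finset.Icc a b, u < y t}) h _

lemma hit_nonneg (u : ℝ) (a b : ℤ) (x : ℤ → ℝ) : 0 ≤ hit u a b x :=
  Set.indicator_nonneg (fun _ _ => zero_le_one) x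

lemma hit_le_one (u : ℝ) (a b : ℤ) (x : ℤ → ℝ) : hit u a b x ≤ 1 :=
  Set.indicator_le' (fun _ _ => le_rfl) (fun _ _ => zero_le_one) x

lemma dependsOn_hit (u : ℝ) (a b : ℤ) : DependsOn (hit u a b) (Set.Icc a b) := by
  intro x y hxy
  by_cases h : ∃ t ∈ Finset.Icc a b, u < x t
  · obtain ⟨t, ht, h⟩ := h
    rw [hit_of_lt ht h, hit_of_lt ht (by rwa [← hxy t (Finset.mem_Icc.1 ht)])]
  · rw [hit_of_not_exists h, hit_of_not_exists]
    rintro ⟨t, ht, h'⟩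
    exact h ⟨t, ht, by rwa [hxy t (Finset.mem_Icc.1 ht)]⟩

lemma hit_shift (u : ℝ) (a b h : ℤ) (x : ℤ → ℝ) :
    hit u a b (shift h x) = hit u (a + h) (b + h) x := by
  by_cases h' : ∃ t ∈ Finset.Icc a b, u < x (t + h)
  · obtain ⟨t, ht, h'⟩ := h'
    rw [hit_of_lt ht h', hit_of_lt (t := t + h) _ h']
    rw [Finset.mem_Icc] at ht ⊢
    omega
  · rw [hit_of_not_exists (x := shift h x) h', hit_of_not_exists]
    rintro ⟨t, ht, h2⟩
    rw [Finset.mem_Icc] at ht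
    exact h' ⟨t - h, Finset.mem_Icc.2 (by omega), by rwa [sub_add_cancel]⟩

/-- A union bound, indexed so that the sums can be exchanged: the block starting at `i` contains `k`
exactly if `i ∈ (k - s, k]`. -/
lemma hit_le_sum (u : ℝ) {a b i : ℤ} (s : ℕ) (hi : i ∈ Finset.Ioc a b) (x : ℤ → ℝ) :
    hit u i (i + s - 1) x
      ≤ ∑ k ∈ Finset.Ioc a (b + s), (if i ∈ Finset.Ioc (k - s) k then exc u k x else 0) := by
  have nn (k : ℤ) : 0 ≤ (if i ∈ Finset.Ioc (k - s) k then exc u k x else 0) := by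
    split_ifs
    · exact exc_nonneg u k x
    · exact le_rfl
  by_cases h : ∃ t ∈ Finset.Icc i (i + s - 1), u < x t
  · obtain ⟨t, ht, h⟩ := h
    rw [Finset.mem_Icc] at ht
    rw [Finset.mem_Ioc] at hi
    refine (hit_le_one _ _ _ _).trans ?_
    refine le_trans (le_of_eq ?_) (Finset.single_le_sum (fun k _ => nn k)
      (Finset.mem_Ioc.2 (show a < t ∧ t ≤ b + s by omega)))
    rw [if_pos (Finset.mem_Ioc.2 (by omega)), exc_of_lt h]
  · rw [hit_of_not_exists h]
    exact Finset.sum_nonneg fun k _ => nn k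

/-- Nonnegative weights of period `s` with sum `1` over each period. -/
structure BlockWeights (s : ℕ) (α : ℤ → ℝ) : Prop where
  nonneg : ∀ i, 0 ≤ α i
  periodic : ∀ i j : ℤ, α (i + j * s) = α i
  sum_eq : ∀ t : ℤ, ∑ i ∈ Finset.Ioc (t - s) t, α i = 1

namespace BlockWeights

variable {s : ℕ} {α : ℤ → ℝ}

lemma sum_ite_le (hα : BlockWeights s α) (S : Finset ℤ) (k : ℤ) :
    ∑ i ∈ S, (if i ∈ Finset.Ioc (k - s) k then α i else 0) ≤ 1 := by
  rw [← Finset.sum_filter, ← hα.sum_eq k]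
  refine Finset.sum_le_sum_of_subset_of_nonneg (fun i hi => ?_) fun i _ _ => hα.nonneg i
  exact (Finset.mem_filter.1 hi).2

lemma numeratorStatistic (hα : BlockWeights s α) (u : ℝ) :
    NumeratorStatistic u s (fun i x => α i * hit u i (i + s - 1) x) where
  nonneg i x := mul_nonneg (hα.nonneg i) (hit_nonneg _ _ _ _)
  dependsOn i x y hxy := by simp only [dependsOn_hit u i (i + s - 1) hxy]
  comp_shift i j x := by
    simp only [hit_shift, hα.periodic]
    ring_nf
  sum_le a b x _ := by
    calc ∑ i ∈ Finset.Ioc a b, α i * hit u i (i + s - 1) x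
        ≤ ∑ i ∈ Finset.Ioc a b, α i * ∑ k ∈ Finset.Ioc a (b + s),
            (if i ∈ Finset.Ioc (k - s) k then exc u k x else 0) :=
          Finset.sum_le_sum fun i hi =>
            mul_le_mul_of_nonneg_left (hit_le_sum u s hi x) (hα.nonneg i)
      _ = ∑ k ∈ Finset.Ioc a (b + s), exc u k x *
            ∑ i ∈ Finset.Ioc a b, (if i ∈ Finset.Ioc (k - s) k then α i else 0) := by
          simp only [Finset.mul_sum]
          rw [Finset.sum_comm]
          refine Finset.sum_congr rfl fun k _ => Finset.sum_congr rfl fun i _ => ?_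
          split_ifs
          · ring
          · ring
      _ ≤ cnt u a (b + s) x := Finset.sum_le_sum fun k _ =>
          mul_le_of_le_one_right (exc_nonneg _ _ _) (hα.sum_ite_le _ k)

/-- The total weight of the blocks that contain the time `k` but not the time `j`. -/
noncomputable def pairWeight (s : ℕ) (α : ℤ → ℝ) (j k : ℤ) : ℝ :=
  ∑ i ∈ Finset.Ioc (k - s) k, (if i ∈ Finset.Ioc (j - s) j then 0 else α i)

lemma pairWeight_nonneg (hα : BlockWeights s α) (j k : ℤ) : 0 ≤ pairWeight s α j k :=
  Finset.sum_nonneg fun i _ => by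
    split_ifs
    · exact le_rfl
    · exact hα.nonneg i

lemma pairWeight_le_one (hα : BlockWeights s α) (j k : ℤ) : pairWeight s α j k ≤ 1 := by
  rw [← hα.sum_eq k]
  refine Finset.sum_le_sum fun i _ => ?_
  split_ifs
  · exact hα.nonneg i
  · exact le_rfl

/-- All blocks containing `j` are hit and their weights add up to `1`. The excess is the weight of
hit blocks that miss `j`, each of which contains some other exceedance `k`. -/
lemma abs_sum_sub_one_le (hα : BlockWeights s α) {u : ℝ} {L : ℕ} {x : ℤ → ℝ} {j : ℤ}
    (hsj : (s : ℤ) ≤ j) (hjL : j ≤ L) (hx : u < x j) :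
    |∑ i ∈ Finset.Ioc (0 : ℤ) L, α i * hit u i (i + s - 1) x - 1|
      ≤ ∑ k ∈ Finset.Ioc (0 : ℤ) (L + s : ℕ), pairWeight s α j k * exc u k x := by
  have one : ∑ i ∈ Finset.Ioc (0 : ℤ) L, (if i ∈ Finset.Ioc (j - s) j then α i else 0) = 1 := by
    rw [← hα.sum_eq j, ← Finset.sum_filter]
    refine Finset.sum_congr ?_ fun _ _ => rfl
    ext i
    simp only [Finset.mem_filter, Finset.mem_Ioc]
    omega
  have e : ∑ i ∈ Finset.Ioc (0 : ℤ) L, α i * hit u i (i + s - 1) x - 1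
      = ∑ i ∈ Finset.Ioc (0 : ℤ) L,
        (if i ∈ Finset.Ioc (j - s) j then 0 else α i) * hit u i (i + s - 1) x := by
    rw [← one, ← Finset.sum_sub_distrib]
    refine Finset.sum_congr rfl fun i _ => ?_
    by_cases h : i ∈ Finset.Ioc (j - s) j
    · simp only [h, if_true]
      rw [Finset.mem_Ioc] at h
      rw [hit_of_lt (t := j) (Finset.mem_Icc.2 (by omega)) hx]
      ring
    · simp only [h, if_false]
      ring
  have nn (i : ℤ) : 0 ≤ (if i ∈ Finset.Ioc (j - s) j then 0 else α i) := by
    split_ifs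
    · exact le_rfl
    · exact hα.nonneg i
  rw [e, abs_of_nonneg (Finset.sum_nonneg fun i _ => mul_nonneg (nn i) (hit_nonneg _ _ _ _))]
  calc _ ≤ ∑ i ∈ Finset.Ioc (0 : ℤ) L, (if i ∈ Finset.Ioc (j - s) j then 0 else α i)
        * ∑ k ∈ Finset.Ioc (0 : ℤ) (L + s : ℕ),
          (if i ∈ Finset.Ioc (k - s) k then exc u k x else 0) :=
        Finset.sum_le_sum fun i hi => mul_le_mul_of_nonneg_left
          (by push_cast; exact hit_le_sum u s hi x) (nn i)
    _ = ∑ k ∈ Finset.Ioc (0 : ℤ) (L + s : ℕ), (∑ i ∈ Finset.Ioc (0 : ℤ) L,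
          (if i ∈ Finset.Ioc (k - s) k then
            (if i ∈ Finset.Ioc (j - s) j then 0 else α i) else 0)) * exc u k x := by
        simp only [Finset.mul_sum, Finset.sum_mul]
        rw [Finset.sum_comm]
        refine Finset.sum_congr rfl fun k _ => Finset.sum_congr rfl fun i _ => ?_
        by_cases h : i ∈ Finset.Ioc (k - s) k <;> simp [h]
    _ ≤ _ := Finset.sum_le_sum fun k _ => mul_le_mul_of_nonneg_right (by
        rw [← Finset.sum_filter]
        exact Finset.sum_le_sum_of_subset_of_nonneg (fun i hi => (Finset.mem_filter.1 hi).2)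
          fun i _ _ => nn i) (exc_nonneg _ _ _)

/-- Blocks containing `k` but not `j` start in `(j, k]` if `j ≤ k`, and in `(k - s, j - s]`
otherwise. Periodicity moves the second range to `(k, j]`, so both are covered by the same window
around `j`. -/
lemma pairWeight_le (hα : BlockWeights s α) {j k : ℤ} {m : ℕ} (h : (j - k).natAbs ≤ m) :
    pairWeight s α j k ≤ ∑ i ∈ Finset.Ioc (-(m : ℤ)) m, α (i + j) := by
  rw [← sum_Ioc_add_right (fun i => α i)]
  have flip : ∑ i ∈ Finset.Ioc (k - s) k, (if i ∈ Finset.Ioc (j - s) j then 0 else α i)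
      = ∑ i ∈ (Finset.Ioc (k - s) k).filter (fun i => i ∉ Finset.Ioc (j - s) j), α i := by
    rw [Finset.sum_filter]
    exact Finset.sum_congr rfl fun i _ => by split_ifs <;> tauto
  rw [pairWeight, flip]
  rcases le_total j k with hjk | hjk
  · refine Finset.sum_le_sum_of_subset_of_nonneg (fun i hi => ?_) fun i _ _ => hα.nonneg i
    simp only [Finset.mem_filter, Finset.mem_Ioc] at hi ⊢
    omega
  · have e : ∑ i ∈ Finset.Ioc k j, α i = ∑ i ∈ Finset.Ioc (k - s) (j - s), α i := by
      rw [sub_eq_add_neg, sub_eq_add_neg, sum_Ioc_add_right]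
      refine Finset.sum_congr rfl fun i _ => ?_
      rw [← hα.periodic i (-1)]
      ring_nf
    calc _ ≤ ∑ i ∈ Finset.Ioc (k - s) (j - s), α i := by
          refine Finset.sum_le_sum_of_subset_of_nonneg (fun i hi => ?_) fun i _ _ => hα.nonneg i
          simp only [Finset.mem_filter, Finset.mem_Ioc] at hi ⊢
          omega
      _ = ∑ i ∈ Finset.Ioc k j, α i := e.symm
      _ ≤ _ := by
          refine Finset.sum_le_sum_of_subset_of_nonneg (fun i hi => ?_) fun i _ _ => hα.nonneg i
          simp only [Finset.mem_Ioc] at hi ⊢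
          omega

lemma sum_mul_eq (hα : BlockWeights s α) (k : ℕ) (i : ℤ) :
    ∑ j ∈ Finset.Ioc (0 : ℤ) (k * s), α (i + j) = k := by
  rw [sum_Ioc_mul]
  have e (a : ℕ) : ∑ j ∈ Finset.Ioc (0 : ℤ) s, α (i + (j + a * s)) = 1 := by
    rw [← hα.sum_eq (s + i)]
    have := sum_Ioc_add_right α 0 s i
    rw [show (s : ℤ) + i - s = 0 + i by ring, this]
    refine Finset.sum_congr rfl fun j _ => ?_
    rw [← hα.periodic (j + i) a]
    ring_nf
  simp [e]

/-- For disjoint blocks a single weight can be `1`, so smallness holds only on average: each of the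
`2 m` shifted weights sums to `k` over `k` periods. The bound contains no factor `s`, hence is
negligible against the number `s k` of times. -/
lemma sum_pairWeight_le (hα : BlockWeights s α) (m k : ℕ) :
    ∑ j ∈ Finset.Ioc (0 : ℤ) (s * k : ℕ), ∑ l ∈ Finset.Ioc (0 : ℤ) (s * k : ℕ),
      (if (j - l).natAbs ≤ m then pairWeight s α j l else 0) ≤ (2 * m + 1) * (2 * m * k) := by
  have inner (j : ℤ) (hj : j ∈ Finset.Ioc (0 : ℤ) (s * k : ℕ)) :
      ∑ l ∈ Finset.Ioc (0 : ℤ) (s * k : ℕ),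
        (if (j - l).natAbs ≤ m then pairWeight s α j l else 0)
      ≤ (2 * m + 1) * ∑ i ∈ Finset.Ioc (-(m : ℤ)) m, α (i + j) := by
    refine le_trans ?_ (mul_le_mul_of_nonneg_right (sum_near_le m (s * k) hj)
      (Finset.sum_nonneg fun i _ => hα.nonneg _))
    rw [Finset.sum_mul]
    refine Finset.sum_le_sum fun l _ => ?_
    split_ifs with h
    · rw [one_mul]
      exact hα.pairWeight_le h
    · rw [zero_mul]
  refine (Finset.sum_le_sum inner).trans ?_
  rw [← Finset.mul_sum, Finset.sum_comm]
  refine mul_le_mul_of_nonneg_left (le_of_eq ?_) (by positivity)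
  have e : ((s * k : ℕ) : ℤ) = (k : ℤ) * s := by push_cast; ring
  simp only [e, hα.sum_mul_eq, Finset.sum_const, Int.card_Ioc, nsmul_eq_mul]
  congr 1
  have : ((m : ℤ) - -m).toNat = 2 * m := by omega
  rw [this]
  push_cast
  ring

end BlockWeights

lemma blockWeights_sliding {s : ℕ} (hs : 1 ≤ s) : BlockWeights s fun _ => 1 / (s : ℝ) where
  nonneg _ := by positivity
  periodic _ _ := rfl
  sum_eq t := by
    have : (s : ℝ) ≠ 0 := by positivity
    simp [this]

lemma blockWeights_disjoint {s : ℕ} (hs : 1 ≤ s) :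
    BlockWeights s fun i => if 0 < s ∧ (s : ℤ) ∣ i - 1 then 1 else 0 where
  nonneg _ := by positivity
  periodic i j := by
    have : (s : ℤ) ∣ i + j * s - 1 ↔ (s : ℤ) ∣ i - 1 := by
      rw [show i + j * s - 1 = (i - 1) + j * s by ring]
      exact Int.dvd_add_left (Dvd.intro_left j rfl)
    simp only [this]
  sum_eq t := by
    have hs' : (0 : ℤ) < s := by exact_mod_cast hs
    have h0 := Int.emod_nonneg (t - 1) hs'.ne'
    have h1 := Int.emod_lt_of_pos (t - 1) hs'
    have h2 := Int.emod_add_mul_ediv (t - 1) s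
    -- The only block start in `(t - s, t]`: the largest integer at most `t` that is congruent to
    -- `1` modulo `s`.
    rw [Finset.sum_eq_single ((s : ℤ) * ((t - 1) / s) + 1)]
    · simp [Nat.pos_of_ne_zero (by omega : s ≠ 0)]
    · intro i hi hne
      rw [Finset.mem_Ioc] at hi
      rw [if_neg]
      rintro ⟨-, a, ha⟩
      refine hne ?_
      have : a = (t - 1) / s := by
        have l1 : (s : ℤ) * a < s * ((t - 1) / s + 1) := by rw [mul_add]; omega
        have l2 : (s : ℤ) * ((t - 1) / s) < s * (a + 1) := by rw [mul_add]; omega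
        have := lt_of_mul_lt_mul_left l1 hs'.le
        have := lt_of_mul_lt_mul_left l2 hs'.le
        omega
      rw [← this, ← ha]
      ring
    · intro h
      refine absurd (Finset.mem_Ioc.2 ?_) h
      omega

/-! ### Ends of runs -/

/-- The indicator of an exceedance at time `i` that is followed by `s - 1` times without
exceedances. -/
noncomputable def runEnd (u : ℝ) (s : ℕ) (i : ℤ) (x : ℤ → ℝ) : ℝ :=
  exc u i x * (1 - hit u (i + 1) (i + s - 1) x)

@[fun_prop]
lemma measurable_runEnd (u : ℝ) (s : ℕ) (i : ℤ) : Measurable (runEnd u s i) := by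
  unfold runEnd
  fun_prop

lemma runEnd_nonneg (u : ℝ) (s : ℕ) (i : ℤ) (x : ℤ → ℝ) : 0 ≤ runEnd u s i x :=
  mul_nonneg (exc_nonneg _ _ _) (sub_nonneg.2 (hit_le_one _ _ _ _))

lemma runEnd_le_exc (u : ℝ) (s : ℕ) (i : ℤ) (x : ℤ → ℝ) : runEnd u s i x ≤ exc u i x :=
  mul_le_of_le_one_right (exc_nonneg _ _ _) (by linarith [hit_nonneg u (i + 1) (i + s - 1) x])

lemma runEnd_shift (u : ℝ) (s : ℕ) (i h : ℤ) (x : ℤ → ℝ) :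
    runEnd u s i (shift h x) = runEnd u s (i + h) x := by
  simp only [runEnd, exc_shift, hit_shift]
  ring_nf

lemma numeratorStatistic_runEnd (u : ℝ) {s : ℕ} (hs : 1 ≤ s) :
    NumeratorStatistic u s (runEnd u s) where
  nonneg i x := runEnd_nonneg u s i x
  dependsOn i x y hxy := by
    simp only [runEnd]
    rw [exc_congr (hxy i ⟨le_rfl, by omega⟩), (dependsOn_hit u (i + 1) (i + s - 1)).mono
      (Set.Icc_subset_Icc (by omega) le_rfl) hxy]
  comp_shift i j x := runEnd_shift u s i _ x
  sum_le a b x _ := (Finset.sum_le_sum fun i _ => runEnd_le_exc u s i x).trans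
    (cnt_mono u le_rfl (by omega) x)

lemma runEnd_eq_zero {u : ℝ} {s : ℕ} {i k : ℤ} {x : ℤ → ℝ} (hik : i < k) (hks : k ≤ i + s - 1)
    (hk : u < x k) : runEnd u s i x = 0 := by
  rw [runEnd, hit_of_lt (Finset.mem_Icc.2 ⟨by omega, hks⟩) hk, sub_self, mul_zero]

/-- Two distinct ends of runs are at least `s` apart, since the earlier one excludes exceedances at
the next `s - 1` times. -/
lemma sum_runEnd_le_one {u : ℝ} {s : ℕ} {S : Finset ℤ}
    (hS : ∀ i ∈ S, ∀ k ∈ S, k ≤ i + s - 1) (x : ℤ → ℝ) : ∑ i ∈ S, runEnd u s i x ≤ 1 := by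
  by_cases h : ∃ i ∈ S, runEnd u s i x ≠ 0
  · obtain ⟨i, hi, hne⟩ := h
    have exceeds {l : ℤ} (hl : runEnd u s l x ≠ 0) : u < x l := by
      by_contra hx
      exact hl (by rw [runEnd, exc_of_not_lt hx, zero_mul])
    rw [Finset.sum_eq_single_of_mem i hi]
    · exact (runEnd_le_exc _ _ _ _).trans (exc_le_one _ _ _)
    · intro k hk hki
      by_contra hk0
      rcases lt_or_gt_of_ne hki with hlt | hlt
      · exact hk0 (runEnd_eq_zero hlt (hS k hk i hi) (exceeds hne))
      · exact hne (runEnd_eq_zero hlt (hS i hi k hk) (exceeds hk0))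
  · push Not at h
    rw [Finset.sum_eq_zero h]
    exact zero_le_one

/-- Times at distance less than about `s / 2` from `j` are less than `s` apart, so they contain at
most one end of a run; further ends are distant exceedances. If there is no distant exceedance, then
the last exceedance in the window is near `j` and ends a run, so the sum is at least `1`. -/
lemma abs_sum_runEnd_sub_one_le {u : ℝ} {s L : ℕ} {x : ℤ → ℝ} {j : ℤ} (hsj : (s : ℤ) ≤ j)
    (hjL : j + s ≤ L) (hs : 1 ≤ s) (hx : u < x j) :
    |∑ i ∈ Finset.Ioc (0 : ℤ) L, runEnd u s i x - 1|
      ≤ ∑ k ∈ Finset.Ioc (0 : ℤ) (L + s : ℕ),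
        (if s ≤ 2 * (j - k).natAbs + 1 then 1 else 0) * exc u k x := by
  set F := ∑ k ∈ Finset.Ioc (0 : ℤ) (L + s : ℕ),
        (if s ≤ 2 * (j - k).natAbs + 1 then 1 else 0) * exc u k x with hF
  have nn (k : ℤ) : 0 ≤ (if s ≤ 2 * (j - k).natAbs + 1 then 1 else 0) * exc u k x :=
    mul_nonneg (by split_ifs <;> norm_num) (exc_nonneg _ _ _)
  have upper : ∑ i ∈ Finset.Ioc (0 : ℤ) L, runEnd u s i x ≤ 1 + F := by
    rw [← Finset.sum_filter_add_sum_filter_not (Finset.Ioc (0 : ℤ) L)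
      (fun i => 2 * (j - i).natAbs + 1 < s)]
    refine add_le_add (sum_runEnd_le_one (fun i hi k hk => ?_) x) ?_
    · simp only [Finset.mem_filter, Finset.mem_Ioc] at hi hk
      omega
    · rw [Finset.sum_filter]
      refine (Finset.sum_le_sum fun i _ => ?_).trans (Finset.sum_le_sum_of_subset_of_nonneg
        (Finset.Ioc_subset_Ioc le_rfl (by push_cast; omega)) fun k _ _ => nn k)
      by_cases h : s ≤ 2 * (j - i).natAbs + 1
      · simp only [h, not_lt.2 h, not_false_eq_true, if_true, one_mul]
        exact runEnd_le_exc _ _ _ _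
      · simp [h, not_le.1 h]
  have lower : 1 ≤ ∑ i ∈ Finset.Ioc (0 : ℤ) L, runEnd u s i x + F := by
    by_cases hfar : ∃ k ∈ Finset.Ioc (0 : ℤ) (L + s : ℕ), s ≤ 2 * (j - k).natAbs + 1 ∧ u < x k
    · obtain ⟨k, hk, hks, hxk⟩ := hfar
      have h1 : 1 ≤ F := by
        refine le_trans (le_of_eq ?_) (Finset.single_le_sum (fun k _ => nn k) hk)
        rw [if_pos hks, exc_of_lt hxk, one_mul]
      have h2 : 0 ≤ ∑ i ∈ Finset.Ioc (0 : ℤ) L, runEnd u s i x :=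
        Finset.sum_nonneg fun i _ => runEnd_nonneg _ _ _ _
      linarith
    · push Not at hfar
      -- The maximum is taken up to `L + s`, so that the `s - 1` times after an end of a run at most
      -- `L` are covered.
      set E := (Finset.Ioc (0 : ℤ) (L + s : ℕ)).filter (fun k => u < x k) with hE
      have hjE : j ∈ E := by
        rw [hE, Finset.mem_filter, Finset.mem_Ioc]
        exact ⟨by push_cast; omega, hx⟩
      have hmax := E.max'_mem ⟨j, hjE⟩
      set i := E.max' ⟨j, hjE⟩ with hi
      have hji : j ≤ i := E.le_max' j hjE
      rw [hE, Finset.mem_filter] at hmax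
      have hnear : 2 * (j - i).natAbs + 1 < s := by
        by_contra h
        exact absurd hmax.2 (not_lt.2 (hfar i hmax.1 (not_lt.1 h)))
      have hnone : ¬∃ t ∈ Finset.Icc (i + 1) (i + s - 1), u < x t := by
        rintro ⟨t, ht, hxt⟩
        rw [Finset.mem_Icc] at ht
        have : t ∈ E := by
          rw [hE, Finset.mem_filter, Finset.mem_Ioc]
          exact ⟨by push_cast; omega, hxt⟩
        have := E.le_max' t this
        omega
      have hrun : runEnd u s i x = 1 := by
        rw [runEnd, exc_of_lt hmax.2, hit_of_not_exists hnone]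
        norm_num
      have h1 := Finset.single_le_sum (f := fun i => runEnd u s i x)
        (fun i _ => runEnd_nonneg u s i x)
        (Finset.mem_Ioc.2 (show 0 < i ∧ i ≤ (L : ℤ) by omega))
      have h2 : 0 ≤ F := Finset.sum_nonneg fun k _ => nn k
      linarith
  rw [abs_le]
  constructor <;> linarith

/-! ### Verification of the cluster property for blocks and runs -/

section Keys

variable {P : Measure (ℤ → ℝ)} [IsProbabilityMeasure P]
  {u : ℕ → ℝ} {s q : ℕ → ℕ} {β : ℕ → ℝ} {c : ℝ}

lemma RareEventArray.tendsto_key_blocks (hR : RareEventArray P u s q β c) {α : ℕ → ℤ → ℝ}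
    (hα : ∀ᶠ n in atTop, BlockWeights (s n) (α n)) :
    Tendsto (fun n => (∫ x, cnt (u n) 0 (s n * (q n - 1) : ℕ) x
        * |∑ i ∈ Finset.Ioc (0 : ℤ) (s n * (q n - 2) : ℕ),
          α n i * hit (u n) i (i + s n - 1) x - 1| ∂P)
      / (((s n * q n : ℕ) : ℝ) * excProb P (u n))) atTop (𝓝 0) := by
  refine hR.tendsto_key (t := fun n i x => α n i * hit (u n) i (i + s n - 1) x)
    (fun n i => by fun_prop) (hα.mono fun n h => h.numeratorStatistic (u n))
    (w := fun n j k => BlockWeights.pairWeight (s n) (α n) j k)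
    (hα.mono fun n h j k => ⟨h.pairWeight_nonneg j k, h.pairWeight_le_one j k⟩)
    (hα.mono fun n h L x j h1 h2 h3 => h.abs_sum_sub_one_le h1 (by omega) h3) fun m => ?_
  have h0 : Tendsto (fun n => (2 * m + 1) * (2 * m) * ((s n : ℝ))⁻¹) atTop (𝓝 0) := by
    have h := (tendsto_inv_atTop_zero.comp
      (tendsto_natCast_atTop_atTop (R := ℝ) |>.comp hR.length)).const_mul
        ((2 * m + 1 : ℝ) * (2 * m))
    rw [mul_zero] at h
    exact h
  refine squeeze_zero' ?_ ?_ h0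
  all_goals filter_upwards [hα, hR.eventually_pos] with n h1 ⟨h2, h3, _⟩
  · refine div_nonneg (Finset.sum_nonneg fun j _ => Finset.sum_nonneg fun k _ => ?_) (by positivity)
    split_ifs
    · exact h1.pairWeight_nonneg j k
    · exact le_rfl
  · have hs : (0 : ℝ) < s n := by exact_mod_cast h2
    have hq : (0 : ℝ) < q n := by exact_mod_cast (by omega : 0 < q n)
    have hq1 : ((q n - 1 : ℕ) : ℝ) ≤ q n := by exact_mod_cast Nat.sub_le _ _
    have e : (2 * m + 1) * (2 * m) * ((s n : ℝ))⁻¹ * ((s n * q n : ℕ) : ℝ)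
        = (2 * m + 1) * (2 * m * q n) := by
      push_cast
      field_simp
    rw [div_le_iff₀ (by push_cast; positivity), e]
    refine (h1.sum_pairWeight_le m (q n - 1)).trans ?_
    gcongr

lemma RareEventArray.tendsto_key_runs (hR : RareEventArray P u s q β c) :
    Tendsto (fun n => (∫ x, cnt (u n) 0 (s n * (q n - 1) : ℕ) x
        * |∑ i ∈ Finset.Ioc (0 : ℤ) (s n * (q n - 2) : ℕ), runEnd (u n) (s n) i x - 1| ∂P)
      / (((s n * q n : ℕ) : ℝ) * excProb P (u n))) atTop (𝓝 0) := by
  refine hR.tendsto_key (t := fun n => runEnd (u n) (s n)) (fun n i => by fun_prop)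
    (hR.eventually_pos.mono fun n h => numeratorStatistic_runEnd (u n) h.1)
    (w := fun n j k => if s n ≤ 2 * (j - k).natAbs + 1 then 1 else 0)
    (Eventually.of_forall fun n j k => by split_ifs <;> norm_num)
    (hR.eventually_pos.mono fun n h L x j h1 h2 h3 =>
      abs_sum_runEnd_sub_one_le h1 h2 h.1 h3) fun m => ?_
  refine tendsto_const_nhds.congr' ?_
  -- Weights vanish within distance about `s / 2`, so once `s > 2 m + 1` the whole sum over near
  -- pairs is zero.
  filter_upwards [hR.length.eventually_gt_atTop (2 * m + 1)] with n hn
  rw [eq_comm, div_eq_zero_iff]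
  left
  refine Finset.sum_eq_zero fun j _ => Finset.sum_eq_zero fun k _ => ?_
  split_ifs
  · omega
  · rfl
  · rfl

end Keys

end ExtremalIndex

namespace ExtremalIndex

set_option linter.unusedSectionVars false

/-! ### Transfer between the time series and its law on the path space -/

section Transfer

variable {Ω : Type*} [MeasurableSpace Ω] {μ : Measure Ω} [IsProbabilityMeasure μ]
  {X : ℤ → Ω → ℝ}

lemma map_path_shift (hX : IsStationarySeries μ X) (h : ℤ) :
    (μ.map (path X)).map (shift h) = μ.map (path X) := by
  rw [Measure.map_map (measurable_shift h) (measurable_path hX.1)]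
  exact hX.2 h

lemma measureReal_eq_integral_hit (hX : IsStationarySeries μ X) (u : ℝ) (a b : ℤ) :
    μ.real {ω | (u : EReal) < blockMax X a b ω} = ∫ x, hit u a b x ∂(μ.map (path X)) := by
  have e : {ω | (u : EReal) < blockMax X a b ω}
      = path X ⁻¹' {y : ℤ → ℝ | ∃ t ∈ Finset.Icc a b, u < y t} := by
    ext ω
    simp [blockMax, Finset.lt_sup_iff, path]
  rw [e, ← map_measureReal_apply (measurable_path hX.1) (measurableSet_hit u a b)]
  exact (integral_indicator_one (measurableSet_hit u a b)).symm

lemma exceedProb_eq (hX : IsStationarySeries μ X) (u : ℕ → ℝ) (n : ℕ) :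
    exceedProb μ X u n = excProb (μ.map (path X)) (u n) := by
  have : IsProbabilityMeasure (μ.map (path X)) :=
    Measure.isProbabilityMeasure_map (measurable_path hX.1).aemeasurable
  rw [← integral_exc (map_path_shift hX) (u n) 1]
  have e : {ω | u n < X 1 ω} = path X ⁻¹' {y : ℤ → ℝ | u n < y 1} := rfl
  rw [exceedProb, e, ← map_measureReal_apply (measurable_path hX.1) (measurableSet_exc _ _)]
  exact (integral_indicator_one (measurableSet_exc _ _)).symm

lemma measureReal_inter_eq_pairProb (hX : IsStationarySeries μ X) (u : ℝ) (k : ℕ) :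
    μ.real ({ω | u < X 0 ω} ∩ {ω | u < X k ω}) = pairProb (μ.map (path X)) u k := by
  have e : {ω | u < X 0 ω} ∩ {ω | u < X k ω}
      = path X ⁻¹' ({y : ℤ → ℝ | u < y 0} ∩ {y : ℤ → ℝ | u < y k}) := rfl
  have m := (measurableSet_exc u 0).inter (measurableSet_exc u k)
  rw [e, ← map_measureReal_apply (measurable_path hX.1) m, pairProb, ← integral_indicator_one m]
  refine integral_congr_ae (ae_of_all _ fun x => ?_)
  rw [Set.inter_indicator_one]
  rfl

lemma pairProb_eq_cond (hX : IsStationarySeries μ X) (u : ℝ) (k : ℕ) :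
    pairProb (μ.map (path X)) u k = excProb (μ.map (path X)) u
      * (μ[|{ω | u < X 0 ω}]).real {ω | u < X k ω} := by
  have : IsProbabilityMeasure (μ.map (path X)) :=
    Measure.isProbabilityMeasure_map (measurable_path hX.1).aemeasurable
  have e0 : μ.real {ω | u < X 0 ω} = excProb (μ.map (path X)) u := by
    have := measureReal_inter_eq_pairProb hX u 0
    rw [pairProb_zero] at this
    simpa using this
  rw [measureReal_def, cond_apply (measurableSet_lt measurable_const (hX.1 0)), ENNReal.toReal_mul,
    ENNReal.toReal_inv, ← measureReal_def, ← measureReal_def, e0, measureReal_inter_eq_pairProb hX]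
  rcases (excProb_nonneg (P := μ.map (path X)) u).eq_or_lt with h | h
  · rw [← h, zero_mul]
    exact le_antisymm (h ▸ pairProb_le u k) (pairProb_nonneg u k)
  · field_simp

lemma Icc_one_eq_Ioc_zero (b : ℤ) : Finset.Icc 1 b = Finset.Ioc 0 b := by
  ext
  rw [Finset.mem_Icc, Finset.mem_Ioc]
  omega

lemma sum_indicator_eq_cnt (u : ℝ) (b : ℤ) (ω : Ω) :
    ∑ i ∈ Finset.Icc (1 : ℤ) b, Set.indicator {ω' | u < X i ω'} (fun _ => (1 : ℝ)) ω
      = cnt u 0 b (path X ω) := by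
  rw [Icc_one_eq_Ioc_zero]
  rfl

lemma tendstoInDistribution_comp_path (hX : ∀ t, Measurable (X t))
    [IsProbabilityMeasure (μ.map (path X))] {Z : ℕ → (ℤ → ℝ) → ℝ} {ν : Measure ℝ}
    [IsProbabilityMeasure ν]
    (h : TendstoInDistribution Z atTop (id : ℝ → ℝ) (fun _ => μ.map (path X)) ν) :
    TendstoInDistribution (fun n ω => Z n (path X ω)) atTop (id : ℝ → ℝ) (fun _ => μ) ν where
  forall_aemeasurable n :=
    (h.forall_aemeasurable n).comp_measurable (measurable_path hX)
  aemeasurable_limit := aemeasurable_id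
  tendsto := by
    refine h.tendsto.congr fun n => Subtype.ext ?_
    exact AEMeasurable.map_map_of_aemeasurable (h.forall_aemeasurable n)
      (measurable_path hX).aemeasurable

end Transfer

/-! ### The conditions (θ1), (θ2) and (θP) yield a rare-event array -/

section Conditions

variable {Ω : Type*} [MeasurableSpace Ω] {μ : Measure Ω} [IsProbabilityMeasure μ]
  {X : ℤ → Ω → ℝ} {u : ℕ → ℝ} {s r : ℕ → ℕ} {c : ℝ}

lemma tendsto_div_of_isLittleO (h : (fun n => (s n : ℝ)) =o[atTop] fun n => (r n : ℝ))
    (hs : Tendsto s atTop atTop) : Tendsto (fun n => r n / s n) atTop atTop := by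
  refine tendsto_atTop.2 fun C => ?_
  filter_upwards [h.bound (show (0 : ℝ) < 1 / (C + 1) by positivity), hs.eventually_ge_atTop 1]
    with n h1 h2
  rw [Nat.le_div_iff_mul_le (by omega)]
  simp only [Real.norm_natCast] at h1
  rw [one_div, inv_mul_eq_div, le_div_iff₀ (by positivity)] at h1
  have h3 : s n * (C + 1) ≤ r n := by exact_mod_cast h1
  nlinarith

/-- The full sum of the `e_n(k)` tends to the series of limits and its first `m` terms converge
termwise, so the sum over `(m, r_n]` tends to the remainder of a convergent series. -/
lemma tail_of_thetaP (hX : IsStationarySeries μ X) (hP : ThetaP μ X u r)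
    (hr : Tendsto r atTop atTop) {ε : ℝ} (hε : 0 < ε) :
    ∃ m : ℕ, ∀ᶠ n in atTop, ∑ k ∈ Finset.Ioc m (r n), pairProb (μ.map (path X)) (u n) k
      ≤ ε * excProb (μ.map (path X)) (u n) := by
  have : IsProbabilityMeasure (μ.map (path X)) :=
    Measure.isProbabilityMeasure_map (measurable_path hX.1).aemeasurable
  obtain ⟨e, eLim, h1, h2, h3, h4⟩ := hP
  obtain ⟨m, hm⟩ := ((h3.hasSum.tendsto_sum_nat).eventually_const_lt
    (show ∑' k, eLim (k + 1) - ε < ∑' k, eLim (k + 1) by linarith)).exists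
  have split (f : ℕ → ℝ) : ∑ k ∈ Finset.Icc 1 m, f k = ∑ k ∈ Finset.range m, f (k + 1) := by
    rw [Finset.range_eq_Ico, Finset.sum_Ico_add' f 0 m 1]
    rfl
  have head : Tendsto (fun n => ∑ k ∈ Finset.Icc 1 m, e n k) atTop
      (𝓝 (∑ k ∈ Finset.range m, eLim (k + 1))) := by
    rw [← split]
    exact tendsto_finsetSum _ fun k hk => h2 k (Finset.mem_Icc.1 hk).1
  refine ⟨m, ?_⟩
  filter_upwards [(h4.sub head).eventually_lt_const
    (show ∑' k, eLim (k + 1) - ∑ k ∈ Finset.range m, eLim (k + 1) < ε by linarith),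
    hr.eventually_ge_atTop m] with n h5 h6
  have h7 : ∑ k ∈ Finset.Icc 1 m, e n k + ∑ k ∈ Finset.Ioc m (r n), e n k
      = ∑ k ∈ Finset.Icc 1 (r n), e n k := by
    have d : Finset.Icc 1 (r n) = Finset.Icc 1 m ∪ Finset.Ioc m (r n) := by
      ext k
      simp only [Finset.mem_union, Finset.mem_Icc, Finset.mem_Ioc]
      omega
    rw [d, Finset.sum_union]
    rw [Finset.disjoint_left]
    intro k hk hk'
    rw [Finset.mem_Icc] at hk
    rw [Finset.mem_Ioc] at hk'
    omega
  calc ∑ k ∈ Finset.Ioc m (r n), pairProb (μ.map (path X)) (u n) k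
      ≤ ∑ k ∈ Finset.Ioc m (r n), excProb (μ.map (path X)) (u n) * e n k := by
        refine Finset.sum_le_sum fun k hk => ?_
        rw [pairProb_eq_cond hX]
        rw [Finset.mem_Ioc] at hk
        exact mul_le_mul_of_nonneg_left (h1 n k (by omega)) (excProb_nonneg _)
    _ = (∑ k ∈ Finset.Ioc m (r n), e n k) * excProb (μ.map (path X)) (u n) := by
        rw [← Finset.mul_sum, mul_comm]
    _ ≤ ε * excProb (μ.map (path X)) (u n) :=
        mul_le_mul_of_nonneg_right (by linarith) (excProb_nonneg _)

/-- Rounding `r` down to the multiple `s * (r / s)` removes fewer than `s = o(r)` times. Ratios of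
block lengths tend to `1`, and the second moment changes by `O(s v) = o(r v)`. -/
lemma rareEventArray (hX : IsStationarySeries μ X) [IsProbabilityMeasure (μ.map (path X))]
    (h1 : Theta1 μ X u s r) (h2 : Theta2 μ X u r c) (hP : ThetaP μ X u r) :
    RareEventArray (μ.map (path X)) u s (fun n => r n / s n)
      (fun n => (betaCoeff μ X n (s n - 1)).toReal) c := by
  obtain ⟨e1, e2, e3, e4, e5, e6, e7⟩ := h1
  have hv (n : ℕ) := exceedProb_eq hX u n
  simp only [hv] at e2 e5 e6
  rw [Theta2] at h2
  simp only [hv, sum_indicator_eq_cnt] at h2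
  have hq := tendsto_div_of_isLittleO e4 e3
  have sqr (n : ℕ) : s n * (r n / s n) ≤ r n := Nat.mul_div_le _ _
  have sqr' (n : ℕ) : ((s n * (r n / s n) : ℕ) : ℝ) ≤ r n := by exact_mod_cast sqr n
  have hr : Tendsto r atTop atTop := by
    refine tendsto_atTop_mono (fun n => ?_) hq
    exact Nat.div_le_self _ _
  have idx : ∀ᶠ n in atTop, 1 ≤ s n ∧ 1 ≤ r n / s n := by
    filter_upwards [e3.eventually_ge_atTop 1, hq.eventually_ge_atTop 1] with n a b using ⟨a, b⟩
  have near (n : ℕ) (hs : 1 ≤ s n) : (r n : ℝ) - ((s n * (r n / s n) : ℕ) : ℝ) ≤ s n := by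
    have := Nat.div_add_mod (r n) (s n)
    have h := Nat.mod_lt (r n) hs
    have h' : r n ≤ s n * (r n / s n) + s n := by omega
    have : (r n : ℝ) ≤ (s n * (r n / s n) : ℕ) + s n := by exact_mod_cast h'
    linarith
  have invq (C : ℝ) : Tendsto (fun n => C * (((r n / s n : ℕ) : ℝ))⁻¹) atTop (𝓝 0) := by
    have h := (tendsto_inv_atTop_zero.comp
      (tendsto_natCast_atTop_atTop (R := ℝ) |>.comp hq)).const_mul C
    rw [mul_zero] at h
    exact h
  have hratio : Tendsto (fun n => (r n : ℝ) / ((s n * (r n / s n) : ℕ) : ℝ)) atTop (𝓝 1) := by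
    have hi : Tendsto (fun n => 1 + 1 * (((r n / s n : ℕ) : ℝ))⁻¹) atTop (𝓝 1) := by
      simpa using (invq 1).const_add 1
    refine tendsto_of_tendsto_of_tendsto_of_le_of_le' tendsto_const_nhds hi ?_ ?_
    all_goals
      filter_upwards [idx] with n ⟨h1, h2⟩
      have hs : (0 : ℝ) < s n := by exact_mod_cast h1
      have hq : (0 : ℝ) < ((r n / s n : ℕ) : ℝ) := by exact_mod_cast h2
      have hsq : (0 : ℝ) < ((s n * (r n / s n) : ℕ) : ℝ) := by rw [Nat.cast_mul]; positivity
    · rw [le_div_iff₀ hsq, one_mul]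
      exact sqr' n
    · rw [div_le_iff₀ hsq]
      have : (1 + 1 * (((r n / s n : ℕ) : ℝ))⁻¹) * ((s n * (r n / s n) : ℕ) : ℝ)
          = ((s n * (r n / s n) : ℕ) : ℝ) + s n := by
        rw [Nat.cast_mul]
        field_simp
      rw [this]
      linarith [near n h1]
  refine ⟨map_path_shift hX, e3, hq, e2, ?_, ?_, ?_, fun n => ENNReal.toReal_nonneg, ?_, ?_, ?_⟩
  · exact squeeze_zero (fun n => mul_nonneg (by positivity) (excProb_nonneg _))
      (fun n => mul_le_mul_of_nonneg_right (sqr' n) (excProb_nonneg _)) e5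
  · exact squeeze_zero (fun n => by positivity)
      (fun n => div_le_div_of_nonneg_right (sqr' n) (Real.sqrt_nonneg _)) e6.tendsto_div_nhds_zero
  · have h := hratio.mul e7
    rw [mul_zero] at h
    refine h.congr' ?_
    filter_upwards [hr.eventually_ge_atTop 1] with n hn
    have : (r n : ℝ) ≠ 0 := by exact_mod_cast (by omega : r n ≠ 0)
    field_simp
  · filter_upwards [idx] with n ⟨hs, _⟩
    intro l f g hl hln hf hg hf1 hg1 hfd hgd
    have mp := (measurable_path hX.1).aemeasurable (μ := μ)
    rw [integral_map (f := fun x => f x * g x) mp (hf.mul hg).aestronglyMeasurable,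
      integral_map mp hf.aestronglyMeasurable,
      integral_map mp hg.aestronglyMeasurable]
    refine norm_integral_mul_sub_le_betaCoeff μ hX.1 hl (by omega) hf hg hf1 hg1 hfd ?_
    -- The coefficient with index `s - 1` compares times up to `l` with times from `l + s` on.
    rwa [show (l : ℤ) + (s n - 1 : ℕ) + 1 = l + s n by omega]
  · obtain ⟨C, hC0, hC⟩ := exists_pair_bound_of_tail (P := μ.map (path X)) (u := u) (K := r)
      (by simpa only [one_mul] using tail_of_thetaP hX hP hr one_pos)
    have pos := e2.eventually_gt_atTop 0
    have diff : Tendsto (fun n => (∫ x, cnt (u n) 0 (r n) x ^ 2 ∂(μ.map (path X))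
        - ∫ x, cnt (u n) 0 (s n * (r n / s n) : ℕ) x ^ 2 ∂(μ.map (path X)))
        / (((s n * (r n / s n) : ℕ) : ℝ) * excProb (μ.map (path X)) (u n))) atTop (𝓝 0) := by
      refine squeeze_zero' ?_ ?_ (invq (2 * C))
      all_goals
        filter_upwards [idx, hC, pos] with n ⟨h1, h2⟩ h4 h3
        obtain ⟨h5, h6⟩ := integral_sq_cnt_sub_le (map_path_shift hX) (u n) (sqr n)
        have hv : 0 < excProb (μ.map (path X)) (u n) :=
          pos_of_mul_pos_right h3 (by positivity)
      · exact div_nonneg h5 (by positivity)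
      · have hs : (0 : ℝ) < s n := by exact_mod_cast h1
        have hq : (0 : ℝ) < ((r n / s n : ℕ) : ℝ) := by exact_mod_cast h2
        rw [div_le_iff₀ (by rw [Nat.cast_mul]; positivity)]
        have h7 : ((r n : ℝ) - ((s n * (r n / s n) : ℕ) : ℝ))
            * (excProb (μ.map (path X)) (u n)
              + 2 * ∑ k ∈ Finset.Ioc 0 (r n), pairProb (μ.map (path X)) (u n) k)
            ≤ s n * (C * excProb (μ.map (path X)) (u n)) :=
          mul_le_mul (near n h1) h4 (add_nonneg hv.le (mul_nonneg zero_le_two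
            (Finset.sum_nonneg fun _ _ => pairProb_nonneg _ _))) hs.le
        have e2 : 2 * C * (((r n / s n : ℕ) : ℝ))⁻¹
            * (((s n * (r n / s n) : ℕ) : ℝ) * excProb (μ.map (path X)) (u n))
            = 2 * (s n * (C * excProb (μ.map (path X)) (u n))) := by
          rw [Nat.cast_mul]
          field_simp
        rw [e2]
        linarith
    have main := (hratio.mul h2).sub diff
    rw [one_mul, sub_zero] at main
    refine main.congr' ?_
    filter_upwards [hr.eventually_ge_atTop 1] with n hn
    have hr0 : (r n : ℝ) ≠ 0 := by exact_mod_cast (by omega : r n ≠ 0)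
    have hint : ∫ ω, cnt (u n) 0 (r n) (path X ω) ^ 2 ∂μ
        = ∫ x, cnt (u n) 0 (r n) x ^ 2 ∂(μ.map (path X)) := by
      rw [integral_map (measurable_path hX.1).aemeasurable
        (Measurable.aestronglyMeasurable (by fun_prop))]
    rw [hint]
    field_simp
    ring
  · intro ε hε
    obtain ⟨m, hm⟩ := tail_of_thetaP hX hP hr hε
    refine ⟨m, hm.mono fun n hn => le_trans ?_ hn⟩
    exact Finset.sum_le_sum_of_subset_of_nonneg (Finset.Ioc_subset_Ioc le_rfl (sqr n))
      fun _ _ _ => pairProb_nonneg _ _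

end Conditions

/-! ### The three estimators as ratios of local statistics -/

section Estimators

variable {Ω : Type*} [MeasurableSpace Ω] {μ : Measure Ω} [IsProbabilityMeasure μ]
  {X : ℤ → Ω → ℝ} {u : ℕ → ℝ} {s : ℕ → ℕ}

lemma indicator_blockMax (u : ℝ) (a b : ℤ) (ω : Ω) :
    Set.indicator {ω' | (u : EReal) < blockMax X a b ω'} (fun _ => (1 : ℝ)) ω
      = hit u a b (path X ω) := by
  have hsup : (u : EReal) < blockMax X a b ω ↔ ∃ t ∈ Finset.Icc a b, u < path X ω t := by
    simp [blockMax, Finset.lt_sup_iff, path]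
  by_cases h : ∃ t ∈ Finset.Icc a b, u < path X ω t
  · obtain ⟨t, ht, hx⟩ := h
    rw [hit_of_lt ht hx, Set.indicator_of_mem (by exact hsup.2 ⟨t, ht, hx⟩)]
  · rw [hit_of_not_exists h, Set.indicator_of_notMem (by exact fun hlt => h (hsup.1 hlt))]

lemma exceedCount_eq (n : ℕ) (ω : Ω) :
    exceedCount X u s n ω = cnt (u n) 0 ((n : ℤ) - s n + 1) (path X ω) :=
  sum_indicator_eq_cnt _ _ _

lemma disjointEstimator_eq (n : ℕ) (ω : Ω) :
    disjointEstimator X u s n ω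
      = (∑ i ∈ Finset.Ioc (0 : ℤ) ((n : ℤ) - s n + 1),
          (if 0 < s n ∧ (s n : ℤ) ∣ i - 1 then 1 else 0)
            * hit (u n) i (i + s n - 1) (path X ω))
        / cnt (u n) 0 ((n : ℤ) - s n + 1) (path X ω) := by
  rw [disjointEstimator, exceedCount_eq]
  congr 1
  simp only [indicator_blockMax, ite_mul, one_mul, zero_mul]
  -- For `s n = 0` the quotient `n / 0` is `0` and the estimator's sum is empty; the conjunct `0 < s
  -- n` makes the weighted sum vanish as well.
  rcases Nat.eq_zero_or_pos (s n) with h0 | h0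
  · simp [h0]
  rw [← Finset.sum_filter]
  have hs : (0 : ℤ) < s n := by exact_mod_cast h0
  -- Block `i` starts at `(i - 1) s + 1`, and `i ≤ n / s` is equivalent to this start being at most
  -- `n - s + 1`.
  refine Finset.sum_bij (fun i _ => (i - 1) * s n + 1) (fun i hi => ?_) (fun i _ k _ h => ?_)
    (fun i hi => ?_) fun i _ => ?_
  · rw [Finset.mem_Icc, Int.natCast_div, Int.le_ediv_iff_mul_le hs] at hi
    rw [Finset.mem_filter, Finset.mem_Ioc]
    refine ⟨⟨?_, ?_⟩, h0, ?_⟩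
    · have : 0 ≤ (i - 1) * s n := mul_nonneg (by linarith [hi.1]) hs.le
      linarith
    · linarith [hi.2]
    · rw [add_sub_cancel_right]
      exact Dvd.intro_left _ rfl
  · have := mul_right_cancel₀ hs.ne' (add_right_cancel h)
    linarith
  · rw [Finset.mem_filter, Finset.mem_Ioc] at hi
    obtain ⟨⟨h1, h2⟩, -, a, ha⟩ := hi
    refine ⟨a + 1, ?_, by linarith⟩
    rw [Finset.mem_Icc, Int.natCast_div, Int.le_ediv_iff_mul_le hs]
    constructor
    · have : 0 ≤ (s n : ℤ) * a := by linarith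
      have := nonneg_of_mul_nonneg_right this hs
      linarith
    · linarith
  · congr 1
    ring

lemma slidingEstimator_eq (n : ℕ) (ω : Ω) :
    slidingEstimator X u s n ω
      = (∑ i ∈ Finset.Ioc (0 : ℤ) ((n : ℤ) - s n + 1),
          1 / (s n : ℝ) * hit (u n) i (i + s n - 1) (path X ω))
        / cnt (u n) 0 ((n : ℤ) - s n + 1) (path X ω) := by
  simp only [slidingEstimator, indicator_blockMax, Finset.mul_sum, exceedCount_eq,
    Icc_one_eq_Ioc_zero]

lemma indicator_runEnd (u : ℝ) (s : ℕ) (i : ℤ) (ω : Ω) :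
    Set.indicator {ω' | u < X i ω' ∧ blockMax X (i + 1) (i + s - 1) ω' ≤ (u : EReal)}
      (fun _ => (1 : ℝ)) ω = runEnd u s i (path X ω) := by
  have h := indicator_blockMax (X := X) u (i + 1) (i + s - 1) ω
  rw [runEnd, ← h]
  by_cases h1 : u < X i ω <;> by_cases h2 : (u : EReal) < blockMax X (i + 1) (i + s - 1) ω
  · rw [Set.indicator_of_notMem (fun hh => hh.2.not_gt h2), Set.indicator_of_mem (by exact h2)]
    ring
  · rw [Set.indicator_of_mem (by exact ⟨h1, not_lt.1 h2⟩), Set.indicator_of_notMem (by exact h2),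
      exc_of_lt (by exact h1)]
    ring
  · rw [Set.indicator_of_notMem (fun hh => hh.2.not_gt h2), Set.indicator_of_mem (by exact h2)]
    ring
  · rw [Set.indicator_of_notMem (fun hh => h1 hh.1), exc_of_not_lt (by exact h1)]
    ring

lemma runsEstimator_eq (n : ℕ) (ω : Ω) :
    runsEstimator X u s n ω
      = (∑ i ∈ Finset.Ioc (0 : ℤ) ((n : ℤ) - s n + 1), runEnd (u n) (s n) i (path X ω))
        / cnt (u n) 0 ((n : ℤ) - s n + 1) (path X ω) := by
  simp only [runsEstimator, indicator_runEnd, exceedCount_eq, Icc_one_eq_Ioc_zero]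

lemma tendsto_sqrt_mul_of_isLittleO {f a : ℕ → ℝ} (ha : Tendsto a atTop atTop)
    (h : f =o[atTop] fun n => a n ^ (-(1 / 2) : ℝ)) :
    Tendsto (fun n => √(a n) * f n) atTop (𝓝 0) := by
  refine h.tendsto_div_nhds_zero.congr' ?_
  filter_upwards [ha.eventually_gt_atTop 0] with n hn
  rw [Real.rpow_neg hn.le, ← Real.sqrt_eq_rpow, div_inv_eq_mul, mul_comm]

/-- All blocks of length `s` have the same hitting probability and the weights of a period sum to
`1`. Disjoint and sliding blocks therefore share the bias condition (B_b). -/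
lemma integral_sum_hit {P : Measure (ℤ → ℝ)} [IsProbabilityMeasure P]
    (hP : ∀ h, P.map (shift h) = P) {s : ℕ} {α : ℤ → ℝ} (hα : BlockWeights s α) (u : ℝ) :
    ∫ x, ∑ i ∈ Finset.Ioc (0 : ℤ) s, α i * hit u i (i + s - 1) x ∂P = ∫ x, hit u 1 s x ∂P := by
  have int (a b : ℤ) : Integrable (hit u a b) P :=
    integrable_of_measurable_of_bound (by fun_prop) 1 fun x => by
      rw [abs_of_nonneg (hit_nonneg _ _ _ _)]
      exact hit_le_one _ _ _ _
  have e (i : ℤ) : ∫ x, hit u i (i + s - 1) x ∂P = ∫ x, hit u 1 s x ∂P := by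
    rw [← integral_comp_shift hP (f := hit u 1 s) (measurable_hit u 1 s).stronglyMeasurable (i - 1)]
    simp only [hit_shift]
    ring_nf
  rw [integral_finsetSum _ fun i _ => (int _ _).const_mul _]
  simp only [integral_const_mul, e, ← Finset.sum_mul]
  have := hα.sum_eq s
  rw [sub_self] at this
  rw [this, one_mul]

lemma integral_sum_runEnd {P : Measure (ℤ → ℝ)} [IsProbabilityMeasure P]
    (hP : ∀ h, P.map (shift h) = P) (s : ℕ) (u : ℝ) :
    ∫ x, ∑ i ∈ Finset.Ioc (0 : ℤ) s, runEnd u s i x ∂P = s * ∫ x, runEnd u s 1 x ∂P := by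
  have int (i : ℤ) : Integrable (runEnd u s i) P :=
    integrable_of_measurable_of_bound (by fun_prop) 1 fun x => by
      rw [abs_of_nonneg (runEnd_nonneg _ _ _ _)]
      exact (runEnd_le_exc _ _ _ _).trans (exc_le_one _ _ _)
  have e (i : ℤ) : ∫ x, runEnd u s i x ∂P = ∫ x, runEnd u s 1 x ∂P := by
    rw [← integral_comp_shift hP (f := runEnd u s 1) (measurable_runEnd u s 1).stronglyMeasurable
      (i - 1)]
    simp only [runEnd_shift]
    ring_nf
  rw [integral_finsetSum _ fun i _ => int i]
  simp [e]

lemma cond_eq_integral_runEnd (hX : IsStationarySeries μ X)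
    [IsProbabilityMeasure (μ.map (path X))] (n : ℕ) :
    (μ[|{ω | u n < X 1 ω}]).real {ω | blockMax X 2 (s n) ω ≤ (u n : EReal)}
      = (∫ x, runEnd (u n) (s n) 1 x ∂(μ.map (path X))) / exceedProb μ X u n := by
  have m1 : MeasurableSet {ω | u n < X 1 ω} := measurableSet_lt measurable_const (hX.1 1)
  have m2 : MeasurableSet {ω | blockMax X 2 (s n) ω ≤ (u n : EReal)} := by
    have : {ω | blockMax X 2 (s n) ω ≤ (u n : EReal)}
        = (path X ⁻¹' {y : ℤ → ℝ | ∃ t ∈ Finset.Icc (2 : ℤ) (s n), u n < y t})ᶜ := by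
      ext ω
      simp [blockMax, path]
    rw [this]
    exact (measurable_path hX.1 (measurableSet_hit _ _ _)).compl
  rw [measureReal_def, cond_apply m1, ENNReal.toReal_mul, ENNReal.toReal_inv, ← measureReal_def,
    ← measureReal_def, ← exceedProb, div_eq_inv_mul, ← integral_indicator_one (m1.inter m2),
    integral_map (measurable_path hX.1).aemeasurable
      (measurable_runEnd _ _ _).aestronglyMeasurable]
  congr 1
  refine integral_congr_ae (ae_of_all _ fun ω => ?_)
  dsimp only
  rw [← indicator_runEnd, show (1 : ℤ) + 1 = 2 by norm_num, add_sub_cancel_left]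
  rfl

end Estimators

end ExtremalIndex

theorem theorem3p1 {Ω : Type*} [MeasurableSpace Ω] (μ : Measure Ω) [IsProbabilityMeasure μ]
    (X : ℤ → Ω → ℝ) (hX : IsStationarySeries μ X)
    (θ : ℝ) (hθ : IsExtremalIndex μ X θ) (hθpos : 0 < θ)
    (u : ℕ → ℝ) (s r : ℕ → ℕ) (c : ℝ)
    (h1 : Theta1 μ X u s r) (h2 : Theta2 μ X u r c) (hP : ThetaP μ X u r) :
    (BiasBlocks μ X u s θ →
      ConvergesToCenteredNormal μ
        (fun n ω => Real.sqrt (n * exceedProb μ X u n) * (disjointEstimator X u s n ω - θ))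
        (θ * (θ * c - 1)) ∧
      ConvergesToCenteredNormal μ
        (fun n ω => Real.sqrt (n * exceedProb μ X u n) * (slidingEstimator X u s n ω - θ))
        (θ * (θ * c - 1))) ∧
    (BiasRuns μ X u s θ →
      ConvergesToCenteredNormal μ
        (fun n ω => Real.sqrt (n * exceedProb μ X u n) * (runsEstimator X u s n ω - θ))
        (θ * (θ * c - 1))) := by
  have : IsProbabilityMeasure (μ.map (path X)) :=
    Measure.isProbabilityMeasure_map (measurable_path hX.1).aemeasurable
  have hR := rareEventArray hX h1 h2 hP
  have hs : ∀ᶠ n in atTop, 1 ≤ s n := h1.block_length.eventually_ge_atTop 1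
  -- Both blocks estimators are instances of one statement about arbitrary block weights.
  have blocks {α : ℕ → ℤ → ℝ} (hα : ∀ᶠ n in atTop, BlockWeights (s n) (α n))
      (hB : BiasBlocks μ X u s θ) {est : ℕ → Ω → ℝ}
      (hest : ∀ n ω, est n ω = (∑ i ∈ Finset.Ioc (0 : ℤ) ((n : ℤ) - s n + 1),
          α n i * hit (u n) i (i + s n - 1) (path X ω))
        / cnt (u n) 0 ((n : ℤ) - s n + 1) (path X ω)) :
      ConvergesToCenteredNormal μ
        (fun n ω => Real.sqrt (n * exceedProb μ X u n) * (est n ω - θ)) (θ * (θ * c - 1)) := by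
    obtain ⟨h0, h⟩ := hR.tendstoInDistribution_ratio
      (t := fun n i x => α n i * hit (u n) i (i + s n - 1) x) (fun n i => by fun_prop)
      (hα.mono fun n h => h.numeratorStatistic (u n)) hθpos.le (by
        have hb := tendsto_sqrt_mul_of_isLittleO h1.exceed_count hB
        refine hb.congr' ?_
        filter_upwards [hα] with n hn
        rw [integral_sum_hit hR.inv hn, measureReal_eq_integral_hit hX, exceedProb_eq hX])
      (hR.tendsto_key_blocks hα)
    refine ⟨h0, ?_⟩
    simp only [hest, exceedProb_eq hX]
    exact tendstoInDistribution_comp_path hX.1 h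
  refine ⟨fun hB => ⟨blocks (hs.mono fun n hn => blockWeights_disjoint hn) hB disjointEstimator_eq,
    blocks (hs.mono fun n hn => blockWeights_sliding hn) hB slidingEstimator_eq⟩, fun hB => ?_⟩
  obtain ⟨h0, h⟩ := hR.tendstoInDistribution_ratio (t := fun n => runEnd (u n) (s n))
    (fun n i => by fun_prop) (hs.mono fun n h => numeratorStatistic_runEnd (u n) h) hθpos.le (by
      have hb := tendsto_sqrt_mul_of_isLittleO h1.exceed_count hB
      refine hb.congr' ?_
      filter_upwards [hs] with n hn
      have : (s n : ℝ) ≠ 0 := by exact_mod_cast (by omega : s n ≠ 0)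
      rw [integral_sum_runEnd hR.inv, cond_eq_integral_runEnd hX, mul_div_mul_left _ _ this,
        exceedProb_eq hX])
    hR.tendsto_key_runs
  refine ⟨h0, ?_⟩
  simp only [runsEstimator_eq, exceedProb_eq hX]
  exact tendstoInDistribution_comp_path hX.1 h
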